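/- **Theorem 1.** Let $N\ge 1$ and let $\Omega\subset\mathbb{R}^N$ be a bounded domain with smooth boundary $\partial\Omega$. Let $p,q\in(1,\infty)$ with $p\neq q$, and let $a\in L^\infty(\Omega)$, $b\in L^\infty(\partial\Omega)$ be nonnegative functions with $$\int_\Omega a\,dx+\int_{\partial\Omega} b\,d\sigma>0 .$$ Put $W:=W^{1,\max\{p,q\}}(\Omega)$; boundary values of elements of $W$ are understood in the sense of traces. A number $\lambda\in\mathbb{R}$ is called an eigenvalue of the problem $$-\Delta_p u-\Delta_q u=\lambda a|u|^{q-2}u\ \text{ in }\Omega,\qquad \big(|\nabla u|^{p-2}+|\nabla u|^{q-2}\big)\frac{\partial u}{\partial\nu}=\lambda b|u|^{q-2}u\ \text{ on }\partial\Omega$$ if there is $u\in W\setminus\{0\}$ such that, for all $w\in W$, $$\int_\Omega\big(|\nabla u|^{p-2}+|\nabla u|^{q-2}\big)\nabla u\cdot\nabla w\,dx=\lambda\Big(\int_\Omega a|u|^{q-2}uw\,dx+\int_{\partial\Omega}b|u|^{q-2}uw\,d\sigma\Big).$$ Let $$\mathcal C:=\Big\{u\in W:\ \int_\Omega a|u|^{q-2}u\,dx+\int_{\partial\Omega}b|u|^{q-2}u\,d\sigma=0\Big\},\qquad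 \lambda_1:=\inf_{w\in\mathcal C\setminus\{0\}}\frac{\int_\Omega|\nabla w|^q\,dx}{\int_\Omega a|w|^q\,dx+\int_{\partial\Omega}b|w|^q\,d\sigma},$$ where a quotient whose denominator is $0$ counts as $+\infty$. Then $\lambda_1>0$, and the set of eigenvalues of the problem is exactly $\{0\}\cup(\lambda_1,\infty)$. Moreover $\lambda_1<\infty$ whenever $N\ge2$, or $\int_\Omega a\,dx>0$, or $b>0$ at every point of $\partial\Omega$. (In the remaining case, where $N=1$, $a=0$ a.e. and $b$ vanishes at one end point of the interval $\Omega$, one has $\lambda_1=+\infty$, and $\{0\}\cup(\lambda_1,\infty)$ is read as $\{0\}$.) -/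

import Mathlib

open MeasureTheory Filter Topology
open scoped ENNReal ContDiff

noncomputable section

namespace PQSteklov

/-- `ℝ^N` with its Euclidean norm and inner product. -/
abbrev Space (N : ℕ) : Type := EuclideanSpace ℝ (Fin N)

variable {N : ℕ}

/-- A bounded domain with smooth boundary: a bounded, connected, nonempty open set which, near each
of its boundary points, is the set of points lying on one side (in the direction of some unit vector
`e`) of the graph of a smooth function `γ` of the variables orthogonal to `e`. -/
structure IsSmoothBoundedDomain (Ω : Set (Space N)) : Prop where
  isOpen : IsOpen Ω
  isConnected : IsConnected Ω
  isBounded : Bornology.IsBounded Ω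
  smooth_boundary : ∀ x ∈ frontier Ω, ∃ e : Space N, ‖e‖ = 1 ∧ ∃ γ : Space N → ℝ,
    ContDiff ℝ ∞ γ ∧ (∀ (y : Space N) (t : ℝ), γ (y + t • e) = γ y) ∧
      ∃ r > 0, ∀ y ∈ Metric.ball x r, (y ∈ Ω ↔ γ y < inner ℝ e y)

/-- Lebesgue measure on `Ω`. -/
def domainMeasure (Ω : Set (Space N)) : Measure (Space N) :=
  volume.restrict Ω

/-- The surface measure on `∂Ω`: the `(N-1)`-dimensional Hausdorff measure, normalized so that it
agrees with Lebesgue measure on `(N-1)`-dimensional Euclidean space. -/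
def boundaryMeasure (Ω : Set (Space N)) : Measure (Space N) :=
  (Measure.euclideanHausdorffMeasure (N - 1)).restrict (frontier Ω)

/-- `g` is a weak (distributional) gradient of `u` in `Ω`: for each test function `φ ∈ C_c^∞(Ω)` and
each direction `v`, `∫_Ω u ∂_v φ = - ∫_Ω (g · v) φ`. -/
def HasWeakGradient (Ω : Set (Space N)) (u : Space N → ℝ) (g : Space N → Space N) : Prop :=
  LocallyIntegrableOn u Ω ∧ LocallyIntegrableOn g Ω ∧
    ∀ φ : Space N → ℝ, ContDiff ℝ ∞ φ → HasCompactSupport φ → tsupport φ ⊆ Ω →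
      ∀ v : Space N, ∫ x in Ω, u x * fderiv ℝ φ x v = - ∫ x in Ω, inner ℝ (g x) v * φ x

open Classical in
/-- The weak gradient of `u` in `Ω` (unique up to a null set when it exists). -/
def weakGradient (Ω : Set (Space N)) (u : Space N → ℝ) : Space N → Space N :=
  if h : ∃ g, HasWeakGradient Ω u g then h.choose else 0

/-- Membership in the Sobolev space `W^{1,r}(Ω)`. The values of `u` outside `Ω` and on null sets
play no role. -/
def MemSobolev (Ω : Set (Space N)) (r : ℝ) (u : Space N → ℝ) : Prop :=
  MemLp u (ENNReal.ofReal r) (domainMeasure Ω) ∧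
    ∃ g, HasWeakGradient Ω u g ∧ MemLp g (ENNReal.ofReal r) (domainMeasure Ω)

/-- `v ∈ L^r(∂Ω)` is a trace of `u ∈ W^{1,r}(Ω)`: there are functions `φ n ∈ C^∞(ℝ^N)` such that
`φ n → u` in `W^{1,r}(Ω)` and the restrictions of `φ n` to `∂Ω` tend to `v` in `L^r(∂Ω)`. -/
def IsTrace (Ω : Set (Space N)) (r : ℝ) (u v : Space N → ℝ) : Prop :=
  MemLp v (ENNReal.ofReal r) (boundaryMeasure Ω) ∧
    ∃ φ : ℕ → Space N → ℝ, (∀ n, ContDiff ℝ ∞ (φ n)) ∧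
      Tendsto (fun n => eLpNorm (fun x => φ n x - u x) (ENNReal.ofReal r) (domainMeasure Ω))
        atTop (𝓝 0) ∧
      Tendsto (fun n => eLpNorm (fun x => gradient (φ n) x - weakGradient Ω u x)
        (ENNReal.ofReal r) (domainMeasure Ω)) atTop (𝓝 0) ∧
      Tendsto (fun n => eLpNorm (fun x => φ n x - v x) (ENNReal.ofReal r) (boundaryMeasure Ω))
        atTop (𝓝 0)

open Classical in
/-- The trace on `∂Ω` of a function `u ∈ W^{1,r}(Ω)` (unique up to a null set of `∂Ω`). -/
def trace (Ω : Set (Space N)) (r : ℝ) (u : Space N → ℝ) : Space N → ℝ :=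
  if h : ∃ v, IsTrace Ω r u v then h.choose else 0

/-- `∫_Ω (|∇u|^{p-2} + |∇u|^{q-2}) ∇u · ∇w dx`. -/
def pqForm (Ω : Set (Space N)) (p q : ℝ) (u w : Space N → ℝ) : ℝ :=
  ∫ x, (‖weakGradient Ω u x‖ ^ (p - 2) + ‖weakGradient Ω u x‖ ^ (q - 2)) *
    inner ℝ (weakGradient Ω u x) (weakGradient Ω w x) ∂(domainMeasure Ω)

/-- `∫_Ω a |u|^{q-2} u w dx + ∫_{∂Ω} b |u|^{q-2} u w dσ` for `u, w ∈ W^{1,max(p,q)}(Ω)`, with the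
boundary values taken in the sense of traces. -/
def weightForm (Ω : Set (Space N)) (p q : ℝ) (a b : Space N → ℝ) (u w : Space N → ℝ) : ℝ :=
  (∫ x, a x * |u x| ^ (q - 2) * u x * w x ∂(domainMeasure Ω)) +
    ∫ x, b x * |trace Ω (max p q) u x| ^ (q - 2) * trace Ω (max p q) u x *
      trace Ω (max p q) w x ∂(boundaryMeasure Ω)

/-- `lam` is an eigenvalue: there is `u ∈ W \ {0}`, `W = W^{1,max(p,q)}(Ω)`, which satisfies the weak
form of the problem against each `w ∈ W`. -/
def IsEigenvalue (Ω : Set (Space N)) (p q : ℝ) (a b : Space N → ℝ) (lam : ℝ) : Prop :=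
  ∃ u : Space N → ℝ, MemSobolev Ω (max p q) u ∧ ¬ (u =ᵐ[domainMeasure Ω] 0) ∧
    ∀ w : Space N → ℝ, MemSobolev Ω (max p q) w →
      pqForm Ω p q u w = lam * weightForm Ω p q a b u w

/-- The cone `𝒞`: the `u ∈ W` with `∫_Ω a |u|^{q-2} u dx + ∫_{∂Ω} b |u|^{q-2} u dσ = 0`. -/
def cone (Ω : Set (Space N)) (p q : ℝ) (a b : Space N → ℝ) : Set (Space N → ℝ) :=
  {u | MemSobolev Ω (max p q) u ∧
    (∫ x, a x * |u x| ^ (q - 2) * u x ∂(domainMeasure Ω)) +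
      (∫ x, b x * |trace Ω (max p q) u x| ^ (q - 2) * trace Ω (max p q) u x
        ∂(boundaryMeasure Ω)) = 0}

/-- The Rayleigh quotient `∫_Ω |∇w|^q dx / (∫_Ω a |w|^q dx + ∫_{∂Ω} b |w|^q dσ)` in `[0,∞]`; in
`ℝ≥0∞` a positive number divided by zero is `∞`. -/
def rayleigh (Ω : Set (Space N)) (p q : ℝ) (a b : Space N → ℝ) (w : Space N → ℝ) : ℝ≥0∞ :=
  ENNReal.ofReal (∫ x, ‖weakGradient Ω w x‖ ^ q ∂(domainMeasure Ω)) /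
    ENNReal.ofReal ((∫ x, a x * |w x| ^ q ∂(domainMeasure Ω)) +
      ∫ x, b x * |trace Ω (max p q) w x| ^ q ∂(boundaryMeasure Ω))

/-- `λ₁`, the infimum of the Rayleigh quotient over `𝒞 \ {0}`. -/
def lambdaOne (Ω : Set (Space N)) (p q : ℝ) (a b : Space N → ℝ) : ℝ≥0∞ :=
  ⨅ w ∈ {w | w ∈ cone Ω p q a b ∧ ¬ (w =ᵐ[domainMeasure Ω] 0)}, rayleigh Ω p q a b w

end PQSteklov

end

/-!
Write `B u` for the function `u` together with its boundary values, an element of `L^q` of the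
measure `μ = a dx + b dσ` (`weightMeasure`), and put `K u = ‖B u‖ ^ q`, `Q u = ‖∇u‖_q ^ q`,
`P u = ‖∇u‖_p ^ p`. The condition defining the cone says that `∫ |B u|^{q-2} B u dμ = 0`, that is,
that `c = 0` minimizes `K (u + c)` over the constants `c`: the cone consists of the functions that
are Birkhoff orthogonal to the constants in `L^q(μ)` (`birkhoffOrth_iff_dualForm_eq_zero`,
`mem_cone_iff`). In particular every function can be moved into the cone by adding a constant, and
`Q` and `P` do not notice this.

*Positivity of `λ₁`.* By the minimality, Poincaré's inequality (`poincare`) and the trace inequality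
(`weightMap_norm_le`) give `K ≤ C Q` on the cone.

*Eigenvalues are zero or exceed `λ₁`* (`IsEigenvalue.lambdaOne_lt`). Testing the equation with `1`
puts an eigenfunction `u` with `λ ≠ 0` into the cone; testing it with `u` gives `P + Q = λ K` with
`P > 0`.

*All `λ > λ₁` are eigenvalues* (`isEigenvalue_of_lambdaOne_lt`). The definition of `λ₁` provides an
element of the cone with `λ K - Q > 0`. By homogeneity `‖∇v‖_p` may be minimized over the `v` in the
cone with `λ K v - Q v ≥ 1`; this works alike for `p < q` and for `p > q`. The minimum is attained
(`exists_constrained_minimizer`) and the minimizer `w` satisfies, with `m = P w`,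
`∫ |∇w|^{p-2} ∇w·∇v + m ∫ |∇w|^{q-2} ∇w·∇v = m λ ∫ |B w|^{q-2} B w B v dμ`
for all `v` (`euler_lagrange`): the competitor `w + t v` has to be moved into the cone by a constant
`c`, but the tangent inequality of the convex function `K` at `w` has no term in `c`, `w` being in
the cone. Since `p ≠ q`, the factor `m` is absorbed by passing to `s w` with `s ^ (q - p) = m`.

No weak topology is used. Minimizing sequences have subsequences along which `B v` converges
(`coneCompact`, from Rellich's theorem `rellich` and the trace inequality with a small factor at the
gradient). Then midpoints almost satisfy the constraint, and the uniform convexity of `L^p`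
(`exists_Lp_norm_sub_rpow_le`) makes the gradients a Cauchy sequence.

*Finiteness of `λ₁`* (`lambdaOne_lt_top`). Unless `μ` is concentrated at a single point, some
coordinate function is not constant `μ`-almost everywhere (`exists_weightMap_ne_smul`), and moving
it into the cone gives a finite Rayleigh quotient. The hypotheses exclude point masses
(`not_ae_eq_point`).

The analysis on smooth domains uses the graph condition near a boundary point in two ways. From
points of the domain one may move inside a fixed cone of directions without leaving
the domain (`exists_coneCondition`), so that convolution with a kernel supported in the opposite
cone commutes with the weak gradient; this yields the density of smooth functions
(`exists_smooth_approx`), the estimate of translations by the gradient, and Rellich's theorem. From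
boundary points one may move along segments of fixed length, and Fubini's theorem over these
(`exists_collar`) yields the trace inequality.
-/

noncomputable section
namespace PQSteklov

variable {N : ℕ}

/-! ### Powers of the norm in an inner product space -/

section Pointwise

variable {E : Type*} [NormedAddCommGroup E] [InnerProductSpace ℝ E]

theorem norm_rpow_sub_two_mul_sq {E : Type*} [NormedAddCommGroup E] {q : ℝ} (hq : 1 < q) (x : E) :
    ‖x‖ ^ (q - 2) * ‖x‖ ^ 2 = ‖x‖ ^ q := by
  rcases eq_or_ne x 0 with rfl | hx
  · rw [norm_zero, Real.zero_rpow (by linarith : q ≠ 0)]; simp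
  · have h : 0 < ‖x‖ := norm_pos_iff.mpr hx
    rw [← Real.rpow_natCast, ← Real.rpow_add h]; congr 1; push_cast; ring

theorem norm_rpow_sub_two_mul_norm {E : Type*} [NormedAddCommGroup E] {q : ℝ} (hq : 1 < q) (x : E) :
    ‖x‖ ^ (q - 2) * ‖x‖ = ‖x‖ ^ (q - 1) := by
  rcases eq_or_ne x 0 with rfl | hx
  · rw [norm_zero, Real.zero_rpow (by linarith : q - 1 ≠ 0)]; simp
  · have h : 0 < ‖x‖ := norm_pos_iff.mpr hx
    nth_rewrite 2 [← Real.rpow_one ‖x‖]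
    rw [← Real.rpow_add h]; congr 1; ring

theorem abs_norm_rpow_mul_inner_le {q : ℝ} (hq : 1 < q) (x y : E) :
    |‖x‖ ^ (q - 2) * inner ℝ x y| ≤ ‖x‖ ^ (q - 1) * ‖y‖ := by
  rw [abs_mul, abs_of_nonneg (by positivity), ← norm_rpow_sub_two_mul_norm hq, mul_assoc]
  gcongr
  exact abs_real_inner_le_norm x y

/-- Young's inequality for the conjugate exponents `q / (q - 1)` and `q`. -/
theorem rpow_sub_one_mul_le {q a b : ℝ} (hq : 1 < q) (ha : 0 ≤ a) (hb : 0 ≤ b) :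
    q * (a ^ (q - 1) * b) ≤ (q - 1) * a ^ q + b ^ q := by
  have h := Real.young_inequality_of_nonneg hb (Real.rpow_nonneg ha (q - 1))
    (Real.HolderConjugate.conjExponent hq)
  rw [← Real.rpow_mul ha] at h
  have hq1 : q - 1 ≠ 0 := by linarith
  have e1 : (q - 1) * q.conjExponent = q := by
    unfold Real.conjExponent; field_simp
  rw [e1] at h
  have e2 : a ^ q / q.conjExponent = a ^ q * (q - 1) / q := by
    unfold Real.conjExponent; field_simp
  rw [e2] at h
  have hq0 : 0 < q := by linarith
  calc q * (a ^ (q - 1) * b) = q * (b * a ^ (q - 1)) := by ring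
    _ ≤ q * (b ^ q / q + a ^ q * (q - 1) / q) := by gcongr
    _ = (q - 1) * a ^ q + b ^ q := by field_simp; ring

/-- The tangent inequality of the convex function `‖·‖ ^ q`. -/
theorem norm_rpow_add_inner_le {q : ℝ} (hq : 1 < q) (x y : E) :
    ‖x‖ ^ q + q * (‖x‖ ^ (q - 2) * inner ℝ x y) ≤ ‖x + y‖ ^ q := by
  have h1 : ‖x‖ ^ (q - 2) * inner ℝ x (x + y) ≤ ‖x‖ ^ (q - 1) * ‖x + y‖ :=
    (le_abs_self _).trans (abs_norm_rpow_mul_inner_le hq x (x + y))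
  have h2 := rpow_sub_one_mul_le hq (norm_nonneg x) (norm_nonneg (x + y))
  rw [inner_add_right, real_inner_self_eq_norm_sq, mul_add, norm_rpow_sub_two_mul_sq hq] at h1
  nlinarith

theorem norm_midpoint_rpow_le {X : Type*} [NormedAddCommGroup X] [NormedSpace ℝ X] {q : ℝ}
    (hq : 1 ≤ q) (x y : X) :
    ‖(1 / 2 : ℝ) • (x + y)‖ ^ q ≤ (‖x‖ ^ q + ‖y‖ ^ q) / 2 := by
  have h1 : ‖(1 / 2 : ℝ) • (x + y)‖ ≤ (1 / 2 : ℝ) • ‖x‖ + (1 / 2 : ℝ) • ‖y‖ := by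
    rw [norm_smul]; norm_num; linarith [norm_add_le x y]
  calc ‖(1 / 2 : ℝ) • (x + y)‖ ^ q ≤ ((1 / 2 : ℝ) • ‖x‖ + (1 / 2 : ℝ) • ‖y‖) ^ q := by gcongr
    _ ≤ (1 / 2 : ℝ) • ‖x‖ ^ q + (1 / 2 : ℝ) • ‖y‖ ^ q :=
      (convexOn_rpow hq).2 (norm_nonneg x) (norm_nonneg y) (by norm_num) (by norm_num)
        (by norm_num)
    _ = _ := by simp only [smul_eq_mul]; ring

theorem norm_midpoint_rpow_lt {q : ℝ} (hq : 1 < q) {x y : E} (hxy : x ≠ y) :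
    ‖(1 / 2 : ℝ) • (x + y)‖ ^ q < (‖x‖ ^ q + ‖y‖ ^ q) / 2 := by
  by_cases h : ‖x‖ = ‖y‖
  · have h1 : ‖x + y‖ < ‖x‖ + ‖y‖ := by
      refine lt_of_le_of_ne (norm_add_le x y) fun he => hxy ?_
      exact (sameRay_iff_norm_add.mpr he).eq_of_norm_eq h
    have h2 : ‖(1 / 2 : ℝ) • (x + y)‖ < ‖x‖ := by
      rw [norm_smul]; norm_num; linarith
    calc ‖(1 / 2 : ℝ) • (x + y)‖ ^ q < ‖x‖ ^ q := by gcongr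
      _ = _ := by rw [← h]; ring
  · have h1 : ‖(1 / 2 : ℝ) • (x + y)‖ ≤ (1 / 2 : ℝ) • ‖x‖ + (1 / 2 : ℝ) • ‖y‖ := by
      rw [norm_smul]; norm_num; linarith [norm_add_le x y]
    calc ‖(1 / 2 : ℝ) • (x + y)‖ ^ q ≤ ((1 / 2 : ℝ) • ‖x‖ + (1 / 2 : ℝ) • ‖y‖) ^ q := by gcongr
      _ < (1 / 2 : ℝ) • ‖x‖ ^ q + (1 / 2 : ℝ) • ‖y‖ ^ q :=
        (strictConvexOn_rpow hq).2 (norm_nonneg x) (norm_nonneg y) h (by norm_num) (by norm_num)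
          (by norm_num)
      _ = _ := by simp only [smul_eq_mul]; ring

/-- Uniform convexity of `‖·‖ ^ p` on a finite-dimensional space. By homogeneity it is enough to
argue on the compact set `‖x‖ ^ p + ‖y‖ ^ p = 1`, where strict convexity gives a positive minimum. -/
theorem exists_norm_sub_rpow_le [FiniteDimensional ℝ E] {p : ℝ} (hp : 1 < p) {ε : ℝ} (hε : 0 < ε) :
    ∃ C : ℝ, 0 ≤ C ∧ ∀ x y : E, ‖x - y‖ ^ p ≤ ε * (‖x‖ ^ p + ‖y‖ ^ p) +
      C * ((‖x‖ ^ p + ‖y‖ ^ p) / 2 - ‖(1 / 2 : ℝ) • (x + y)‖ ^ p) := by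
  have hp0 : 0 < p := by linarith
  set Δ : E × E → ℝ := fun z => (‖z.1‖ ^ p + ‖z.2‖ ^ p) / 2 - ‖(1 / 2 : ℝ) • (z.1 + z.2)‖ ^ p
    with hΔ
  have hcr : ∀ {f : E × E → E}, Continuous f → Continuous fun z => ‖f z‖ ^ p := fun hf =>
    hf.norm.rpow_const fun _ => Or.inr hp0.le
  have hΔc : Continuous Δ := by
    refine (((hcr continuous_fst).add (hcr continuous_snd)).div_const 2).sub (hcr ?_)
    fun_prop
  have hΔ0 : ∀ z, 0 ≤ Δ z := fun z => sub_nonneg.mpr (norm_midpoint_rpow_le hp.le z.1 z.2)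
  -- on the set where `‖x‖ ^ p + ‖y‖ ^ p = 1` the pairs with `‖x - y‖ ^ p < ε` need no second term,
  -- and on the compact rest `Δ` is bounded below
  have key : ∃ C : ℝ, 0 ≤ C ∧ ∀ z : E × E, ‖z.1‖ ^ p + ‖z.2‖ ^ p = 1 →
      ‖z.1 - z.2‖ ^ p ≤ ε + C * Δ z := by
    set K : Set (E × E) := {z | ‖z.1‖ ^ p + ‖z.2‖ ^ p = 1 ∧ ε ≤ ‖z.1 - z.2‖ ^ p} with hK
    have hle : ∀ z : E × E, ‖z.1‖ ^ p + ‖z.2‖ ^ p = 1 → ‖z.1‖ ≤ 1 ∧ ‖z.2‖ ≤ 1 := by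
      intro z hz
      have h1 : 0 ≤ ‖z.1‖ ^ p := by positivity
      have h2 : 0 ≤ ‖z.2‖ ^ p := by positivity
      constructor
      · by_contra! h
        have := Real.one_lt_rpow h hp0
        linarith
      · by_contra! h
        have := Real.one_lt_rpow h hp0
        linarith
    have hKc : IsCompact K := by
      refine Metric.isCompact_of_isClosed_isBounded ?_ ?_
      · exact (isClosed_eq ((hcr continuous_fst).add (hcr continuous_snd)) continuous_const).inter
          (isClosed_le continuous_const (hcr (continuous_fst.sub continuous_snd)))
      · refine (Metric.isBounded_closedBall (x := (0 : E × E)) (r := 1)).subset fun z hz => ?_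
        rw [mem_closedBall_zero_iff]
        exact max_le (hle z hz.1).1 (hle z hz.1).2
    have h2p : ∀ z : E × E, ‖z.1‖ ^ p + ‖z.2‖ ^ p = 1 → ‖z.1 - z.2‖ ^ p ≤ 2 ^ p := by
      intro z hz
      have := hle z hz
      gcongr
      linarith [norm_sub_le z.1 z.2]
    rcases K.eq_empty_or_nonempty with he | hne
    · refine ⟨0, le_rfl, fun z hz => ?_⟩
      by_contra! h
      have : z ∈ K := ⟨hz, by linarith⟩
      simp [he] at this
    · obtain ⟨z₀, hz₀, hmin⟩ := hKc.exists_isMinOn hne hΔc.continuousOn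
      have hpos : 0 < Δ z₀ := by
        refine sub_pos.mpr (norm_midpoint_rpow_lt hp fun h => ?_)
        have := hz₀.2
        rw [h, sub_self, norm_zero, Real.zero_rpow hp0.ne'] at this
        linarith
      refine ⟨2 ^ p / Δ z₀, by positivity, fun z hz => ?_⟩
      by_cases h : ε ≤ ‖z.1 - z.2‖ ^ p
      · have h1 : Δ z₀ ≤ Δ z := hmin ⟨hz, h⟩
        have h2 : (2 : ℝ) ^ p ≤ 2 ^ p / Δ z₀ * Δ z := by
          rw [div_mul_eq_mul_div, le_div_iff₀ hpos]
          gcongr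
        linarith [h2p z hz]
      · have : 0 ≤ 2 ^ p / Δ z₀ * Δ z := mul_nonneg (by positivity) (hΔ0 z)
        linarith
  obtain ⟨C, hC0, hC⟩ := key
  refine ⟨C, hC0, fun x y => ?_⟩
  set S := ‖x‖ ^ p + ‖y‖ ^ p with hS
  have hS0 : 0 ≤ S := by positivity
  rcases hS0.eq_or_lt with h0 | hpos
  · have hx : ‖x‖ ^ p = 0 := by
      have : 0 ≤ ‖y‖ ^ p := by positivity
      have : 0 ≤ ‖x‖ ^ p := by positivity
      linarith
    have hy : ‖y‖ ^ p = 0 := by linarith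
    have hx' : x = 0 := norm_eq_zero.mp ((Real.rpow_eq_zero (norm_nonneg x) hp0.ne').mp hx)
    have hy' : y = 0 := norm_eq_zero.mp ((Real.rpow_eq_zero (norm_nonneg y) hp0.ne').mp hy)
    simp [hS, hx', hy', Real.zero_rpow hp0.ne']
  · set s := S ^ (-(1 / p)) with hs
    have hspos : 0 < s := Real.rpow_pos_of_pos hpos _
    have hsp : s ^ p = S⁻¹ := by
      rw [hs, ← Real.rpow_mul hS0, ← Real.rpow_neg_one]; congr 1; field_simp
    have hn : ∀ v : E, ‖s • v‖ ^ p = S⁻¹ * ‖v‖ ^ p := fun v => by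
      rw [norm_smul, Real.norm_of_nonneg hspos.le, Real.mul_rpow hspos.le (norm_nonneg v), hsp]
    have h := hC (s • x, s • y) (by
      simp only [hn]; rw [← mul_add]; exact inv_mul_cancel₀ hpos.ne')
    simp only [hΔ, ← smul_sub, ← smul_add, smul_comm (1 / 2 : ℝ) s, hn] at h
    have h3 := mul_le_mul_of_nonneg_left h hS0
    rw [← mul_assoc, mul_inv_cancel₀ hpos.ne', one_mul] at h3
    refine h3.trans (le_of_eq ?_)
    field_simp
    rw [hS]

end Pointwise

/-! ### Powers of the norm of `L^q` and their derivatives -/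

section Integral

variable {α : Type*} [MeasurableSpace α] {m : Measure α}
variable {E : Type*} [NormedAddCommGroup E] [InnerProductSpace ℝ E]

theorem MemLp_integrable_rpow {F : Type*} [NormedAddCommGroup F] {q : ℝ} (hq : 1 < q) {f : α → F}
    (hf : MemLp f (ENNReal.ofReal q) m) :
    Integrable (fun x => ‖f x‖ ^ q) m := by
  have := hf.integrable_norm_rpow (by simp; linarith) ENNReal.ofReal_ne_top
  rwa [ENNReal.toReal_ofReal (by linarith)] at this

/-- The form `∫ |f|^{q-2} f · g`, the derivative of `(1/q) ∫ |f|^q` in the direction `g`. -/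
def dualForm (m : Measure α) (q : ℝ) (f g : α → E) : ℝ :=
  ∫ x, ‖f x‖ ^ (q - 2) * inner ℝ (f x) (g x) ∂m

theorem aestronglyMeasurable_dualForm {q : ℝ} {f g : α → E} (hf : AEStronglyMeasurable f m)
    (hg : AEStronglyMeasurable g m) :
    AEStronglyMeasurable (fun x => ‖f x‖ ^ (q - 2) * inner ℝ (f x) (g x)) m :=
  (hf.norm.aemeasurable.pow_const _).aestronglyMeasurable.mul (hf.inner hg)

theorem integrable_dualForm {q : ℝ} (hq : 1 < q) {f g : α → E}
    (hf : MemLp f (ENNReal.ofReal q) m) (hg : MemLp g (ENNReal.ofReal q) m) :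
    Integrable (fun x => ‖f x‖ ^ (q - 2) * inner ℝ (f x) (g x)) m := by
  refine Integrable.mono' (((MemLp_integrable_rpow hq hf).const_mul (q - 1)).add
    (MemLp_integrable_rpow hq hg)) (aestronglyMeasurable_dualForm hf.1 hg.1) (ae_of_all _ fun x => ?_)
  have h1 := abs_norm_rpow_mul_inner_le hq (f x) (g x)
  have h2 := rpow_sub_one_mul_le hq (norm_nonneg (f x)) (norm_nonneg (g x))
  have h3 : 0 ≤ ‖f x‖ ^ (q - 1) * ‖g x‖ := by positivity
  simp only [Pi.add_apply, Real.norm_eq_abs]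
  nlinarith

theorem dualForm_add_right {q : ℝ} (hq : 1 < q) {f g h : α → E}
    (hf : MemLp f (ENNReal.ofReal q) m) (hg : MemLp g (ENNReal.ofReal q) m)
    (hh : MemLp h (ENNReal.ofReal q) m) :
    dualForm m q f (g + h) = dualForm m q f g + dualForm m q f h := by
  unfold dualForm
  rw [← integral_add (integrable_dualForm hq hf hg) (integrable_dualForm hq hf hh)]
  simp only [Pi.add_apply, inner_add_right, mul_add]

theorem dualForm_smul_right {q : ℝ} (f g : α → E) (c : ℝ) :
    dualForm m q f (c • g) = c * dualForm m q f g := by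
  unfold dualForm
  rw [← integral_const_mul]
  congr 1; ext x
  simp only [Pi.smul_apply, inner_smul_right]; ring

theorem dualForm_smul_left {q : ℝ} (f g : α → E) {c : ℝ} (hc : 0 < c) :
    dualForm m q (c • f) g = c ^ (q - 1) * dualForm m q f g := by
  unfold dualForm
  rw [← integral_const_mul]
  congr 1; ext x
  simp only [Pi.smul_apply, real_inner_smul_left, norm_smul, Real.norm_of_nonneg hc.le]
  rw [Real.mul_rpow hc.le (norm_nonneg _)]
  have : c ^ (q - 1) = c ^ (q - 2) * c := by
    rw [← Real.rpow_add_one hc.ne']; congr 1; ring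
  rw [this]; ring

theorem dualForm_congr {q : ℝ} {f g f' g' : α → E} (hf : f =ᵐ[m] f') (hg : g =ᵐ[m] g') :
    dualForm m q f g = dualForm m q f' g' := by
  refine integral_congr_ae ?_
  filter_upwards [hf, hg] with x h1 h2
  rw [h1, h2]

theorem dualForm_self {q : ℝ} (hq : 1 < q) (f : α → E) :
    dualForm m q f f = ∫ x, ‖f x‖ ^ q ∂m := by
  unfold dualForm
  congr 1; ext x
  rw [real_inner_self_eq_norm_sq, norm_rpow_sub_two_mul_sq hq]

/-- The integrated tangent inequality: `q * dualForm m q f` is a subgradient of `∫ ‖·‖ ^ q` at `f`. -/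
theorem integral_rpow_add_dualForm_le {q : ℝ} (hq : 1 < q) {f g : α → E}
    (hf : MemLp f (ENNReal.ofReal q) m) (hg : MemLp g (ENNReal.ofReal q) m) :
    ∫ x, ‖f x‖ ^ q ∂m + q * dualForm m q f g ≤ ∫ x, ‖f x + g x‖ ^ q ∂m := by
  unfold dualForm
  rw [← integral_const_mul, ← integral_add (MemLp_integrable_rpow hq hf)
    ((integrable_dualForm hq hf hg).const_mul q)]
  exact integral_mono ((MemLp_integrable_rpow hq hf).add
    ((integrable_dualForm hq hf hg).const_mul q)) (MemLp_integrable_rpow hq (hf.add hg))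
    fun x => norm_rpow_add_inner_le hq (f x) (g x)

theorem hasDerivAt_integral_norm_rpow {q : ℝ} (hq : 1 < q) {f g : α → E}
    (hf : MemLp f (ENNReal.ofReal q) m) (hg : MemLp g (ENNReal.ofReal q) m) :
    HasDerivAt (fun t : ℝ => ∫ x, ‖f x + t • g x‖ ^ q ∂m) (q * dualForm m q f g) 0 := by
  have hfg : ∀ t : ℝ, MemLp (fun x => f x + t • g x) (ENNReal.ofReal q) m := fun t =>
    hf.add (hg.const_smul t)
  have hsum : MemLp (fun x => ‖f x‖ + ‖g x‖) (ENNReal.ofReal q) m := hf.norm.add hg.norm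
  have hb : Integrable (fun x => q * (‖f x‖ + ‖g x‖) ^ q) m := by
    have := (MemLp_integrable_rpow hq hsum).const_mul q
    refine this.congr (ae_of_all _ fun x => ?_)
    change q * ‖‖f x‖ + ‖g x‖‖ ^ q = _
    rw [Real.norm_of_nonneg (add_nonneg (norm_nonneg (f x)) (norm_nonneg (g x)))]
  have h := hasDerivAt_integral_of_dominated_loc_of_deriv_le (μ := m) (x₀ := (0 : ℝ))
    (s := Metric.ball 0 1) (F := fun t x => ‖f x + t • g x‖ ^ q)
    (F' := fun t x => q * (‖f x + t • g x‖ ^ (q - 2) * inner ℝ (f x + t • g x) (g x)))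
    (bound := fun x => q * (‖f x‖ + ‖g x‖) ^ q) (Metric.ball_mem_nhds _ one_pos)
    (Eventually.of_forall fun t => (MemLp_integrable_rpow hq (hfg t)).1)
    (MemLp_integrable_rpow hq (hfg 0))
    (((integrable_dualForm hq (hfg 0) hg).const_mul q).1) ?_ hb ?_
  · have e : q * dualForm m q f g = ∫ x, q * (‖f x + (0 : ℝ) • g x‖ ^ (q - 2) *
        inner ℝ (f x + (0 : ℝ) • g x) (g x)) ∂m := by
      unfold dualForm
      rw [← integral_const_mul]
      simp
    rw [e]
    exact h.2
  · refine ae_of_all _ fun x t ht => ?_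
    have ht1 : |t| ≤ 1 := by
      have := (mem_ball_zero_iff.mp ht).le
      rwa [Real.norm_eq_abs] at this
    have h1 := abs_norm_rpow_mul_inner_le hq (f x + t • g x) (g x)
    have h2 : ‖f x + t • g x‖ ≤ ‖f x‖ + ‖g x‖ := by
      refine (norm_add_le _ _).trans ?_
      rw [norm_smul, Real.norm_eq_abs]
      gcongr
      exact mul_le_of_le_one_left (norm_nonneg _) ht1
    rw [norm_mul, Real.norm_of_nonneg (by linarith : (0 : ℝ) ≤ q)]
    gcongr
    calc _ ≤ ‖f x + t • g x‖ ^ (q - 1) * ‖g x‖ := h1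
      _ ≤ (‖f x‖ + ‖g x‖) ^ (q - 1) * (‖f x‖ + ‖g x‖) := by
        gcongr
        linarith [norm_nonneg (f x)]
      _ = (‖f x‖ + ‖g x‖) ^ q := by
        rw [← Real.rpow_add_one' (by positivity) (by linarith)]; congr 1; ring
  · refine ae_of_all _ fun x t _ => ?_
    have h1 : HasDerivAt (fun t : ℝ => f x + t • g x) (g x) t := by
      simpa using ((hasDerivAt_id t).smul_const (g x)).const_add (f x)
    have h2 := (hasFDerivAt_norm_rpow (f x + t • g x) hq).comp_hasDerivAt t h1
    exact h2.congr_deriv (mul_assoc _ _ _)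

theorem Lp_norm_rpow {F : Type*} [NormedAddCommGroup F] {q : ℝ} (hq : 1 < q)
    (f : Lp F (ENNReal.ofReal q) m) :
    ‖f‖ ^ q = ∫ x, ‖f x‖ ^ q ∂m := by
  have hq0 : 0 < q := by linarith
  have h0 : 0 ≤ ∫ x, ‖f x‖ ^ q ∂m := integral_nonneg fun x => by positivity
  rw [Lp.norm_def, (Lp.memLp f).eLpNorm_eq_integral_rpow_norm (by simpa using hq0)
    ENNReal.ofReal_ne_top, ENNReal.toReal_ofReal hq0.le, ENNReal.toReal_ofReal (by positivity),
    ← Real.rpow_mul h0, inv_mul_cancel₀ hq0.ne', Real.rpow_one]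

/-- Uniform convexity of `L^p`, in the form in which it turns the convergence of norms of midpoints
into the Cauchy property. -/
theorem exists_Lp_norm_sub_rpow_le [FiniteDimensional ℝ E] {p : ℝ} (hp : 1 < p) {ε : ℝ}
    (hε : 0 < ε) :
    ∃ C : ℝ, 0 ≤ C ∧ ∀ f g : Lp E (ENNReal.ofReal p) m, ‖f - g‖ ^ p ≤ ε * (‖f‖ ^ p + ‖g‖ ^ p) +
      C * ((‖f‖ ^ p + ‖g‖ ^ p) / 2 - ‖(1 / 2 : ℝ) • (f + g)‖ ^ p) := by
  obtain ⟨C, hC0, hC⟩ := exists_norm_sub_rpow_le (E := E) hp hε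
  refine ⟨C, hC0, fun f g => ?_⟩
  have hi : ∀ h : Lp E (ENNReal.ofReal p) m, Integrable (fun x => ‖h x‖ ^ p) m := fun h =>
    MemLp_integrable_rpow hp (Lp.memLp h)
  have h12 : Integrable (fun x => ‖f x‖ ^ p + ‖g x‖ ^ p) m := (hi f).add (hi g)
  have h123 : Integrable (fun x => (‖f x‖ ^ p + ‖g x‖ ^ p) / 2 -
      ‖((1 / 2 : ℝ) • (f + g) : Lp E (ENNReal.ofReal p) m) x‖ ^ p) m := (h12.div_const 2).sub (hi _)
  simp only [Lp_norm_rpow hp]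
  have e1 : ε * (∫ x, ‖f x‖ ^ p ∂m + ∫ x, ‖g x‖ ^ p ∂m) +
      C * ((∫ x, ‖f x‖ ^ p ∂m + ∫ x, ‖g x‖ ^ p ∂m) / 2 -
        ∫ x, ‖((1 / 2 : ℝ) • (f + g) : Lp E (ENNReal.ofReal p) m) x‖ ^ p ∂m) =
      ∫ x, (ε * (‖f x‖ ^ p + ‖g x‖ ^ p) + C * ((‖f x‖ ^ p + ‖g x‖ ^ p) / 2 -
        ‖((1 / 2 : ℝ) • (f + g) : Lp E (ENNReal.ofReal p) m) x‖ ^ p)) ∂m := by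
    rw [integral_add (h12.const_mul ε) (h123.const_mul C), integral_const_mul,
      integral_const_mul, integral_sub (h12.div_const 2) (hi _), integral_div,
      integral_add (hi f) (hi g)]
  rw [e1]
  refine integral_mono_ae (hi _) ((h12.const_mul ε).add (h123.const_mul C)) ?_
  filter_upwards [Lp.coeFn_sub f g, Lp.coeFn_add f g, Lp.coeFn_smul (1 / 2 : ℝ) (f + g)]
    with x h1 h2 h3
  rw [h1, h3, Pi.smul_apply, h2]
  exact hC (f x) (g x)

end Integral

/-! ### Birkhoff orthogonality -/

section Birkhoff

variable {Y : Type*} [NormedAddCommGroup Y] [NormedSpace ℝ Y]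

/-- Birkhoff orthogonality of `y` to the line spanned by `b`: zero is a best approximation of `y`
in this line. -/
def BirkhoffOrth (b y : Y) : Prop := ∀ c : ℝ, ‖y‖ ≤ ‖y + c • b‖

theorem BirkhoffOrth.smul {b y : Y} (h : BirkhoffOrth b y) (s : ℝ) : BirkhoffOrth b (s • y) := by
  intro c
  rcases eq_or_ne s 0 with rfl | hs
  · simp
  · have e : s • y + c • b = s • (y + (s⁻¹ * c) • b) := by
      rw [smul_add, smul_smul, mul_inv_cancel_left₀ hs]
    rw [e, norm_smul, norm_smul]
    gcongr
    exact h _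

/-- A best approximation of `y` in the line spanned by `b` moves `y` into the cone. -/
theorem exists_birkhoffOrth_add (b y : Y) (hb : b ≠ 0) : ∃ c : ℝ, BirkhoffOrth b (y + c • b) := by
  have hcont : Continuous fun c : ℝ => ‖y + c • b‖ := by fun_prop
  have hlim : Tendsto (fun c : ℝ => ‖y + c • b‖) (cocompact ℝ) atTop := by
    have h1 : Tendsto (fun c : ℝ => ‖c‖ * ‖b‖ + -‖y‖) (cocompact ℝ) atTop :=
      tendsto_atTop_add_const_right _ _
        (tendsto_norm_cocompact_atTop.atTop_mul_const (norm_pos_iff.mpr hb))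
    refine tendsto_atTop_mono (fun c => ?_) h1
    have := norm_sub_le (y + c • b) y
    rw [add_sub_cancel_left, norm_smul] at this
    linarith
  obtain ⟨c, hc⟩ := hcont.exists_forall_le hlim
  refine ⟨c, fun d => ?_⟩
  have := hc (c + d)
  rwa [add_smul, ← add_assoc] at this

theorem BirkhoffOrth.of_tendsto {b y : Y} {ι : Type*} {l : Filter ι} [l.NeBot] {u : ι → Y}
    (hu : ∀ i, BirkhoffOrth b (u i)) (h : Tendsto u l (𝓝 y)) : BirkhoffOrth b y := fun c =>
  le_of_tendsto_of_tendsto' h.norm (h.add_const (c • b)).norm fun i => hu i c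

theorem BirkhoffOrth.eq_zero {b : Y} {c : ℝ} (h : BirkhoffOrth b (c • b)) : c • b = 0 := by
  have := h (-c)
  rw [neg_smul, add_neg_cancel, norm_zero] at this
  exact norm_le_zero_iff.mp this

end Birkhoff

/-! ### Minimization over the cone and the Euler–Lagrange equation -/

section Minimization

variable {V X Y Z : Type*} [AddCommGroup V] [Module ℝ V] [NormedAddCommGroup X] [NormedSpace ℝ X]
  [NormedAddCommGroup Y] [NormedSpace ℝ Y] [NormedAddCommGroup Z] [NormedSpace ℝ Z]

/-- Compactness of a bounded sequence of the cone `{v | B v ⟂ b}`: after passing to a subsequence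
`B v` converges and, if moreover `A v` is a Cauchy sequence, then the limits come from some `w`, the
norm of `D` being lower semicontinuous along the way. -/
def ConeCompact (A : V →ₗ[ℝ] X) (D : V →ₗ[ℝ] Z) (B : V →ₗ[ℝ] Y) (b : Y) : Prop :=
  ∀ v : ℕ → V, (∀ n, BirkhoffOrth b (B (v n))) →
    ∀ M : ℝ, (∀ n, ‖A (v n)‖ ≤ M) → (∀ n, ‖D (v n)‖ ≤ M) →
    ∃ φ : ℕ → ℕ, StrictMono φ ∧ ∃ y, Tendsto (fun n => B (v (φ n))) atTop (𝓝 y) ∧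
      (CauchySeq (fun n => A (v (φ n))) → ∃ w, B w = y ∧
        Tendsto (fun n => A (v (φ n))) atTop (𝓝 (A w)) ∧
        ∀ M' : ℝ, (∀ᶠ n in atTop, ‖D (v (φ n))‖ ≤ M') → ‖D w‖ ≤ M')

variable {A : V →ₗ[ℝ] X} {D : V →ₗ[ℝ] Z} {B : V →ₗ[ℝ] Y} {e : V} {lam p q : ℝ}

/-- On the cone, a bound on `A` and the constraint `1 ≤ lam ‖B v‖ ^ q - ‖D v‖ ^ q` bound `D`:
otherwise the normalized sequence `v / ‖D v‖` would converge to a constant of the cone. -/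
theorem exists_bound_of_constraint (hq : 1 < q)
    (hker : ∀ v, A v = 0 → ∃ c : ℝ, B v = c • B e)
    (hcomp : ConeCompact A D B (B e)) (M : ℝ) :
    ∃ M' : ℝ, ∀ v, BirkhoffOrth (B e) (B v) → ‖A v‖ ≤ M →
      1 ≤ lam * ‖B v‖ ^ q - ‖D v‖ ^ q → ‖D v‖ ≤ M' := by
  have hq0 : 0 < q := by linarith
  by_contra! hcon
  choose v hv1 hv2 hv3 hv4 using fun n : ℕ => hcon (n + 1)
  have hpos : ∀ n, 0 < ‖D (v n)‖ := fun n => lt_trans (by positivity) (hv4 n)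
  set z : ℕ → V := fun n => ‖D (v n)‖⁻¹ • v n with hz
  have hzD : ∀ n, ‖D (z n)‖ = 1 := fun n => by
    simp only [hz, map_smul, norm_smul, norm_inv, norm_norm]
    exact inv_mul_cancel₀ (hpos n).ne'
  have hM : 0 ≤ M := (norm_nonneg _).trans (hv2 0)
  have hzA : ∀ n : ℕ, ‖A (z n)‖ ≤ M * (1 / ((n : ℝ) + 1)) := fun n => by
    simp only [hz, map_smul, norm_smul, norm_inv, norm_norm]
    rw [mul_comm, one_div]
    gcongr
    · exact hv2 n
    · exact (hv4 n).le
  have hzA0 : Tendsto (fun n => A (z n)) atTop (𝓝 0) := by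
    refine squeeze_zero_norm hzA ?_
    simpa using tendsto_one_div_add_atTop_nhds_zero_nat.const_mul M
  have hzorth : ∀ n, BirkhoffOrth (B e) (B (z n)) := fun n => by
    simp only [hz, map_smul]; exact (hv1 n).smul _
  have hzB : ∀ n, 1 ≤ lam * ‖B (z n)‖ ^ q := fun n => by
    have h1 : ‖D (v n)‖ ^ q ≤ lam * ‖B (v n)‖ ^ q := by linarith [hv3 n]
    have h2 := Real.rpow_pos_of_pos (hpos n) q
    simp only [hz, map_smul, norm_smul, norm_inv, norm_norm]
    rw [Real.mul_rpow (inv_nonneg.mpr (hpos n).le) (norm_nonneg _), Real.inv_rpow (hpos n).le,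
      mul_left_comm, ← div_eq_inv_mul, le_div_iff₀ h2, one_mul]
    exact h1
  obtain ⟨φ, hφ, y, hy, hcl⟩ := hcomp z hzorth (max M 1) (fun n => (hzA n).trans
    (le_max_of_le_left (mul_le_of_le_one_right hM (by
      rw [div_le_one (by positivity)]; linarith [(Nat.cast_nonneg n : (0 : ℝ) ≤ n)]))))
    (fun n => by rw [hzD]; exact le_max_right _ _)
  have hA0 := hzA0.comp hφ.tendsto_atTop
  obtain ⟨w, hw, hAw, -⟩ := hcl hA0.cauchySeq
  obtain ⟨c, hc⟩ := hker w (tendsto_nhds_unique hAw hA0)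
  have hyorth : BirkhoffOrth (B e) y := BirkhoffOrth.of_tendsto (fun n => hzorth (φ n)) hy
  have hy0 : y = 0 := by
    rw [← hw, hc] at hyorth ⊢
    exact hyorth.eq_zero
  have hlim : Tendsto (fun n => lam * ‖B (z (φ n))‖ ^ q) atTop (𝓝 (lam * ‖y‖ ^ q)) :=
    (hy.norm.rpow_const (Or.inr hq0.le)).const_mul lam
  have := ge_of_tendsto' hlim fun n => hzB (φ n)
  rw [hy0, norm_zero, Real.zero_rpow hq0.ne'] at this
  linarith

/-- Minimization of `‖A v‖` over the `v` of the cone with `1 ≤ lam ‖B v‖ ^ q - ‖D v‖ ^ q`. For a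
minimizing sequence `B v` may be assumed to converge; midpoints of its members, put back into the
cone by a multiple of `e`, almost satisfy the constraint, so uniform convexity forces `A v` to be a
Cauchy sequence. -/
theorem exists_constrained_minimizer (hp : 1 < p) (hq : 1 < q) (hlam : 0 < lam)
    (hAe : A e = 0) (hDe : D e = 0) (hBe : B e ≠ 0)
    (hunif : ∀ ε : ℝ, 0 < ε → ∃ C : ℝ, 0 ≤ C ∧ ∀ f g : X, ‖f - g‖ ^ p ≤
      ε * (‖f‖ ^ p + ‖g‖ ^ p) + C * ((‖f‖ ^ p + ‖g‖ ^ p) / 2 - ‖(1 / 2 : ℝ) • (f + g)‖ ^ p))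
    (hker : ∀ v, A v = 0 → ∃ c : ℝ, B v = c • B e)
    (hcomp : ConeCompact A D B (B e))
    {v₀ : V} (hv₀ : BirkhoffOrth (B e) (B v₀)) (hv₀' : 0 < lam * ‖B v₀‖ ^ q - ‖D v₀‖ ^ q) :
    ∃ w, BirkhoffOrth (B e) (B w) ∧ 0 < ‖A w‖ ∧ lam * ‖B w‖ ^ q - ‖D w‖ ^ q = 1 ∧
      ∀ v, BirkhoffOrth (B e) (B v) → 0 < lam * ‖B v‖ ^ q - ‖D v‖ ^ q →
        ‖A w‖ * (lam * ‖B v‖ ^ q - ‖D v‖ ^ q) ^ (1 / q) ≤ ‖A v‖ := by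
  have hq0 : 0 < q := by linarith
  have hp0 : 0 < p := by linarith
  set S : Set V := {v | BirkhoffOrth (B e) (B v) ∧ 1 ≤ lam * ‖B v‖ ^ q - ‖D v‖ ^ q} with hS
  set I := sInf ((fun v => ‖A v‖) '' S) with hI
  have hbdd : BddBelow ((fun v => ‖A v‖) '' S) :=
    ⟨0, by rintro _ ⟨v, -, rfl⟩; exact norm_nonneg _⟩
  -- both sides of the constraint are homogeneous of degree `q`, so an element of the cone with a
  -- positive value is rescaled to one with the value `1`
  have hscale : ∀ v, BirkhoffOrth (B e) (B v) → 0 < lam * ‖B v‖ ^ q - ‖D v‖ ^ q →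
      ((lam * ‖B v‖ ^ q - ‖D v‖ ^ q) ^ (1 / q))⁻¹ • v ∈ S := by
    intro v hv hθ
    set θ := lam * ‖B v‖ ^ q - ‖D v‖ ^ q with hθd
    have hs : 0 < (θ ^ (1 / q))⁻¹ := inv_pos.mpr (Real.rpow_pos_of_pos hθ _)
    have hsq : ((θ ^ (1 / q))⁻¹) ^ q = θ⁻¹ := by
      rw [Real.inv_rpow (by positivity), ← Real.rpow_mul hθ.le, one_div_mul_cancel hq0.ne',
        Real.rpow_one]
    refine ⟨by rw [map_smul]; exact hv.smul _, le_of_eq ?_⟩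
    rw [map_smul, map_smul, norm_smul, norm_smul, Real.norm_of_nonneg hs.le,
      Real.mul_rpow hs.le (norm_nonneg _), Real.mul_rpow hs.le (norm_nonneg _), hsq]
    rw [mul_left_comm, ← mul_sub, ← hθd]
    exact (inv_mul_cancel₀ hθ.ne').symm
  have hIle : ∀ v, BirkhoffOrth (B e) (B v) → 0 < lam * ‖B v‖ ^ q - ‖D v‖ ^ q →
      I * (lam * ‖B v‖ ^ q - ‖D v‖ ^ q) ^ (1 / q) ≤ ‖A v‖ := by
    intro v hv hθ
    have h1 : I ≤ _ := csInf_le hbdd ⟨_, hscale v hv hθ, rfl⟩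
    have h2 := Real.rpow_pos_of_pos hθ (1 / q)
    simp only [map_smul, norm_smul, norm_inv, Real.norm_of_nonneg h2.le] at h1
    rwa [← div_eq_inv_mul, le_div_iff₀ h2] at h1
  have hI0 : 0 ≤ I := Real.sInf_nonneg (by rintro _ ⟨v, -, rfl⟩; exact norm_nonneg _)
  obtain ⟨a, -, ha, haS⟩ := exists_seq_tendsto_sInf (Set.Nonempty.image _ ⟨_, hscale v₀ hv₀ hv₀'⟩)
    hbdd
  choose v hvS hva using haS
  obtain rfl : (fun n => ‖A (v n)‖) = a := funext hva
  obtain ⟨M₁, hM₁⟩ := ha.bddAbove_range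
  have hM₁' : ∀ n, ‖A (v n)‖ ≤ M₁ := fun n => hM₁ ⟨n, rfl⟩
  obtain ⟨M₂, hM₂⟩ := exists_bound_of_constraint (lam := lam) hq hker hcomp M₁
  obtain ⟨φ, hφ, y, hy, hcl⟩ := hcomp v (fun n => (hvS n).1) (max M₁ M₂)
    (fun n => (hM₁' n).trans (le_max_left _ _))
    (fun n => (hM₂ _ (hvS n).1 (hM₁' n) (hvS n).2).trans (le_max_right _ _))
  set u : ℕ → V := fun n => v (φ n) with hu
  have huS : ∀ n, u n ∈ S := fun n => hvS (φ n)
  have huA : Tendsto (fun n => ‖A (u n)‖) atTop (𝓝 I) := ha.comp hφ.tendsto_atTop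
  have hcauchy : CauchySeq fun n => A (u n) := by
    rw [cauchySeq_iff_tendsto_dist_atTop_0, ← prod_atTop_atTop_eq]
    set F : Filter (ℕ × ℕ) := atTop ×ˢ atTop
    have huA1 : Tendsto (fun n : ℕ × ℕ => ‖A (u n.1)‖) F (𝓝 I) := huA.comp tendsto_fst
    have huA2 : Tendsto (fun n : ℕ × ℕ => ‖A (u n.2)‖) F (𝓝 I) := huA.comp tendsto_snd
    have hB1 : Tendsto (fun n : ℕ × ℕ => B (u n.1)) F (𝓝 y) := hy.comp tendsto_fst
    have hB2 : Tendsto (fun n : ℕ × ℕ => B (u n.2)) F (𝓝 y) := hy.comp tendsto_snd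
    set h : ℕ × ℕ → V := fun n => (1 / 2 : ℝ) • (u n.1 + u n.2) with hh
    have hBh : Tendsto (fun n => B (h n)) F (𝓝 y) := by
      have := (hB1.add hB2).const_smul (1 / 2 : ℝ)
      rw [← two_smul ℝ y, smul_smul] at this
      norm_num at this
      simpa only [hh, map_smul, map_add, one_div, smul_add] using this
    -- `β` bounds `‖B (h + c e)‖` from below for every `c`, because `u n.1` lies in the cone; hence
    -- `τ` bounds from below the value of the constraint at the midpoint `h`, moved into the cone
    set β : ℕ × ℕ → ℝ := fun n => ‖B (u n.1)‖ - ‖B (h n) - B (u n.1)‖ with hβ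
    have hβlim : Tendsto β F (𝓝 ‖y‖) := by
      have := hB1.norm.sub (hBh.sub hB1).norm
      rwa [sub_self, norm_zero, sub_zero] at this
    set τ : ℕ × ℕ → ℝ := fun n =>
      lam * (max (β n) 0) ^ q - lam * ((‖B (u n.1)‖ ^ q + ‖B (u n.2)‖ ^ q) / 2) + 1 with hτ
    have hτlim : Tendsto τ F (𝓝 1) := by
      have h1 : Tendsto (fun n => max (β n) 0) F (𝓝 (max ‖y‖ 0)) := hβlim.max tendsto_const_nhds
      rw [max_eq_left (norm_nonneg y)] at h1
      have h2 := (((h1.rpow_const (p := q) (Or.inr hq0.le)).const_mul lam).sub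
        ((((hB1.norm.rpow_const (p := q) (Or.inr hq0.le)).add
          (hB2.norm.rpow_const (p := q) (Or.inr hq0.le))).div_const 2).const_mul lam)).add_const 1
      convert h2 using 2
      ring
    have hτle : ∀ n, 0 < τ n → I * (τ n) ^ (1 / q) ≤ ‖A (h n)‖ := by
      intro n hn
      obtain ⟨c, hc⟩ := exists_birkhoffOrth_add (B e) (B (h n)) hBe
      have hB' : B (h n + c • e) = B (h n) + c • B e := by rw [map_add, map_smul B c]
      have hA' : A (h n + c • e) = A (h n) := by
        rw [map_add, map_smul A c, hAe, smul_zero, add_zero]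
      have hD' : D (h n + c • e) = D (h n) := by
        rw [map_add, map_smul D c, hDe, smul_zero, add_zero]
      have hβle : max (β n) 0 ≤ ‖B (h n + c • e)‖ := by
        refine max_le ?_ (norm_nonneg _)
        have h1 := (huS n.1).1 c
        have h2 : ‖B (u n.1) + c • B e‖ ≤ ‖B (h n) + c • B e‖ + ‖B (h n) - B (u n.1)‖ := by
          have := norm_sub_le (B (h n) + c • B e) (B (h n) - B (u n.1))
          rwa [add_sub_sub_cancel, add_comm (c • B e)] at this
        rw [hB']
        simp only [hβ]
        linarith
      have hDh : ‖D (h n)‖ ^ q ≤ lam * ((‖B (u n.1)‖ ^ q + ‖B (u n.2)‖ ^ q) / 2) - 1 := by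
        have h1 := norm_midpoint_rpow_le hq.le (D (u n.1)) (D (u n.2))
        rw [← map_add, ← map_smul] at h1
        have h2 := (huS n.1).2
        have h3 := (huS n.2).2
        linarith
      have hτg : τ n ≤ lam * ‖B (h n + c • e)‖ ^ q - ‖D (h n + c • e)‖ ^ q := by
        rw [hD']
        have : lam * (max (β n) 0) ^ q ≤ lam * ‖B (h n + c • e)‖ ^ q := by gcongr
        simp only [hτ]
        linarith
      have := hIle (h n + c • e) (by rw [hB']; exact hc) (hn.trans_le hτg)
      rw [hA'] at this
      refine le_trans ?_ this
      gcongr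
    -- the norms of the midpoints are at least `I τ ^ (1 / q)`, which tends to the limit `I` of the
    -- norms themselves, so the uniform convexity of the norm applies
    have hpow : Tendsto (fun n : ℕ × ℕ => ‖A (u n.1) - A (u n.2)‖ ^ p) F (𝓝 0) := by
      refine tendsto_order.2 ⟨fun a' ha' => Eventually.of_forall fun n =>
        lt_of_lt_of_le ha' (by positivity), fun η hη => ?_⟩
      obtain ⟨C, hC0, hC⟩ := hunif (η / (4 * (I ^ p + 1))) (by positivity)
      set ε := η / (4 * (I ^ p + 1)) with hε
      have hSlim : Tendsto (fun n : ℕ × ℕ => ‖A (u n.1)‖ ^ p + ‖A (u n.2)‖ ^ p) F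
          (𝓝 (I ^ p + I ^ p)) :=
        (huA1.rpow_const (Or.inr hp0.le)).add (huA2.rpow_const (Or.inr hp0.le))
      have hlim : Tendsto (fun n : ℕ × ℕ => ε * (‖A (u n.1)‖ ^ p + ‖A (u n.2)‖ ^ p) +
          C * ((‖A (u n.1)‖ ^ p + ‖A (u n.2)‖ ^ p) / 2 - (I * (τ n) ^ (1 / q)) ^ p)) F
          (𝓝 (ε * (I ^ p + I ^ p) + C * ((I ^ p + I ^ p) / 2 - (I * 1 ^ (1 / q)) ^ p))) :=
        (hSlim.const_mul ε).add (((hSlim.div_const 2).sub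
          (((hτlim.rpow_const (Or.inl one_ne_zero)).const_mul I).rpow_const
            (Or.inr hp0.le))).const_mul C)
      have hlt : ε * (I ^ p + I ^ p) + C * ((I ^ p + I ^ p) / 2 - (I * 1 ^ (1 / q)) ^ p) < η := by
        rw [Real.one_rpow, mul_one]
        have h1 : ε * (I ^ p + I ^ p) < η := by
          have hIp : 0 ≤ I ^ p := by positivity
          rw [hε, div_mul_eq_mul_div, div_lt_iff₀ (by positivity)]
          nlinarith
        have h2 : (I ^ p + I ^ p) / 2 - I ^ p = 0 := by ring
        rw [h2, mul_zero, add_zero]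
        exact h1
      filter_upwards [hlim.eventually_lt_const hlt, hτlim.eventually_const_lt one_pos] with n h1 h2
      refine lt_of_le_of_lt (hC _ _) (lt_of_le_of_lt ?_ h1)
      have h3 : (I * (τ n) ^ (1 / q)) ^ p ≤ ‖A (h n)‖ ^ p := by
        have := hτle n h2
        gcongr
      have h4 : (1 / 2 : ℝ) • (A (u n.1) + A (u n.2)) = A (h n) := by
        simp only [hh, map_smul, map_add]
      rw [h4]
      gcongr
    have := hpow.rpow_const (p := 1 / p) (Or.inr (by positivity))
    rw [Real.zero_rpow (by positivity)] at this
    refine this.congr fun n => ?_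
    rw [← Real.rpow_mul (norm_nonneg _), mul_one_div_cancel hp0.ne', Real.rpow_one, dist_eq_norm]
  obtain ⟨w, hBw, hAw, hDw⟩ := hcl hcauchy
  have hAI : ‖A w‖ = I := tendsto_nhds_unique hAw.norm huA
  have horth : BirkhoffOrth (B e) (B w) := by
    rw [hBw]; exact BirkhoffOrth.of_tendsto (fun n => (huS n).1) hy
  have hBlim : Tendsto (fun n => lam * ‖B (u n)‖ ^ q - 1) atTop (𝓝 (lam * ‖y‖ ^ q - 1)) :=
    ((hy.norm.rpow_const (Or.inr hq0.le)).const_mul lam).sub_const 1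
  have hDle : ‖D w‖ ^ q ≤ lam * ‖y‖ ^ q - 1 := by
    refine le_of_forall_pos_le_add fun δ hδ => ?_
    have hev := hBlim.eventually_lt_const (show lam * ‖y‖ ^ q - 1 < lam * ‖y‖ ^ q - 1 + δ by linarith)
    have hev' : ∀ᶠ n in atTop, ‖D (u n)‖ ^ q ≤ lam * ‖y‖ ^ q - 1 + δ := by
      filter_upwards [hev] with n hn
      linarith [(huS n).2]
    obtain ⟨n₀, hn₀⟩ := hev'.exists
    have hnn : 0 ≤ lam * ‖y‖ ^ q - 1 + δ := le_trans (by positivity) hn₀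
    have := hDw ((lam * ‖y‖ ^ q - 1 + δ) ^ (1 / q)) (by
      filter_upwards [hev'] with n hn
      rw [one_div, Real.le_rpow_inv_iff_of_pos (norm_nonneg _) hnn hq0]
      exact hn)
    rwa [one_div, Real.le_rpow_inv_iff_of_pos (norm_nonneg _) hnn hq0] at this
  have hg1 : 1 ≤ lam * ‖B w‖ ^ q - ‖D w‖ ^ q := by rw [hBw]; linarith
  have hApos : 0 < ‖A w‖ := by
    rw [norm_pos_iff]
    intro h0
    obtain ⟨c, hc⟩ := hker w h0
    have h1 : B w = 0 := by
      rw [hc] at horth ⊢; exact horth.eq_zero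
    rw [h1, norm_zero, Real.zero_rpow hq0.ne'] at hg1
    have : 0 ≤ ‖D w‖ ^ q := by positivity
    linarith
  refine ⟨w, horth, hApos, le_antisymm ?_ hg1, fun v hv hθ => ?_⟩
  · have h1 := hIle w horth (by linarith)
    rw [← hAI] at h1
    have h2 : (lam * ‖B w‖ ^ q - ‖D w‖ ^ q) ^ (1 / q) ≤ 1 := by
      by_contra! h
      nlinarith
    by_contra! h
    have := Real.one_lt_rpow h (show 0 < 1 / q by positivity)
    linarith
  · rw [hAI]; exact hIle v hv hθ

/-- The Euler–Lagrange equation of the constrained minimizer. The competitor `w + t v` is put back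
into the cone by a multiple of `e`; by convexity (`hB`) this does not spoil the first order
expansion of the constraint. -/
theorem euler_lagrange (hp : 1 < p) (hq : 1 < q) (hlam : 0 < lam)
    (hAe : A e = 0) (hDe : D e = 0) (hBe : B e ≠ 0) {w : V}
    (hw1 : lam * ‖B w‖ ^ q - ‖D w‖ ^ q = 1)
    (hmin : ∀ v, BirkhoffOrth (B e) (B v) → 0 < lam * ‖B v‖ ^ q - ‖D v‖ ^ q →
        ‖A w‖ * (lam * ‖B v‖ ^ q - ‖D v‖ ^ q) ^ (1 / q) ≤ ‖A v‖) {v : V} {α δ κ : ℝ}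
    (hA : HasDerivAt (fun t : ℝ => ‖A w + t • A v‖ ^ p) (p * α) 0)
    (hD : HasDerivAt (fun t : ℝ => ‖D w + t • D v‖ ^ q) (q * δ) 0)
    (hB : ∀ t c : ℝ, ‖B w‖ ^ q + q * (t * κ) ≤ ‖B w + (t • B v + c • B e)‖ ^ q) :
    α + ‖A w‖ ^ p * δ = ‖A w‖ ^ p * (lam * κ) := by
  have hq0 : 0 < q := by linarith
  have hp0 : 0 < p := by linarith
  -- `d t` is a lower bound of the constraint at the competitor, with equality at `t = 0`; hence
  -- `‖A w + t A v‖ ^ p - ‖A w‖ ^ p * d t ^ (p / q)` has a local minimum there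
  set d : ℝ → ℝ := fun t => lam * (‖B w‖ ^ q + q * (t * κ)) - ‖D w + t • D v‖ ^ q with hd
  have hd0 : d 0 = 1 := by simp [hd, hw1]
  have hdd : HasDerivAt d (lam * (q * κ) - q * δ) 0 := by
    have h1 : HasDerivAt (fun t : ℝ => lam * (‖B w‖ ^ q + q * (t * κ))) (lam * (q * κ)) 0 := by
      have := ((((hasDerivAt_id (0 : ℝ)).mul_const κ).const_mul q).const_add (‖B w‖ ^ q)).const_mul lam
      simpa using this
    exact h1.sub hD
  have hdp : HasDerivAt (fun t => d t ^ (p / q)) ((lam * (q * κ) - q * δ) * (p / q)) 0 := by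
    have := hdd.rpow_const (p := p / q) (Or.inl (by rw [hd0]; exact one_ne_zero))
    simpa [hd0] using this
  have hΦ := hA.sub (hdp.const_mul (‖A w‖ ^ p))
  have hloc : IsLocalMin ((fun t : ℝ => ‖A w + t • A v‖ ^ p) -
      fun t => ‖A w‖ ^ p * d t ^ (p / q)) 0 := by
    have hev : ∀ᶠ t in 𝓝 (0 : ℝ), 0 < d t := by
      have := hdd.continuousAt.eventually (lt_mem_nhds (show 0 < d 0 by rw [hd0]; exact one_pos))
      exact this
    filter_upwards [hev] with t ht
    simp only [Pi.sub_apply, hd0, Real.one_rpow, zero_smul, add_zero, mul_one, sub_self, sub_nonneg]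
    obtain ⟨c, hc⟩ := exists_birkhoffOrth_add (B e) (B (w + t • v)) hBe
    have hB' : B (w + t • v + c • e) = B (w + t • v) + c • B e := by rw [map_add, map_smul _ c]
    have hA' : A (w + t • v + c • e) = A w + t • A v := by
      simp only [map_add, map_smul, hAe, smul_zero, add_zero]
    have hD' : D (w + t • v + c • e) = D w + t • D v := by
      simp only [map_add, map_smul, hDe, smul_zero, add_zero]
    have hle : d t ≤ lam * ‖B (w + t • v + c • e)‖ ^ q - ‖D (w + t • v + c • e)‖ ^ q := by
      rw [hD']
      have h1 := hB t c
      rw [← add_assoc] at h1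
      have h2 : B (w + t • v + c • e) = B w + t • B v + c • B e := by
        simp only [map_add, map_smul]
      rw [h2]
      simp only [hd]
      gcongr
    have h1 := hmin _ (by rw [hB']; exact hc) (ht.trans_le hle)
    rw [hA'] at h1
    have h2 : ‖A w‖ * d t ^ (1 / q) ≤ ‖A w + t • A v‖ := le_trans (by gcongr) h1
    calc ‖A w‖ ^ p * d t ^ (p / q) = (‖A w‖ * d t ^ (1 / q)) ^ p := by
          rw [Real.mul_rpow (norm_nonneg _) (by positivity), ← Real.rpow_mul ht.le]
          congr 2; ring
      _ ≤ _ := by gcongr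
  have h0 := hloc.hasDerivAt_eq_zero hΦ
  field_simp at h0
  linarith [(mul_eq_zero.mp h0).resolve_left hp0.ne']

end Minimization

/-! ### Seminorms with real exponent -/

section LpNorm

variable {α F : Type*} [MeasurableSpace α] [NormedAddCommGroup F] {μ : Measure α}

theorem eLpNorm_ofReal {s : ℝ} (hs : 1 ≤ s) (f : α → F) :
    eLpNorm f (ENNReal.ofReal s) μ = (∫⁻ x, ‖f x‖ₑ ^ s ∂μ) ^ (1 / s) := by
  rw [eLpNorm_eq_lintegral_rpow_enorm_toReal (by simp; linarith) ENNReal.ofReal_ne_top,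
    ENNReal.toReal_ofReal (by linarith)]

theorem eLpNorm_ofReal_rpow {s : ℝ} (hs : 1 ≤ s) (f : α → F) :
    eLpNorm f (ENNReal.ofReal s) μ ^ s = ∫⁻ x, ‖f x‖ₑ ^ s ∂μ := by
  rw [eLpNorm_ofReal hs, ← ENNReal.rpow_mul, one_div_mul_cancel (by linarith), ENNReal.rpow_one]

theorem eLpNorm_ofReal_le_iff {s : ℝ} (hs : 1 ≤ s) (f : α → F) (K : ℝ≥0∞) :
    eLpNorm f (ENNReal.ofReal s) μ ≤ K ↔ ∫⁻ x, ‖f x‖ₑ ^ s ∂μ ≤ K ^ s := by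
  rw [← eLpNorm_ofReal_rpow hs, ENNReal.rpow_le_rpow_iff (by linarith)]

theorem one_le_ofReal {s : ℝ} (hs : 1 ≤ s) : 1 ≤ ENNReal.ofReal s := by
  simpa using ENNReal.ofReal_le_ofReal hs

/-- Jensen's inequality for powers and a probability measure. -/
theorem rpow_lintegral_le_lintegral_rpow [IsProbabilityMeasure μ] {s : ℝ} (hs : 1 ≤ s)
    {h : α → ℝ≥0∞} (hh : AEMeasurable h μ) : (∫⁻ y, h y ∂μ) ^ s ≤ ∫⁻ y, h y ^ s ∂μ := by
  have h1 := eLpNorm'_le_eLpNorm'_of_exponent_le (μ := μ) (f := h) one_pos hs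
    hh.aestronglyMeasurable
  simp only [eLpNorm', enorm_eq_self, ENNReal.rpow_one, div_one] at h1
  have h2 := ENNReal.rpow_le_rpow h1 (by linarith : 0 ≤ s)
  rwa [← ENNReal.rpow_mul, one_div_mul_cancel (by linarith), ENNReal.rpow_one] at h2

end LpNorm

/-! ### Mollification -/

section Mollify

variable {F : Type*} [NormedAddCommGroup F] [NormedSpace ℝ F]

/-- The convolution of the scalar kernel `g` with the function `f`. -/
def mollify (g : Space N → ℝ) (f : Space N → F) (x : Space N) : F := ∫ y, g y • f (x - y)

/-- A mollifier: a smooth nonnegative kernel of compact support and integral one. -/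
structure IsMollifier (g : Space N → ℝ) : Prop where
  contDiff : ContDiff ℝ ∞ g
  hasCompactSupport : HasCompactSupport g
  nonneg : ∀ x, 0 ≤ g x
  integral_eq_one : ∫ x, g x = 1

theorem mollify_congr (g : Space N → ℝ) {f f' : Space N → F} (h : f =ᵐ[volume] f') (x : Space N) :
    mollify g f x = mollify g f' x := by
  refine integral_congr_ae ?_
  have := (quasiMeasurePreserving_sub_left volume x).ae_eq_comp h
  filter_upwards [this] with y hy
  simp only [Function.comp_apply] at hy
  rw [hy]

theorem integrable_mollify {g : Space N → ℝ} (hg : IsMollifier g) {f : Space N → F}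
    (hf : LocallyIntegrable f) (x : Space N) : Integrable fun y => g y • f (x - y) :=
  hg.hasCompactSupport.convolutionExists_left (ContinuousLinearMap.lsmul ℝ ℝ)
    hg.contDiff.continuous hf x

theorem integrable_mollifier {g : Space N → ℝ} (hg : IsMollifier g) : Integrable g :=
  hg.contDiff.continuous.integrable_of_hasCompactSupport hg.hasCompactSupport

theorem lintegral_mollifier {g : Space N → ℝ} (hg : IsMollifier g) :
    ∫⁻ y, ENNReal.ofReal (g y) = 1 := by
  rw [← ofReal_integral_eq_lintegral_ofReal (integrable_mollifier hg) (ae_of_all _ hg.nonneg),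
    hg.integral_eq_one, ENNReal.ofReal_one]

theorem mollify_sub_eq [CompleteSpace F] {g : Space N → ℝ} (hg : IsMollifier g) {f : Space N → F}
    (hf : LocallyIntegrable f) (x : Space N) :
    mollify g f x - f x = ∫ y, g y • (f (x - y) - f x) := by
  have h1 : ∫ y, g y • f x = f x := by
    rw [integral_smul_const, hg.integral_eq_one, one_smul]
  simp only [smul_sub]
  rw [integral_sub (integrable_mollify hg hf x) ((integrable_mollifier hg).smul_const _), h1]
  rfl

/-- Jensen's inequality for the probability measure with density `g`. -/
theorem rpow_lintegral_mollifier_le {g : Space N → ℝ} (hg : IsMollifier g) {s : ℝ} (hs : 1 ≤ s)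
    {h : Space N → ℝ≥0∞} (hh : AEMeasurable h) :
    (∫⁻ y, ENNReal.ofReal (g y) * h y) ^ s ≤ ∫⁻ y, ENNReal.ofReal (g y) * h y ^ s := by
  have hgm : Measurable fun y => ENNReal.ofReal (g y) :=
    hg.contDiff.continuous.measurable.ennreal_ofReal
  set π : Measure (Space N) := volume.withDensity fun y => ENNReal.ofReal (g y) with hπ
  have : IsProbabilityMeasure π := ⟨by
    rw [hπ, withDensity_apply _ MeasurableSet.univ, Measure.restrict_univ, lintegral_mollifier hg]⟩
  have hh' : AEMeasurable h π := hh.mono_ac (withDensity_absolutelyContinuous _ _)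
  have e1 : ∫⁻ y, ENNReal.ofReal (g y) * h y = ∫⁻ y, h y ∂π := by
    rw [hπ, lintegral_withDensity_eq_lintegral_mul₀ hgm.aemeasurable hh]; rfl
  have e2 : ∫⁻ y, ENNReal.ofReal (g y) * h y ^ s = ∫⁻ y, h y ^ s ∂π := by
    rw [hπ, lintegral_withDensity_eq_lintegral_mul₀ hgm.aemeasurable (hh.pow_const s)]; rfl
  rw [e1, e2]
  exact rpow_lintegral_le_lintegral_rpow hs hh'

/-- If all translations of `f` by vectors of the support of the mollifier `g` move `f` by at most
`K` in `L^s(A)`, then so does the convolution with `g`. -/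
theorem eLpNorm_mollify_sub_le [CompleteSpace F] {g : Space N → ℝ} (hg : IsMollifier g) {s : ℝ}
    (hs : 1 ≤ s) {f : Space N → F} (hf : LocallyIntegrable f) (A : Set (Space N)) {K : ℝ≥0∞}
    (hK : ∀ y, g y ≠ 0 →
      eLpNorm (fun x => f (x - y) - f x) (ENNReal.ofReal s) (volume.restrict A) ≤ K) :
    eLpNorm (fun x => mollify g f x - f x) (ENNReal.ofReal s) (volume.restrict A) ≤ K := by
  -- it suffices to treat a strongly measurable representative
  wlog hfm : StronglyMeasurable f generalizing f with H
  · have hfa : AEStronglyMeasurable f volume := hf.aestronglyMeasurable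
    have hae := hfa.ae_eq_mk
    have hloc : LocallyIntegrable (hfa.mk f) := by
      intro x
      obtain ⟨U, hU, hi⟩ := hf x
      exact ⟨U, hU, hi.congr (ae_restrict_of_ae hae)⟩
    have h1 := H hloc (fun y hy => by
      refine le_trans (le_of_eq (eLpNorm_congr_ae (ae_restrict_of_ae ?_))) (hK y hy)
      have h2 := (measurePreserving_sub_right volume y).quasiMeasurePreserving.ae_eq_comp hae
      filter_upwards [h2, hae] with x hx hx'
      simp only [Function.comp_apply] at hx
      rw [hx, hx']) hfa.stronglyMeasurable_mk
    refine le_trans (le_of_eq (eLpNorm_congr_ae (ae_restrict_of_ae ?_))) h1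
    filter_upwards [hae] with x hx
    rw [mollify_congr g hae x, hx]
  have hgm : Measurable fun y => ENNReal.ofReal (g y) :=
    hg.contDiff.continuous.measurable.ennreal_ofReal
  have hjm : Measurable fun z : Space N × Space N => ‖f (z.1 - z.2) - f z.1‖ₑ :=
    ((hfm.comp_measurable (measurable_fst.sub measurable_snd)).sub
      (hfm.comp_measurable measurable_fst)).enorm
  rw [eLpNorm_ofReal_le_iff hs]
  calc ∫⁻ x in A, ‖mollify g f x - f x‖ₑ ^ s
      ≤ ∫⁻ x in A, ∫⁻ y, ENNReal.ofReal (g y) * ‖f (x - y) - f x‖ₑ ^ s := by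
        refine lintegral_mono fun x => ?_
        refine le_trans ?_ (rpow_lintegral_mollifier_le hg hs
          (hjm.comp measurable_prodMk_left).aemeasurable)
        gcongr
        rw [mollify_sub_eq hg hf]
        refine (enorm_integral_le_lintegral_enorm _).trans (lintegral_mono fun y => ?_)
        simp only
        rw [enorm_smul, ← ofReal_norm (g y), Real.norm_of_nonneg (hg.nonneg y)]
    _ = ∫⁻ y, ∫⁻ x in A, ENNReal.ofReal (g y) * ‖f (x - y) - f x‖ₑ ^ s := by
        refine lintegral_lintegral_swap ?_
        exact ((hgm.comp measurable_snd).mul (hjm.pow_const s)).aemeasurable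
    _ ≤ ∫⁻ y, ENNReal.ofReal (g y) * K ^ s := by
        refine lintegral_mono fun y => ?_
        have hym : Measurable fun x => ‖f (x - y) - f x‖ₑ ^ s :=
          (hjm.comp (measurable_prodMk_right (y := y))).pow_const s
        rw [lintegral_const_mul _ hym]
        by_cases hy : g y = 0
        · simp [hy]
        · gcongr
          exact (eLpNorm_ofReal_le_iff hs _ K).mp (hK y hy)
    _ = K ^ s := by
        rw [lintegral_mul_const _ hgm, lintegral_mollifier hg, one_mul]

theorem tendsto_eLpNorm_translate_sub {F : Type*} [NormedAddCommGroup F] {s : ℝ} (hs : 1 ≤ s)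
    {f : Space N → F}
    (hf : MemLp f (ENNReal.ofReal s)) :
    Tendsto (fun y : Space N => eLpNorm (fun x => f (x - y) - f x) (ENNReal.ofReal s) volume)
      (𝓝 0) (𝓝 0) := by
  have : Fact (1 ≤ ENNReal.ofReal s) := ⟨one_le_ofReal hs⟩
  have hm : ∀ y : Space N, MeasurePreserving (fun x : Space N => x - y) volume volume := fun y =>
    measurePreserving_sub_right volume y
  let T : C(Space N, C(Space N, Space N)) :=
    ContinuousMap.curry ⟨fun z : Space N × Space N => z.2 - z.1, by fun_prop⟩
  have hT : Tendsto (fun y => T y) (𝓝 0) (𝓝 (T 0)) := T.continuous.tendsto 0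
  have h1 := Filter.Tendsto.compMeasurePreservingLp (tendsto_const_nhds (x := hf.toLp f)) hT hm
    (hm 0) ENNReal.ofReal_ne_top
  rw [Lp.tendsto_Lp_iff_tendsto_eLpNorm'] at h1
  refine h1.congr fun y => eLpNorm_congr_ae ?_
  have ec : ∀ y : Space N, (Lp.compMeasurePreserving (T y) (hm y) (hf.toLp f) : Space N → F)
      =ᵐ[volume] fun x => f (x - y) := fun y => by
    refine (Lp.coeFn_compMeasurePreserving _ (hm y)).trans ?_
    exact (hm y).quasiMeasurePreserving.ae_eq_comp hf.coeFn_toLp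
  filter_upwards [ec y, ec 0] with x h2 h3
  simp only [Pi.sub_apply]
  rw [h2, h3, sub_zero]

/-- Mollifiers with support near the origin approximate in `L^s`. The kernels need not be centred at
the origin, which leaves room to choose their support inside a cone. -/
theorem exists_mollify_close [CompleteSpace F] {s : ℝ} (hs : 1 ≤ s) {f : Space N → F}
    (hf : MemLp f (ENNReal.ofReal s)) {ε : ℝ≥0∞} (hε : 0 < ε) :
    ∃ δ > 0, ∀ g : Space N → ℝ, IsMollifier g → (∀ y, g y ≠ 0 → ‖y‖ < δ) →
      eLpNorm (fun x => mollify g f x - f x) (ENNReal.ofReal s) volume ≤ ε := by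
  have h := (tendsto_eLpNorm_translate_sub hs hf).eventually_le_const hε
  obtain ⟨δ, hδ, h⟩ := Metric.eventually_nhds_iff.mp h
  refine ⟨δ, hδ, fun g hg hsupp => ?_⟩
  have h1 := eLpNorm_mollify_sub_le hg hs (hf.locallyIntegrable (one_le_ofReal hs)) Set.univ
    (K := ε) (fun y hy => by
      rw [Measure.restrict_univ]
      exact h (by rw [dist_zero_right]; exact hsupp y hy))
  rwa [Measure.restrict_univ] at h1

theorem mollify_eq_convolution (g f : Space N → ℝ) :
    mollify g f = convolution g f (ContinuousLinearMap.lsmul ℝ ℝ) volume := rfl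

theorem contDiff_mollify {g : Space N → ℝ} (hg : IsMollifier g) {f : Space N → ℝ}
    (hf : LocallyIntegrable f) : ContDiff ℝ ∞ (mollify g f) := by
  rw [mollify_eq_convolution]
  exact hg.hasCompactSupport.contDiff_convolution_left _ hg.contDiff hf

theorem fderiv_mollify_apply {g : Space N → ℝ} (hg : IsMollifier g) {f : Space N → ℝ}
    (hf : LocallyIntegrable f) (x v : Space N) :
    fderiv ℝ (mollify g f) x v = - ∫ y, f y * fderiv ℝ (fun z => g (x - z)) y v := by
  have h := hg.hasCompactSupport.hasFDerivAt_convolution_left (μ := volume)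
    (ContinuousLinearMap.lsmul ℝ ℝ) (hg.contDiff.of_le (by exact_mod_cast le_top)) hf x
  rw [mollify_eq_convolution, h.fderiv]
  have hint : Integrable (fun t => (((ContinuousLinearMap.lsmul ℝ ℝ).precompL (Space N)
      : (Space N →L[ℝ] ℝ) →L[ℝ] ℝ →L[ℝ] (Space N →L[ℝ] ℝ)) (fderiv ℝ g t)) (f (x - t))) volume :=
    (hg.hasCompactSupport.fderiv ℝ).convolutionExists_left _
      (hg.contDiff.continuous_fderiv (by simp)) hf x
  rw [convolution, ContinuousLinearMap.integral_apply hint, ← integral_neg,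
    ← integral_sub_left_eq_self _ volume x]
  congr 1
  ext y
  have h2 : HasFDerivAt (fun z => g (x - z)) (-(fderiv ℝ g (x - y))) y := by
    have h3 := (hg.contDiff.differentiable (by simp) (x - y)).hasFDerivAt.comp y
      ((hasFDerivAt_id y).const_sub x)
    simpa using! h3
  rw [h2.fderiv, sub_sub_cancel]
  simp [ContinuousLinearMap.precompL_apply, mul_comm]

end Mollify

/-! ### Weak gradients -/

section WeakGradient

variable {Ω : Set (Space N)}

theorem integrable_mul_test {F : Type*} [NormedAddCommGroup F] [NormedSpace ℝ F]
    {h : Space N → F} (hh : LocallyIntegrableOn h Ω) {ψ : Space N → ℝ}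
    (hψ : Continuous ψ) (hc : HasCompactSupport ψ) (hs : tsupport ψ ⊆ Ω) :
    Integrable (fun x => ψ x • h x) := by
  have h1 : IntegrableOn h (tsupport ψ) := hh.integrableOn_compact_subset hs hc
  have h2 : IntegrableOn (fun x => ψ x • h x) (tsupport ψ) :=
    h1.continuousOn_smul hψ.continuousOn hc
  refine (integrableOn_iff_integrable_of_support_subset ?_).mp h2
  intro x hx
  refine subset_tsupport ψ ?_
  intro h0
  simp [h0] at hx

theorem integral_domain_eq {h : Space N → ℝ} {ψ : Space N → ℝ} (hs : tsupport ψ ⊆ Ω)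
    (hz : ∀ x, ψ x = 0 → h x = 0) : ∫ x in Ω, h x = ∫ x, h x :=
  setIntegral_eq_integral_of_forall_compl_eq_zero fun x hx =>
    hz x (image_eq_zero_of_notMem_tsupport fun h => hx (hs h))

theorem HasWeakGradient.integrable_left {u : Space N → ℝ} {g : Space N → Space N}
    (h : HasWeakGradient Ω u g) {φ : Space N → ℝ} (hφ : ContDiff ℝ ∞ φ)
    (hc : HasCompactSupport φ) (hs : tsupport φ ⊆ Ω) (v : Space N) :
    IntegrableOn (fun x => u x * fderiv ℝ φ x v) Ω := by
  have := integrable_mul_test h.1 (ψ := fun x => fderiv ℝ φ x v)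
    ((hφ.continuous_fderiv (by simp)).clm_apply continuous_const)
    (hc.fderiv_apply ℝ v) ((tsupport_fderiv_apply_subset ℝ v).trans hs)
  simp only [smul_eq_mul, mul_comm] at this
  exact this.integrableOn

theorem HasWeakGradient.integrable_right {u : Space N → ℝ} {g : Space N → Space N}
    (h : HasWeakGradient Ω u g) {φ : Space N → ℝ} (hφ : ContDiff ℝ ∞ φ)
    (hc : HasCompactSupport φ) (hs : tsupport φ ⊆ Ω) (v : Space N) :
    IntegrableOn (fun x => inner ℝ (g x) v * φ x) Ω := by
  have := (integrable_mul_test h.2.1 hφ.continuous hc hs).inner_const (𝕜 := ℝ) v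
  simp only [real_inner_smul_left] at this
  simpa only [mul_comm] using this.integrableOn

theorem HasWeakGradient.ae_eq (hΩ : IsOpen Ω) {u : Space N → ℝ} {g g' : Space N → Space N}
    (h : HasWeakGradient Ω u g) (h' : HasWeakGradient Ω u g') : g =ᵐ[domainMeasure Ω] g' := by
  have key : ∀ᵐ x, x ∈ Ω → (g - g') x = 0 := by
    refine hΩ.ae_eq_zero_of_integral_contDiff_smul_eq_zero (h.2.1.sub h'.2.1)
      fun φ hφ hc hs => ?_
    have hi := integrable_mul_test (h.2.1.sub h'.2.1) hφ.continuous hc hs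
    refine ext_inner_left ℝ fun v => ?_
    rw [inner_zero_right, ← integral_inner hi]
    have e : ∀ x, inner ℝ v (φ x • (g - g') x) = inner ℝ (g x) v * φ x - inner ℝ (g' x) v * φ x := by
      intro x
      rw [inner_smul_right, Pi.sub_apply, inner_sub_right, real_inner_comm, real_inner_comm (g' x)]
      ring
    simp only [e]
    rw [← integral_domain_eq hs (fun x hx => by rw [hx]; ring),
      integral_sub (h.integrable_right hφ hc hs v) (h'.integrable_right hφ hc hs v)]
    have h1 := h.2.2 φ hφ hc hs v
    have h2 := h'.2.2 φ hφ hc hs v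
    linarith
  rw [domainMeasure, EventuallyEq, ae_restrict_iff' hΩ.measurableSet]
  filter_upwards [key] with x hx hxΩ
  exact sub_eq_zero.mp (hx hxΩ)

theorem HasWeakGradient.weakGradient {u : Space N → ℝ} {g : Space N → Space N}
    (h : HasWeakGradient Ω u g) : HasWeakGradient Ω u (weakGradient Ω u) := by
  have hex : ∃ g, HasWeakGradient Ω u g := ⟨g, h⟩
  rw [PQSteklov.weakGradient, dif_pos hex]
  exact hex.choose_spec

theorem HasWeakGradient.weakGradient_ae_eq (hΩ : IsOpen Ω) {u : Space N → ℝ}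
    {g : Space N → Space N} (h : HasWeakGradient Ω u g) :
    PQSteklov.weakGradient Ω u =ᵐ[domainMeasure Ω] g :=
  h.weakGradient.ae_eq hΩ h

theorem HasWeakGradient.add {u u' : Space N → ℝ} {g g' : Space N → Space N}
    (h : HasWeakGradient Ω u g) (h' : HasWeakGradient Ω u' g') :
    HasWeakGradient Ω (u + u') (g + g') := by
  refine ⟨h.1.add h'.1, h.2.1.add h'.2.1, fun φ hφ hc hs v => ?_⟩
  have e1 := integral_add (h.integrable_left hφ hc hs v) (h'.integrable_left hφ hc hs v)
  have e2 := integral_add (h.integrable_right hφ hc hs v) (h'.integrable_right hφ hc hs v)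
  rw [h.2.2 φ hφ hc hs v, h'.2.2 φ hφ hc hs v] at e1
  simp only [Pi.add_apply, add_mul, inner_add_left]
  linarith

theorem HasWeakGradient.const_smul {u : Space N → ℝ} {g : Space N → Space N}
    (h : HasWeakGradient Ω u g) (c : ℝ) : HasWeakGradient Ω (c • u) (c • g) := by
  refine ⟨h.1.smul c, h.2.1.smul c, fun φ hφ hc hs v => ?_⟩
  simp only [Pi.smul_apply, smul_eq_mul, real_inner_smul_left, mul_assoc]
  rw [integral_const_mul, integral_const_mul, h.2.2 φ hφ hc hs v, mul_neg]

theorem HasWeakGradient.congr {u u' : Space N → ℝ} {g g' : Space N → Space N}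
    (h : HasWeakGradient Ω u g) (hu : LocallyIntegrableOn u' Ω) (hg : LocallyIntegrableOn g' Ω)
    (eu : u =ᵐ[domainMeasure Ω] u') (eg : g =ᵐ[domainMeasure Ω] g') :
    HasWeakGradient Ω u' g' := by
  refine ⟨hu, hg, fun φ hφ hc hs v => ?_⟩
  have e1 : ∫ x in Ω, u' x * fderiv ℝ φ x v = ∫ x in Ω, u x * fderiv ℝ φ x v := by
    refine integral_congr_ae ?_
    filter_upwards [eu] with x hx
    rw [hx]
  have e2 : ∫ x in Ω, inner ℝ (g' x) v * φ x = ∫ x in Ω, inner ℝ (g x) v * φ x := by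
    refine integral_congr_ae ?_
    filter_upwards [eg] with x hx
    rw [hx]
  rw [e1, e2, h.2.2 φ hφ hc hs v]

theorem continuous_gradient {φ : Space N → ℝ} (hφ : ContDiff ℝ ∞ φ) : Continuous (gradient φ) :=
  (InnerProductSpace.toDual ℝ (Space N)).symm.continuous.comp (hφ.continuous_fderiv (by simp))

theorem norm_gradient (φ : Space N → ℝ) (x : Space N) : ‖gradient φ x‖ = ‖fderiv ℝ φ x‖ := by
  rw [gradient, LinearIsometryEquiv.norm_map]

theorem hasWeakGradient_of_contDiff {φ : Space N → ℝ} (hφ : ContDiff ℝ ∞ φ) :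
    HasWeakGradient Ω φ (gradient φ) := by
  refine ⟨hφ.continuous.locallyIntegrable.locallyIntegrableOn _,
    (continuous_gradient hφ).locallyIntegrable.locallyIntegrableOn _, fun ψ hψ hc hs v => ?_⟩
  have hd : ∀ x, fderiv ℝ ψ x v ≠ 0 → x ∈ tsupport ψ := fun x hx =>
    tsupport_fderiv_apply_subset ℝ v (subset_tsupport (fun x => fderiv ℝ ψ x v) hx)
  have e1 : ∫ x in Ω, φ x * fderiv ℝ ψ x v = ∫ x, φ x * fderiv ℝ ψ x v :=
    setIntegral_eq_integral_of_forall_compl_eq_zero fun x hx => by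
      by_contra h
      exact hx (hs (hd x fun h0 => h (by rw [h0, mul_zero])))
  rw [e1, integral_domain_eq hs (fun x hx => by rw [hx, mul_zero])]
  simp only [inner_gradient_left]
  have cφ' : Continuous fun x => fderiv ℝ φ x v :=
    (hφ.continuous_fderiv (by simp)).clm_apply continuous_const
  have cψ' : Continuous fun x => fderiv ℝ ψ x v :=
    (hψ.continuous_fderiv (by simp)).clm_apply continuous_const
  refine integral_mul_fderiv_eq_neg_fderiv_mul_of_integrable ?_ ?_ ?_
    (fun x _ => hφ.differentiable (by simp) x) (fun x _ => hψ.differentiable (by simp) x)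
  · exact (cφ'.mul hψ.continuous).integrable_of_hasCompactSupport hc.mul_left
  · exact (hφ.continuous.mul cψ').integrable_of_hasCompactSupport (hc.fderiv_apply ℝ v).mul_left
  · exact (hφ.continuous.mul hψ.continuous).integrable_of_hasCompactSupport hc.mul_left

/-- Mollification commutes with the weak gradient at the points `x` for which `x - tsupport g`
stays inside the domain. -/
theorem gradient_mollify (hΩ : IsOpen Ω) {u : Space N → ℝ} {G : Space N → Space N}
    (h : HasWeakGradient Ω u G) (hu : IntegrableOn u Ω) (hG : IntegrableOn G Ω)
    {g : Space N → ℝ} (hg : IsMollifier g) {x : Space N} (hx : ∀ y ∈ tsupport g, x - y ∈ Ω) :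
    gradient (mollify g (Ω.indicator u)) x = mollify g (Ω.indicator G) x := by
  have hu' : LocallyIntegrable (Ω.indicator u) :=
    ((integrable_indicator_iff hΩ.measurableSet).mpr hu).locallyIntegrable
  have hG' : LocallyIntegrable (Ω.indicator G) :=
    ((integrable_indicator_iff hΩ.measurableSet).mpr hG).locallyIntegrable
  set φ : Space N → ℝ := fun z => g (x - z) with hφd
  have hφ : ContDiff ℝ ∞ φ := hg.contDiff.comp (contDiff_const.sub contDiff_id)
  have hts : ∀ z ∈ tsupport φ, x - z ∈ tsupport g := by
    intro z hz
    have h1 : Function.support φ ⊆ (fun z => x - z) ⁻¹' tsupport g := fun z hz =>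
      subset_tsupport g hz
    exact closure_minimal h1 ((isClosed_tsupport g).preimage (by fun_prop)) hz
  have hs : tsupport φ ⊆ Ω := fun z hz => by
    have := hx _ (hts z hz)
    rwa [sub_sub_cancel] at this
  have hc : HasCompactSupport φ := by
    have := hg.hasCompactSupport.comp_homeomorph (Homeomorph.subLeft x)
    exact this
  refine ext_inner_right ℝ fun v => ?_
  rw [inner_gradient_left, fderiv_mollify_apply hg hu']
  have e1 : ∫ y, Ω.indicator u y * fderiv ℝ φ y v = ∫ y in Ω, u y * fderiv ℝ φ y v := by
    rw [← integral_indicator hΩ.measurableSet]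
    congr 1; ext y
    by_cases hy : y ∈ Ω <;> simp [hy]
  rw [e1, h.2.2 φ hφ hc hs v, neg_neg]
  have hint := integrable_mollify hg hG' x
  rw [mollify, real_inner_comm, ← integral_inner hint, ← integral_indicator hΩ.measurableSet,
    ← integral_sub_left_eq_self _ volume x]
  congr 1; ext y
  by_cases hy : x - y ∈ Ω
  · simp only [Set.indicator_of_mem hy, inner_smul_right, hφd, sub_sub_cancel]
    rw [real_inner_comm]; ring
  · simp [Set.indicator_of_notMem hy]

end WeakGradient

/-! ### The cone condition at the boundary -/

section Charts

/-- The open cone condition: from every point of `Ω ∩ U` one stays in `Ω` when moving by a vector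
`t • z` with `z` in the ball `B(z₀, κ)` and `0 < t < δ`. -/
def ConeCondition (Ω U : Set (Space N)) (z₀ : Space N) (κ δ : ℝ) : Prop :=
  0 < κ ∧ 0 < δ ∧ ∀ y ∈ Ω ∩ U, ∀ t, 0 < t → t < δ → ∀ z ∈ Metric.ball z₀ κ, y + t • z ∈ Ω

/-- Every point of the closure has a neighbourhood satisfying a cone condition. At a boundary point
the direction is that of the graph, and the aperture `κ` is chosen from a Lipschitz constant of `γ`. -/
theorem exists_coneCondition {Ω : Set (Space N)} (hΩ : IsSmoothBoundedDomain Ω) {x : Space N}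
    (hx : x ∈ closure Ω) :
    ∃ ρ > 0, ∃ z₀ κ δ, ConeCondition Ω (Metric.ball x ρ) z₀ κ δ := by
  by_cases hxΩ : x ∈ Ω
  · obtain ⟨r, hr, hsub⟩ := Metric.isOpen_iff.mp hΩ.isOpen x hxΩ
    refine ⟨r / 2, by positivity, 0, 1, r / 2, one_pos, by positivity, fun y hy t ht htδ z hz => ?_⟩
    refine hsub ?_
    have h1 := mem_ball_iff_norm.mp hy.2
    have h2 := mem_ball_zero_iff.mp hz
    rw [mem_ball_iff_norm]
    have h3 : ‖t • z‖ ≤ t := by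
      rw [norm_smul, Real.norm_of_nonneg ht.le]
      exact mul_le_of_le_one_right ht.le h2.le
    have h4 : y + t • z - x = (y - x) + t • z := by abel
    rw [h4]
    linarith [norm_add_le (y - x) (t • z)]
  · have hfr : x ∈ frontier Ω := ⟨hx, by rwa [hΩ.isOpen.interior_eq]⟩
    obtain ⟨e, he, γ, hγ, hγe, r, hr, hΩr⟩ := hΩ.smooth_boundary x hfr
    have hγ1 : ContDiff ℝ 1 γ := hγ.of_le (by exact_mod_cast le_top)
    obtain ⟨K, V, hV, hK⟩ := (hγ1.contDiffAt (x := x)).exists_lipschitzOnWith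
    obtain ⟨r₁, hr₁, hVr⟩ := Metric.mem_nhds_iff.mp hV
    set r' := min r r₁ with hr'
    have hr'0 : 0 < r' := lt_min hr hr₁
    have hκ : 0 < 1 / ((K : ℝ) + 1) := by positivity
    set κ := 1 / ((K : ℝ) + 1) with hκd
    have hκ1 : κ ≤ 1 := by
      rw [hκd, div_le_one (by positivity)]; linarith [K.2]
    -- moving by `t z` raises `⟪e, ·⟫` by at least `t (1 - κ)` and `γ` by at most `K t κ`; the choice
    -- of `κ` makes the two equal
    have hKκ : K * κ = 1 - κ := by rw [hκd]; field_simp; ring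
    refine ⟨r' / 2, by positivity, e, κ, r' / 4, hκ, by positivity, fun y hy t ht htδ z hz => ?_⟩
    have hy1 := mem_ball_iff_norm.mp hy.2
    have hz1 := mem_ball_iff_norm.mp hz
    have hz2 : ‖z‖ ≤ 2 := by
      have := norm_sub_norm_le z e
      linarith
    have hb1 : y + t • z ∈ Metric.ball x r' := by
      rw [mem_ball_iff_norm]
      have h3 : ‖t • z‖ ≤ t * 2 := by
        rw [norm_smul, Real.norm_of_nonneg ht.le]; gcongr
      have h4 : y + t • z - x = (y - x) + t • z := by abel
      rw [h4]
      linarith [norm_add_le (y - x) (t • z)]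
    have hb2 : y + t • (z - e) ∈ Metric.ball x r' := by
      rw [mem_ball_iff_norm]
      have h3 : ‖t • (z - e)‖ ≤ t * 1 := by
        rw [norm_smul, Real.norm_of_nonneg ht.le]; gcongr; linarith
      have h4 : y + t • (z - e) - x = (y - x) + t • (z - e) := by abel
      rw [h4]
      linarith [norm_add_le (y - x) (t • (z - e))]
    have hyb : y ∈ Metric.ball x r' := Metric.ball_subset_ball (by linarith) hy.2
    have hmem : ∀ {w}, w ∈ Metric.ball x r' → w ∈ Metric.ball x r ∧ w ∈ V := fun hw =>
      ⟨Metric.ball_subset_ball (min_le_left _ _) hw,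
        hVr (Metric.ball_subset_ball (min_le_right _ _) hw)⟩
    rw [hΩr _ (hmem hb1).1]
    have hyΩ := (hΩr y (hmem hyb).1).mp hy.1
    have e1 : y + t • z = (y + t • (z - e)) + t • e := by
      rw [smul_sub]; abel
    have hlip := hK.norm_sub_le (hmem hb2).2 (hmem hyb).2
    rw [add_sub_cancel_left, norm_smul, Real.norm_of_nonneg ht.le] at hlip
    have h5 : γ (y + t • (z - e)) - γ y ≤ K * (t * κ) := by
      refine (le_abs_self _).trans (hlip.trans ?_)
      gcongr
    have h6 : 1 - κ ≤ inner ℝ e z := by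
      have h7 : inner ℝ e z = 1 + inner ℝ e (z - e) := by
        rw [inner_sub_right, real_inner_self_eq_norm_sq, he]; ring
      have h8 := abs_real_inner_le_norm e (z - e)
      rw [he, one_mul] at h8
      rw [h7]
      linarith [neg_abs_le (inner ℝ e (z - e))]
    have h9 : inner ℝ e (y + t • z) = inner ℝ e y + t * inner ℝ e z := by
      rw [inner_add_right, inner_smul_right]
    rw [h9]
    rw [e1, hγe]
    have h10 : t * (1 - κ) ≤ t * inner ℝ e z := by gcongr
    have h11 : K * (t * κ) = t * (1 - κ) := by rw [← hKκ]; ring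
    linarith

/-- A mollifier supported in the cone opposite to that of a cone condition, at the scale `t`. -/
theorem exists_isMollifier (z₀ : Space N) {κ t : ℝ} (hκ : 0 < κ) (ht : 0 < t) :
    ∃ g : Space N → ℝ, IsMollifier g ∧
      ∀ y ∈ tsupport g, ∃ z ∈ Metric.ball z₀ κ, y = -(t • z) := by
  let f : ContDiffBump (-(t • z₀) : Space N) := ⟨t * κ / 4, t * κ / 2, by positivity, by
    have : 0 < t * κ := by positivity
    linarith⟩
  refine ⟨f.normed volume, ⟨f.contDiff_normed, f.hasCompactSupport_normed,
    f.nonneg_normed, f.integral_normed⟩, fun y hy => ?_⟩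
  rw [f.tsupport_normed_eq, mem_closedBall_iff_norm] at hy
  refine ⟨-(t⁻¹ • y), ?_, by rw [smul_neg, smul_inv_smul₀ ht.ne', neg_neg]⟩
  rw [mem_ball_iff_norm]
  have e : -(t⁻¹ • y) - z₀ = -(t⁻¹ • (y - -(t • z₀))) := by
    rw [sub_neg_eq_add, smul_add, inv_smul_smul₀ ht.ne']; abel
  rw [e, norm_neg, norm_smul, norm_inv, Real.norm_of_nonneg ht.le, ← div_eq_inv_mul,
    div_lt_iff₀ ht]
  have : 0 < t * κ := by positivity
  have hle : ‖y - -(t • z₀)‖ ≤ t * κ / 2 := hy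
  linarith

end Charts

/-! ### Density of smooth functions -/

section Density

variable {Ω : Set (Space N)}

theorem IsSmoothBoundedDomain.isFiniteMeasure (hΩ : IsSmoothBoundedDomain Ω) :
    IsFiniteMeasure (domainMeasure Ω) :=
  ⟨by rw [domainMeasure, Measure.restrict_apply_univ]; exact hΩ.isBounded.measure_lt_top⟩

theorem MemLp.integrableOn_domain {F : Type*} [NormedAddCommGroup F]
    (hΩ : IsSmoothBoundedDomain Ω) {s : ℝ} (hs : 1 ≤ s) {f : Space N → F}
    (hf : MemLp f (ENNReal.ofReal s) (domainMeasure Ω)) : IntegrableOn f Ω := by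
  have := hΩ.isFiniteMeasure
  exact hf.integrable (one_le_ofReal hs)

/-- Local approximation by mollification with a kernel shifted into the cone, for which the
convolution near the boundary only uses values of `u` inside the domain. -/
theorem exists_local_approx (hΩ : IsSmoothBoundedDomain Ω) {s : ℝ} (hs : 1 ≤ s)
    {u : Space N → ℝ} {G : Space N → Space N} (h : HasWeakGradient Ω u G)
    (hu : MemLp u (ENNReal.ofReal s) (domainMeasure Ω))
    (hG : MemLp G (ENNReal.ofReal s) (domainMeasure Ω)) {U : Set (Space N)} (hU : IsOpen U)
    {z₀ : Space N} {κ δ : ℝ} (hcone : ConeCondition Ω U z₀ κ δ) {ε : ℝ≥0∞} (hε : 0 < ε) :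
    ∃ ψ : Space N → ℝ, ContDiff ℝ ∞ ψ ∧
      eLpNorm (fun x => ψ x - u x) (ENNReal.ofReal s) (volume.restrict (Ω ∩ U)) ≤ ε ∧
      eLpNorm (fun x => gradient ψ x - G x) (ENNReal.ofReal s) (volume.restrict (Ω ∩ U)) ≤ ε := by
  obtain ⟨hκ, hδ, hcone⟩ := hcone
  have hΩm := hΩ.isOpen.measurableSet
  have hui : MemLp (Ω.indicator u) (ENNReal.ofReal s) := (memLp_indicator_iff_restrict hΩm).mpr hu
  have hGi : MemLp (Ω.indicator G) (ENNReal.ofReal s) := (memLp_indicator_iff_restrict hΩm).mpr hG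
  obtain ⟨δ₁, hδ₁, h₁⟩ := exists_mollify_close hs hui hε
  obtain ⟨δ₂, hδ₂, h₂⟩ := exists_mollify_close hs hGi hε
  obtain ⟨t, ht, htδ, ht₁, ht₂⟩ : ∃ t, 0 < t ∧ t < δ ∧ t * (‖z₀‖ + κ) < δ₁ ∧
      t * (‖z₀‖ + κ) < δ₂ := by
    have hc : Tendsto (fun t : ℝ => t * (‖z₀‖ + κ)) (𝓝[>] 0) (𝓝 0) := by
      have : Tendsto (fun t : ℝ => t * (‖z₀‖ + κ)) (𝓝 0) (𝓝 (0 * (‖z₀‖ + κ))) :=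
        (continuous_id.mul continuous_const).tendsto 0
      rw [zero_mul] at this
      exact this.mono_left nhdsWithin_le_nhds
    obtain ⟨t, h⟩ := ((eventually_mem_nhdsWithin (a := (0 : ℝ)) (s := Set.Ioi 0)).and
      (((tendsto_id.mono_left nhdsWithin_le_nhds).eventually_lt_const hδ).and
      ((hc.eventually_lt_const hδ₁).and (hc.eventually_lt_const hδ₂)))).exists
    exact ⟨t, h.1, h.2.1, h.2.2.1, h.2.2.2⟩
  obtain ⟨g, hg, hsupp⟩ := exists_isMollifier z₀ hκ ht
  have hnorm : ∀ y, g y ≠ 0 → ‖y‖ ≤ t * (‖z₀‖ + κ) := by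
    intro y hy
    obtain ⟨z, hz, rfl⟩ := hsupp y (subset_tsupport g hy)
    rw [norm_neg, norm_smul, Real.norm_of_nonneg ht.le]
    gcongr
    have := norm_sub_norm_le z z₀
    linarith [mem_ball_iff_norm.mp hz]
  have hin : ∀ x ∈ Ω ∩ U, ∀ y ∈ tsupport g, x - y ∈ Ω := by
    intro x hx y hy
    obtain ⟨z, hz, rfl⟩ := hsupp y hy
    rw [sub_neg_eq_add]
    exact hcone x hx t ht htδ z hz
  have hmeas : MeasurableSet (Ω ∩ U) := hΩm.inter hU.measurableSet
  refine ⟨mollify g (Ω.indicator u), contDiff_mollify hg (hui.locallyIntegrable (one_le_ofReal hs)),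
    ?_, ?_⟩
  · refine le_trans (le_of_eq (eLpNorm_congr_ae ?_)) ((eLpNorm_mono_measure _
      Measure.restrict_le_self).trans (h₁ g hg fun y hy => (hnorm y hy).trans_lt ht₁))
    filter_upwards [ae_restrict_mem hmeas] with x hx
    rw [Set.indicator_of_mem hx.1]
  · refine le_trans (le_of_eq (eLpNorm_congr_ae ?_)) ((eLpNorm_mono_measure _
      Measure.restrict_le_self).trans (h₂ g hg fun y hy => (hnorm y hy).trans_lt ht₂))
    filter_upwards [ae_restrict_mem hmeas] with x hx
    rw [Set.indicator_of_mem hx.1, gradient_mollify hΩ.isOpen h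
      (MemLp.integrableOn_domain hΩ hs hu) (MemLp.integrableOn_domain hΩ hs hG) hg (hin x hx)]

theorem exists_finite_cone_cover (hΩ : IsSmoothBoundedDomain Ω) :
    ∃ T : Finset (Space N), ∃ U : T → Set (Space N), ∃ z₀ : T → Space N, ∃ κ δ : T → ℝ,
      (∀ i, IsOpen (U i)) ∧ closure Ω ⊆ ⋃ i, U i ∧
      ∀ i, ConeCondition Ω (U i) (z₀ i) (κ i) (δ i) := by
  have hcomp : IsCompact (closure Ω) := hΩ.isBounded.isCompact_closure
  choose! ρ hρ z₀ κ δ hcone using fun x (hx : x ∈ closure Ω) => exists_coneCondition hΩ hx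
  obtain ⟨T, hT, hcov⟩ := hcomp.elim_nhds_subcover (fun x => Metric.ball x (ρ x))
    fun x hx => Metric.ball_mem_nhds x (hρ x hx)
  refine ⟨T, fun i => Metric.ball i (ρ i), fun i => z₀ i, fun i => κ i, fun i => δ i,
    fun i => Metric.isOpen_ball, ?_, fun i => hcone i (hT i i.2)⟩
  rwa [Set.iUnion_subtype]

/-- A smooth partition of unity on a closed set, with the gradients vanishing outside the cover. -/
theorem exists_partition {ι : Type} [Fintype ι] {S : Set (Space N)} (hS : IsClosed S)
    {U : ι → Set (Space N)} (hU : ∀ i, IsOpen (U i)) (hcov : S ⊆ ⋃ i, U i) :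
    ∃ χ : ι → Space N → ℝ, (∀ i, ContDiff ℝ ∞ (χ i)) ∧ (∀ i x, x ∉ U i → χ i x = 0) ∧
      (∀ i x, x ∉ U i → gradient (χ i) x = 0) ∧ (∀ i x, |χ i x| ≤ 1) ∧ ∀ x ∈ S, ∑ i, χ i x = 1 := by
  obtain ⟨f, hf⟩ := SmoothPartitionOfUnity.exists_isSubordinate
    (modelWithCornersSelf ℝ (Space N)) hS U hU hcov
  refine ⟨fun i => f i, fun i => (f i).contMDiff.contDiff, fun i x hx => ?_, fun i x hx => ?_,
    fun i x => ?_, fun x hx => ?_⟩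
  · exact image_eq_zero_of_notMem_tsupport fun h => hx (hf i h)
  · have h1 : fderiv ℝ (f i) x = 0 := by
      by_contra h
      exact hx (hf i (support_fderiv_subset ℝ h))
    rw [gradient, h1, map_zero]
  · rw [abs_of_nonneg (f.nonneg i x)]
    exact f.le_one i x
  · rw [← finsum_eq_sum_of_fintype]
    exact f.sum_eq_one hx

theorem eLpNorm_le_of_local {F F' : Type*} [NormedAddCommGroup F] [NormedAddCommGroup F']
    (hΩ : IsOpen Ω) {U : Set (Space N)} (hU : IsOpen U) {p : ℝ≥0∞} {k : Space N → F}
    {h : Space N → F'} {C : ℝ} (hk : ∀ x ∈ Ω ∩ U, ‖k x‖ ≤ C * ‖h x‖)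
    (hk0 : ∀ x, x ∉ U → k x = 0) :
    eLpNorm k p (domainMeasure Ω) ≤
      ENNReal.ofReal C * eLpNorm h p (volume.restrict (Ω ∩ U)) := by
  have e : eLpNorm h p (volume.restrict (Ω ∩ U)) = eLpNorm (U.indicator h) p (domainMeasure Ω) := by
    rw [eLpNorm_indicator_eq_eLpNorm_restrict hU.measurableSet, domainMeasure,
      Measure.restrict_restrict hU.measurableSet, Set.inter_comm]
  rw [e]
  refine eLpNorm_le_mul_eLpNorm_of_ae_le_mul ?_ p
  filter_upwards [ae_restrict_mem hΩ.measurableSet] with x hx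
  by_cases hxU : x ∈ U
  · rw [Set.indicator_of_mem hxU]
    exact hk x ⟨hx, hxU⟩
  · simp [hk0 x hxU, Set.indicator_of_notMem hxU]

/-- Smooth functions on the whole space are dense in the Sobolev space of `Ω`. The local
approximations are glued by a partition of unity `χ`; the terms with `∇χ` cancel in the limit since
`∑ ∇χ = 0`. -/
theorem exists_smooth_approx (hΩ : IsSmoothBoundedDomain Ω) {s : ℝ} (hs : 1 ≤ s)
    {u : Space N → ℝ} {G : Space N → Space N} (h : HasWeakGradient Ω u G)
    (hu : MemLp u (ENNReal.ofReal s) (domainMeasure Ω))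
    (hG : MemLp G (ENNReal.ofReal s) (domainMeasure Ω)) :
    ∃ φ : ℕ → Space N → ℝ, (∀ n, ContDiff ℝ ∞ (φ n)) ∧
      Tendsto (fun n => eLpNorm (fun x => φ n x - u x) (ENNReal.ofReal s) (domainMeasure Ω))
        atTop (𝓝 0) ∧
      Tendsto (fun n => eLpNorm (fun x => gradient (φ n) x - G x) (ENNReal.ofReal s)
        (domainMeasure Ω)) atTop (𝓝 0) := by
  obtain ⟨T, U, z₀, κ, δ, hU, hcov, hcone⟩ := exists_finite_cone_cover hΩ
  obtain ⟨χ, hχ, hχ0, hχ0', hχ1, hχs⟩ := exists_partition isClosed_closure hU hcov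
  have hgrad : ∀ i, ∃ C : ℝ, 0 ≤ C ∧ ∀ x ∈ Ω, ‖gradient (χ i) x‖ ≤ C := by
    intro i
    obtain ⟨C, hC⟩ := hΩ.isBounded.isCompact_closure.exists_bound_of_continuousOn
      (continuous_gradient (hχ i)).continuousOn
    exact ⟨max C 0, le_max_right _ _, fun x hx => (hC x (subset_closure hx)).trans (le_max_left _ _)⟩
  choose C hC0 hC using hgrad
  choose ψ hψ hψu hψG using fun (i : T) (n : ℕ) => exists_local_approx hΩ hs h hu hG (hU i)
    (hcone i) (ε := ((n : ℝ≥0∞) + 1)⁻¹) (by simp)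
  have hε : Tendsto (fun n : ℕ => ((n : ℝ≥0∞) + 1)⁻¹) atTop (𝓝 0) := by
    have := ENNReal.tendsto_inv_nat_nhds_zero.comp (tendsto_add_atTop_nat 1)
    refine this.congr fun n => ?_
    simp
  have hsum0 : ∀ x ∈ Ω, ∑ i, gradient (χ i) x = 0 := by
    intro x hx
    have h1 : (fun y => ∑ i, χ i y) =ᶠ[𝓝 x] fun _ => 1 := by
      filter_upwards [hΩ.isOpen.mem_nhds hx] with y hy
      exact hχs y (subset_closure hy)
    have h2 : fderiv ℝ (fun y => ∑ i, χ i y) x = ∑ i, fderiv ℝ (χ i) x :=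
      fderiv_fun_sum fun i _ => (hχ i).differentiable (by simp) x
    rw [h1.fderiv_eq, fderiv_const_apply] at h2
    simp only [gradient, ← map_sum, ← h2, map_zero]
  have hφ : ∀ n, ContDiff ℝ ∞ fun x => ∑ i, χ i x * ψ i n x := fun n =>
    ContDiff.sum fun i _ => (hχ i).mul (hψ i n)
  have hgradφ : ∀ n, ∀ x, gradient (fun x => ∑ i, χ i x * ψ i n x) x =
      ∑ i, (χ i x • gradient (ψ i n) x + ψ i n x • gradient (χ i) x) := by
    intro n x
    simp only [gradient]
    rw [fderiv_fun_sum fun i _ => ((hχ i).mul (hψ i n)).differentiable (by simp) x, map_sum]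
    refine Finset.sum_congr rfl fun i _ => ?_
    rw [fderiv_fun_mul ((hχ i).differentiable (by simp) x) ((hψ i n).differentiable (by simp) x)]
    simp
  have hum : AEStronglyMeasurable u (domainMeasure Ω) := hu.1
  have hGm : AEStronglyMeasurable G (domainMeasure Ω) := hG.1
  have h1s := one_le_ofReal hs
  refine ⟨fun n x => ∑ i, χ i x * ψ i n x, hφ, ?_, ?_⟩
  · have hle : ∀ n, eLpNorm (fun x => ∑ i, χ i x * ψ i n x - u x) (ENNReal.ofReal s)
        (domainMeasure Ω) ≤ ∑ _i : T, ENNReal.ofReal 1 * ((n : ℝ≥0∞) + 1)⁻¹ := by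
      intro n
      have e : (fun x => ∑ i, χ i x * ψ i n x - u x) =ᵐ[domainMeasure Ω]
          ∑ i, fun x => χ i x * (ψ i n x - u x) := by
        filter_upwards [ae_restrict_mem hΩ.isOpen.measurableSet] with x hx
        simp only [Finset.sum_apply, mul_sub, Finset.sum_sub_distrib]
        rw [← Finset.sum_mul, hχs x (subset_closure hx), one_mul]
      rw [eLpNorm_congr_ae e]
      refine (eLpNorm_sum_le (fun i _ => ?_) h1s).trans (Finset.sum_le_sum fun i _ => ?_)
      · exact (hχ i).continuous.aestronglyMeasurable.mul
          ((hψ i n).continuous.aestronglyMeasurable.sub hum)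
      · refine (eLpNorm_le_of_local hΩ.isOpen (hU i) (h := fun x => ψ i n x - u x) (C := 1)
          (fun x _ => ?_) (fun x hx => by rw [hχ0 i x hx, zero_mul])).trans ?_
        · rw [norm_mul]
          gcongr
          exact hχ1 i x
        · gcongr
          exact hψu i n
    refine tendsto_of_tendsto_of_tendsto_of_le_of_le tendsto_const_nhds ?_ (fun _ => zero_le) hle
    have := tendsto_finsetSum (Finset.univ : Finset T) fun i _ =>
      ENNReal.Tendsto.const_mul hε (Or.inr (ENNReal.ofReal_ne_top (r := 1)))
    simpa using this
  · have hle : ∀ n, eLpNorm (fun x => gradient (fun x => ∑ i, χ i x * ψ i n x) x - G x)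
        (ENNReal.ofReal s) (domainMeasure Ω) ≤
        ∑ i : T, (ENNReal.ofReal 1 * ((n : ℝ≥0∞) + 1)⁻¹ +
          ENNReal.ofReal (C i) * ((n : ℝ≥0∞) + 1)⁻¹) := by
      intro n
      have e : (fun x => gradient (fun x => ∑ i, χ i x * ψ i n x) x - G x) =ᵐ[domainMeasure Ω]
          ∑ i, ((fun x => χ i x • (gradient (ψ i n) x - G x)) +
            fun x => (ψ i n x - u x) • gradient (χ i) x) := by
        filter_upwards [ae_restrict_mem hΩ.isOpen.measurableSet] with x hx
        rw [hgradφ]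
        simp only [Finset.sum_apply, Pi.add_apply, smul_sub, sub_smul, Finset.sum_add_distrib,
          Finset.sum_sub_distrib]
        rw [← Finset.sum_smul, hχs x (subset_closure hx), one_smul, ← Finset.smul_sum,
          hsum0 x hx, smul_zero]
        abel
      rw [eLpNorm_congr_ae e]
      have hm1 : ∀ i, AEStronglyMeasurable (fun x => χ i x • (gradient (ψ i n) x - G x))
          (domainMeasure Ω) := fun i => (hχ i).continuous.aestronglyMeasurable.smul
            ((continuous_gradient (hψ i n)).aestronglyMeasurable.sub hGm)
      have hm2 : ∀ i, AEStronglyMeasurable (fun x => (ψ i n x - u x) • gradient (χ i) x)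
          (domainMeasure Ω) := fun i => ((hψ i n).continuous.aestronglyMeasurable.sub hum).smul
            (continuous_gradient (hχ i)).aestronglyMeasurable
      refine (eLpNorm_sum_le (fun i _ => (hm1 i).add (hm2 i)) h1s).trans
        (Finset.sum_le_sum fun i _ => (eLpNorm_add_le (hm1 i) (hm2 i) h1s).trans ?_)
      refine add_le_add ?_ ?_
      · refine (eLpNorm_le_of_local hΩ.isOpen (hU i) (h := fun x => gradient (ψ i n) x - G x)
          (C := 1) (fun x _ => ?_) (fun x hx => by rw [hχ0 i x hx, zero_smul])).trans ?_
        · rw [norm_smul]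
          gcongr
          exact hχ1 i x
        · gcongr
          exact hψG i n
      · refine (eLpNorm_le_of_local hΩ.isOpen (hU i) (h := fun x => ψ i n x - u x)
          (C := C i) (fun x hx => ?_) (fun x hx => by rw [hχ0' i x hx, smul_zero])).trans ?_
        · rw [norm_smul, mul_comm]
          gcongr
          exact hC i x hx.1
        · gcongr
          exact hψu i n
    refine tendsto_of_tendsto_of_tendsto_of_le_of_le tendsto_const_nhds ?_ (fun _ => zero_le) hle
    have := tendsto_finsetSum (Finset.univ : Finset T) fun i _ =>
      (ENNReal.Tendsto.const_mul hε (Or.inr (ENNReal.ofReal_ne_top (r := 1)))).add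
      (ENNReal.Tendsto.const_mul hε (Or.inr (ENNReal.ofReal_ne_top (r := C i))))
    simpa using this

end Density

/-! ### Translations of Sobolev functions -/

section Translation

variable {Ω : Set (Space N)}

theorem eLpNorm_comp_add_le {F : Type*} [NormedAddCommGroup F] {A : Set (Space N)}
    {f : Space N → F} {p : ℝ≥0∞} (hΩ : IsOpen Ω)
    (hf : AEStronglyMeasurable f (domainMeasure Ω)) {h : Space N} (hA : ∀ x ∈ A, x + h ∈ Ω) :
    eLpNorm (fun x => f (x + h)) p (volume.restrict A) ≤ eLpNorm f p (domainMeasure Ω) := by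
  have h1 := (measurePreserving_add_right volume h).restrict_preimage hΩ.measurableSet
  have h2 := eLpNorm_comp_measurePreserving (p := p) hf h1
  rw [← h2]
  exact eLpNorm_mono_measure _ (Measure.restrict_mono (fun x hx => hA x hx) le_rfl)

/-- The translation estimate for smooth functions: integrate the gradient along the segments from `x`
to `x + h`, which have to stay in the domain. -/
theorem eLpNorm_translate_sub_le_of_contDiff (hΩ : IsOpen Ω) {s : ℝ} (hs : 1 ≤ s)
    {φ : Space N → ℝ} (hφ : ContDiff ℝ ∞ φ) {A : Set (Space N)} {h : Space N}
    (hA : ∀ x ∈ A, ∀ τ ∈ Set.Ioc (0 : ℝ) 1, x + τ • h ∈ Ω) :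
    eLpNorm (fun x => φ (x + h) - φ x) (ENNReal.ofReal s) (volume.restrict A) ≤
      ‖h‖ₑ * eLpNorm (gradient φ) (ENNReal.ofReal s) (domainMeasure Ω) := by
  have hs0 : 0 ≤ s := by linarith
  have hgc := continuous_gradient hφ
  have hprob : IsProbabilityMeasure (volume.restrict (Set.Ioc (0 : ℝ) 1)) := ⟨by simp⟩
  have hjm : Measurable fun z : Space N × ℝ => ‖gradient φ (z.1 + z.2 • h)‖ₑ :=
    (hgc.comp (by fun_prop)).enorm.measurable
  rw [eLpNorm_ofReal_le_iff hs, ENNReal.mul_rpow_of_nonneg _ _ hs0, eLpNorm_ofReal_rpow hs]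
  calc ∫⁻ x in A, ‖φ (x + h) - φ x‖ₑ ^ s
      ≤ ∫⁻ x in A, ‖h‖ₑ ^ s * ∫⁻ τ in Set.Ioc (0 : ℝ) 1, ‖gradient φ (x + τ • h)‖ₑ ^ s := by
        refine lintegral_mono fun x => ?_
        have hd : ∀ τ : ℝ, HasDerivAt (fun τ : ℝ => φ (x + τ • h)) (fderiv ℝ φ (x + τ • h) h) τ := by
          intro τ
          have h1 : HasDerivAt (fun τ : ℝ => x + τ • h) h τ := by
            simpa using ((hasDerivAt_id τ).smul_const h).const_add x
          exact (hφ.differentiable (by simp) _).hasFDerivAt.comp_hasDerivAt τ h1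
        have hcont : Continuous fun τ : ℝ => fderiv ℝ φ (x + τ • h) h :=
          ((hφ.continuous_fderiv (by simp)).comp (by fun_prop)).clm_apply continuous_const
        have hint := intervalIntegral.integral_eq_sub_of_hasDerivAt
          (fun τ _ => hd τ) (hcont.intervalIntegrable 0 1)
        rw [one_smul, zero_smul, add_zero, intervalIntegral.integral_of_le zero_le_one] at hint
        have h2 : ‖φ (x + h) - φ x‖ₑ ≤
            ‖h‖ₑ * ∫⁻ τ in Set.Ioc (0 : ℝ) 1, ‖gradient φ (x + τ • h)‖ₑ := by
          rw [← hint, ← lintegral_const_mul' _ _ enorm_ne_top]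
          refine (enorm_integral_le_lintegral_enorm _).trans (lintegral_mono fun τ => ?_)
          simp only
          rw [← inner_gradient_left, mul_comm]
          rw [← ofReal_norm, ← ofReal_norm, ← ofReal_norm, ← ENNReal.ofReal_mul (norm_nonneg _)]
          exact ENNReal.ofReal_le_ofReal (norm_inner_le_norm _ _)
        calc ‖φ (x + h) - φ x‖ₑ ^ s
            ≤ (‖h‖ₑ * ∫⁻ τ in Set.Ioc (0 : ℝ) 1, ‖gradient φ (x + τ • h)‖ₑ) ^ s := by gcongr
          _ ≤ _ := by
            rw [ENNReal.mul_rpow_of_nonneg _ _ hs0]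
            gcongr
            exact rpow_lintegral_le_lintegral_rpow hs
              (hjm.comp (measurable_prodMk_left (x := x))).aemeasurable
    _ = ‖h‖ₑ ^ s * ∫⁻ τ in Set.Ioc (0 : ℝ) 1, ∫⁻ x in A, ‖gradient φ (x + τ • h)‖ₑ ^ s := by
        rw [lintegral_const_mul' _ _ (by finiteness)]
        congr 1
        exact lintegral_lintegral_swap (hjm.pow_const s).aemeasurable
    _ ≤ ‖h‖ₑ ^ s * ∫⁻ _τ in Set.Ioc (0 : ℝ) 1, ∫⁻ x, ‖gradient φ x‖ₑ ^ s ∂(domainMeasure Ω) := by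
        gcongr 1
        refine setLIntegral_mono' measurableSet_Ioc fun τ hτ => ?_
        have h3 := eLpNorm_comp_add_le (p := ENNReal.ofReal s) hΩ
          (hgc.aestronglyMeasurable (μ := domainMeasure Ω)) (h := τ • h) (fun x hx => hA x hx τ hτ)
        rwa [eLpNorm_ofReal_le_iff hs, eLpNorm_ofReal_rpow hs] at h3
    _ = ‖h‖ₑ ^ s * ∫⁻ x, ‖gradient φ x‖ₑ ^ s ∂(domainMeasure Ω) := by simp

theorem tendsto_eLpNorm_of_sub {F : Type*} [NormedAddCommGroup F] {α : Type*} [MeasurableSpace α]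
    {μ : Measure α} {p : ℝ≥0∞} (hp : 1 ≤ p) {f : ℕ → α → F} {g : α → F}
    (hf : ∀ n, AEStronglyMeasurable (f n) μ) (hg : AEStronglyMeasurable g μ)
    (h : Tendsto (fun n => eLpNorm (fun x => f n x - g x) p μ) atTop (𝓝 0)) :
    Tendsto (fun n => eLpNorm (f n) p μ) atTop (𝓝 (eLpNorm g p μ)) := by
  have h1 := (tendsto_const_nhds (x := eLpNorm g p μ)).add h
  have h2 := ENNReal.Tendsto.sub (tendsto_const_nhds (x := eLpNorm g p μ) (f := atTop)) h
    (Or.inr ENNReal.zero_ne_top)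
  rw [add_zero] at h1
  rw [tsub_zero] at h2
  refine tendsto_of_tendsto_of_tendsto_of_le_of_le h2 h1 (fun n => ?_) fun n => ?_
  · rw [tsub_le_iff_right]
    have e : g = f n - fun x => f n x - g x := by ext1 x; simp
    nth_rewrite 1 [e]
    exact eLpNorm_sub_le (hf n) ((hf n).sub hg) hp
  · have e : f n = g + fun x => f n x - g x := by ext1 x; simp
    nth_rewrite 1 [e]
    exact eLpNorm_add_le hg ((hf n).sub hg) hp

/-- Translations of a Sobolev function are controlled by its gradient. -/
theorem eLpNorm_translate_sub_le (hΩ : IsSmoothBoundedDomain Ω) {s : ℝ} (hs : 1 ≤ s)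
    {u : Space N → ℝ} {G : Space N → Space N} (hw : HasWeakGradient Ω u G)
    (hu : MemLp u (ENNReal.ofReal s) (domainMeasure Ω))
    (hG : MemLp G (ENNReal.ofReal s) (domainMeasure Ω)) {A : Set (Space N)} {h : Space N}
    (hAΩ : A ⊆ Ω) (hA : ∀ x ∈ A, ∀ τ ∈ Set.Ioc (0 : ℝ) 1, x + τ • h ∈ Ω) :
    eLpNorm (fun x => u (x + h) - u x) (ENNReal.ofReal s) (volume.restrict A) ≤
      ‖h‖ₑ * eLpNorm G (ENNReal.ofReal s) (domainMeasure Ω) := by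
  have h1s := one_le_ofReal hs
  obtain ⟨φ, hφ, hφu, hφG⟩ := exists_smooth_approx hΩ hs hw hu hG
  have hφm : ∀ n, AEStronglyMeasurable (φ n) (domainMeasure Ω) := fun n =>
    (hφ n).continuous.aestronglyMeasurable
  have hgm : ∀ n, AEStronglyMeasurable (gradient (φ n)) (domainMeasure Ω) := fun n =>
    (continuous_gradient (hφ n)).aestronglyMeasurable
  have hA1 : ∀ x ∈ A, x + h ∈ Ω := fun x hx => by simpa using hA x hx 1 (by simp)
  have hle : volume.restrict A ≤ domainMeasure Ω := Measure.restrict_mono hAΩ le_rfl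
  have hum : AEStronglyMeasurable u (volume.restrict A) := hu.1.mono_measure hle
  have hum' : AEStronglyMeasurable (fun x => u (x + h)) (volume.restrict A) := by
    have h1 := (measurePreserving_add_right volume h).restrict_preimage hΩ.isOpen.measurableSet
    exact (hu.1.comp_measurePreserving h1).mono_measure
      (Measure.restrict_mono (fun x hx => hA1 x hx) le_rfl)
  have key : ∀ n, eLpNorm (fun x => u (x + h) - u x) (ENNReal.ofReal s) (volume.restrict A) ≤
      eLpNorm (fun x => φ n x - u x) (ENNReal.ofReal s) (domainMeasure Ω) +
      ‖h‖ₑ * (eLpNorm G (ENNReal.ofReal s) (domainMeasure Ω) +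
        eLpNorm (fun x => gradient (φ n) x - G x) (ENNReal.ofReal s) (domainMeasure Ω)) +
      eLpNorm (fun x => φ n x - u x) (ENNReal.ofReal s) (domainMeasure Ω) := by
    intro n
    have e : (fun x => u (x + h) - u x) = (fun x => u (x + h) - φ n (x + h)) +
        (fun x => φ n (x + h) - φ n x) + fun x => φ n x - u x := by
      ext x; simp
    have cφ := (hφ n).continuous
    have m1 : AEStronglyMeasurable (fun x => u (x + h) - φ n (x + h)) (volume.restrict A) :=
      hum'.sub (cφ.comp (by fun_prop)).aestronglyMeasurable
    have m2 : AEStronglyMeasurable (fun x => φ n (x + h) - φ n x) (volume.restrict A) :=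
      ((cφ.comp (by fun_prop)).sub cφ).aestronglyMeasurable
    have m3 : AEStronglyMeasurable (fun x => φ n x - u x) (volume.restrict A) :=
      cφ.aestronglyMeasurable.sub hum
    rw [e]
    refine (eLpNorm_add_le (m1.add m2) m3 h1s).trans (add_le_add
      ((eLpNorm_add_le m1 m2 h1s).trans (add_le_add ?_ ?_)) (eLpNorm_mono_measure _ hle))
    · refine (eLpNorm_comp_add_le hΩ.isOpen (f := fun x => u x - φ n x) (hu.1.sub (hφm n))
        hA1).trans (le_of_eq ?_)
      rw [← eLpNorm_neg]
      congr 1; ext x; simp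
    · refine (eLpNorm_translate_sub_le_of_contDiff hΩ.isOpen hs (hφ n) hA).trans ?_
      gcongr
      have e2 : gradient (φ n) = G + fun x => gradient (φ n) x - G x := by ext1 x; simp
      nth_rewrite 1 [e2]
      exact eLpNorm_add_le hG.1 ((hgm n).sub hG.1) h1s
  have hlim := (hφu.add (ENNReal.Tendsto.const_mul (tendsto_const_nhds
    (x := eLpNorm G (ENNReal.ofReal s) (domainMeasure Ω)).add hφG)
      (Or.inr (enorm_ne_top (x := h))))).add hφu
  simp only [add_zero, zero_add] at hlim
  exact ge_of_tendsto' hlim key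

end Translation

/-! ### Rellich's compactness theorem -/

section Rellich

variable {Ω : Set (Space N)}

/-- Compactness of a uniformly bounded and uniformly Lipschitz sequence of functions on a totally
bounded set, in the form of a partition of the sequence into finitely many classes of uniformly
close functions. -/
theorem exists_finite_classes_of_lipschitz {X : Type*} [PseudoMetricSpace X] {S : Set X}
    (hS : TotallyBounded S) {h : ℕ → X → ℝ} {B L : ℝ} (hB : ∀ n x, |h n x| ≤ B)
    (hL : ∀ n x y, |h n x - h n y| ≤ L * dist x y) {η : ℝ} (hη : 0 < η) :
    ∃ (K : Type) (_ : Finite K) (c : ℕ → K), ∀ n k, c n = c k →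
      ∀ x ∈ S, |h n x - h k x| ≤ η := by
  have hL0 : 0 < max L 0 + 1 := by positivity
  obtain ⟨t, ht, hcov⟩ := Metric.totallyBounded_iff.mp hS (η / (4 * (max L 0 + 1))) (by positivity)
  have := ht.fintype
  set P : Set (t → ℝ) := Set.range fun n => fun j : t => h n j with hP
  have hPb : TotallyBounded P := by
    refine (isCompact_closedBall (0 : t → ℝ) (max B 0)).totallyBounded.subset ?_
    rintro _ ⟨n, rfl⟩
    rw [mem_closedBall_zero_iff, pi_norm_le_iff_of_nonneg (le_max_right _ _)]
    exact fun j => (hB n j).trans (le_max_left _ _)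
  obtain ⟨F, hF, hFcov⟩ := Metric.totallyBounded_iff.mp hPb (η / 4) (by positivity)
  have hex : ∀ n, ∃ y : F, dist (fun j : t => h n j) y < η / 4 := fun n => by
    have := hFcov ⟨n, rfl⟩
    simp only [Set.mem_iUnion, Metric.mem_ball] at this
    obtain ⟨y, hy, hd⟩ := this
    exact ⟨⟨y, hy⟩, hd⟩
  choose c hc using hex
  obtain ⟨m, ⟨e⟩⟩ := (finite_iff_exists_equiv_fin (α := F)).mp hF
  refine ⟨Fin m, inferInstance, fun n => e (c n), fun n k hnk x hx => ?_⟩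
  have hnk' : c n = c k := e.injective hnk
  have hx' := hcov hx
  simp only [Set.mem_iUnion, Metric.mem_ball] at hx'
  obtain ⟨z, hz, hxz⟩ := hx'
  have hlip : ∀ n, |h n x - h n z| ≤ η / 4 := fun n => by
    refine (hL n x z).trans ?_
    have h1 : L * dist x z ≤ (max L 0 + 1) * dist x z := by
      gcongr
      linarith [le_max_left L 0]
    refine h1.trans ?_
    rw [lt_div_iff₀ (by positivity)] at hxz
    nlinarith
  have hcl : ∀ n, |h n z - (c n : t → ℝ) ⟨z, hz⟩| ≤ η / 4 := fun n => by
    have := (dist_le_pi_dist (fun j : t => h n j) (c n : t → ℝ) ⟨z, hz⟩).trans (hc n).le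
    rwa [Real.dist_eq] at this
  have h1 := hlip n
  have h2 := hlip k
  have h3 := hcl n
  have h4 := hcl k
  rw [← hnk'] at h4
  rw [abs_le] at *
  constructor <;> linarith

theorem mollify_eq_integral (g f : Space N → ℝ) (x : Space N) :
    mollify g f x = ∫ y, g (x - y) * f y := by
  rw [mollify, ← integral_sub_left_eq_self _ volume x]
  simp

theorem abs_mollify_le {g : Space N → ℝ} {f : Space N → ℝ} (hf : Integrable f) {C : ℝ}
    (hC : ∀ x, |g x| ≤ C) (x : Space N) : |mollify g f x| ≤ C * ∫ y, ‖f y‖ := by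
  rw [mollify_eq_integral, ← integral_const_mul, ← Real.norm_eq_abs]
  refine norm_integral_le_of_norm_le (hf.norm.const_mul C) (ae_of_all _ fun y => ?_)
  rw [norm_mul]
  gcongr
  exact hC _

theorem abs_mollify_sub_le {g : Space N → ℝ} (hg : IsMollifier g) {f : Space N → ℝ}
    (hf : Integrable f) {L : NNReal} (hL : LipschitzWith L g) (x x' : Space N) :
    |mollify g f x - mollify g f x'| ≤ L * (∫ y, ‖f y‖) * dist x x' := by
  have hi : ∀ x, Integrable fun y => g (x - y) * f y := fun x => by
    have := (integrable_mollify hg hf.locallyIntegrable x).comp_sub_left x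
    simpa using this
  rw [mollify_eq_integral, mollify_eq_integral, ← integral_sub (hi x) (hi x'), ← Real.norm_eq_abs,
    mul_right_comm, ← integral_const_mul]
  refine norm_integral_le_of_norm_le (hf.norm.const_mul _) (ae_of_all _ fun y => ?_)
  rw [← sub_mul, norm_mul]
  gcongr
  have := hL.dist_le_mul (x - y) (x' - y)
  rwa [dist_sub_right, Real.dist_eq] at this

theorem eLpNorm_le_sum_local (hΩ : IsOpen Ω) {ι : Type} [Fintype ι] {U : ι → Set (Space N)}
    (hU : ∀ i, IsOpen (U i)) (hcov : closure Ω ⊆ ⋃ i, U i) {F : Type*} [NormedAddCommGroup F]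
    [NormedSpace ℝ F] {p : ℝ≥0∞} (hp : 1 ≤ p) {f : Space N → F}
    (hf : AEStronglyMeasurable f (domainMeasure Ω)) :
    eLpNorm f p (domainMeasure Ω) ≤ ∑ i, eLpNorm f p (volume.restrict (Ω ∩ U i)) := by
  obtain ⟨χ, hχ, hχ0, hχ0', hχ1, hχs⟩ := exists_partition isClosed_closure hU hcov
  have e : f =ᵐ[domainMeasure Ω] ∑ i, fun x => χ i x • f x := by
    filter_upwards [ae_restrict_mem hΩ.measurableSet] with x hx
    simp only [Finset.sum_apply]
    rw [← Finset.sum_smul, hχs x (subset_closure hx), one_smul]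
  rw [eLpNorm_congr_ae e]
  refine (eLpNorm_sum_le (fun i _ => (hχ i).continuous.aestronglyMeasurable.smul hf) hp).trans
    (Finset.sum_le_sum fun i _ => ?_)
  refine (eLpNorm_le_of_local hΩ (hU i) (h := f) (C := 1) (fun x _ => ?_)
    (fun x hx => by rw [Pi.smul_apply', hχ0 i x hx, zero_smul])).trans (by simp)
  rw [Pi.smul_apply', norm_smul]
  gcongr
  exact hχ1 i x

/-- In a chart, the mollification of a Sobolev function is close to it, at a rate controlled by the
gradient. -/
theorem eLpNorm_mollify_indicator_sub_le (hΩ : IsSmoothBoundedDomain Ω) {s : ℝ} (hs : 1 ≤ s)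
    {u : Space N → ℝ} {G : Space N → Space N} (hw : HasWeakGradient Ω u G)
    (hu : MemLp u (ENNReal.ofReal s) (domainMeasure Ω))
    (hG : MemLp G (ENNReal.ofReal s) (domainMeasure Ω)) {U : Set (Space N)} (hU : IsOpen U)
    {z₀ : Space N} {κ δ t : ℝ} (hcone : ConeCondition Ω U z₀ κ δ) (ht : 0 < t) (htδ : t < δ)
    {g : Space N → ℝ} (hg : IsMollifier g)
    (hsupp : ∀ y ∈ tsupport g, ∃ z ∈ Metric.ball z₀ κ, y = -(t • z)) :
    eLpNorm (fun x => mollify g (Ω.indicator u) x - u x) (ENNReal.ofReal s)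
      (volume.restrict (Ω ∩ U)) ≤
      ENNReal.ofReal (t * (‖z₀‖ + κ)) * eLpNorm G (ENNReal.ofReal s) (domainMeasure Ω) := by
  have hΩm := hΩ.isOpen.measurableSet
  have hmeas : MeasurableSet (Ω ∩ U) := hΩm.inter hU.measurableSet
  have hloc : LocallyIntegrable (Ω.indicator u) :=
    ((integrable_indicator_iff hΩm).mpr (MemLp.integrableOn_domain hΩ hs hu)).locallyIntegrable
  have h1 := eLpNorm_mollify_sub_le hg hs hloc (Ω ∩ U)
    (K := ENNReal.ofReal (t * (‖z₀‖ + κ)) * eLpNorm G (ENNReal.ofReal s) (domainMeasure Ω))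
    (fun y hy => by
      obtain ⟨z, hz, rfl⟩ := hsupp y (subset_tsupport g hy)
      have hin : ∀ x ∈ Ω ∩ U, ∀ τ ∈ Set.Ioc (0 : ℝ) 1, x + τ • (t • z) ∈ Ω := by
        intro x hx τ hτ
        rw [smul_smul]
        refine hcone.2.2 x hx _ (mul_pos hτ.1 ht) (lt_of_le_of_lt ?_ htδ) z hz
        exact mul_le_of_le_one_left ht.le hτ.2
      have h2 := eLpNorm_translate_sub_le hΩ hs hw hu hG Set.inter_subset_left hin
      refine le_trans (le_of_eq (eLpNorm_congr_ae ?_)) (h2.trans ?_)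
      · filter_upwards [ae_restrict_mem hmeas] with x hx
        have := hin x hx 1 (by simp)
        rw [one_smul] at this
        rw [sub_neg_eq_add, Set.indicator_of_mem this, Set.indicator_of_mem hx.1]
      · gcongr
        rw [← ofReal_norm]
        refine ENNReal.ofReal_le_ofReal ?_
        rw [norm_smul, Real.norm_of_nonneg ht.le]
        gcongr
        linarith [norm_sub_norm_le z z₀, mem_ball_iff_norm.mp hz])
  refine le_trans (le_of_eq (eLpNorm_congr_ae ?_)) h1
  filter_upwards [ae_restrict_mem hmeas] with x hx
  rw [Set.indicator_of_mem hx.1]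

/-- A bounded sequence of Sobolev functions splits into finitely many classes of `ε`-close functions:
in each chart the mollifications at a small fixed scale are close to the functions, uniformly in `n`,
and are uniformly bounded and uniformly Lipschitz. -/
theorem exists_finite_classes (hΩ : IsSmoothBoundedDomain Ω) {s : ℝ} (hs : 1 ≤ s)
    {u : ℕ → Space N → ℝ} {G : ℕ → Space N → Space N} (hw : ∀ n, HasWeakGradient Ω (u n) (G n))
    (hu : ∀ n, MemLp (u n) (ENNReal.ofReal s) (domainMeasure Ω))
    (hG : ∀ n, MemLp (G n) (ENNReal.ofReal s) (domainMeasure Ω)) {M : ℝ}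
    (huM : ∀ n, eLpNorm (u n) (ENNReal.ofReal s) (domainMeasure Ω) ≤ ENNReal.ofReal M)
    (hGM : ∀ n, eLpNorm (G n) (ENNReal.ofReal s) (domainMeasure Ω) ≤ ENNReal.ofReal M)
    {ε : ℝ} (hε : 0 < ε) :
    ∃ (K : Type) (_ : Finite K) (c : ℕ → K), ∀ n k, c n = c k →
      eLpNorm (fun x => u n x - u k x) (ENNReal.ofReal s) (domainMeasure Ω) ≤
        ENNReal.ofReal ε := by
  have hfin := hΩ.isFiniteMeasure
  have h1s := one_le_ofReal hs
  have hΩm := hΩ.isOpen.measurableSet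
  obtain ⟨T, U, z₀, κ, δ, hU, hcov, hcone⟩ := exists_finite_cone_cover hΩ
  have hui : ∀ n, Integrable (Ω.indicator (u n)) := fun n =>
    (integrable_indicator_iff hΩm).mpr (MemLp.integrableOn_domain hΩ hs (hu n))
  -- the bounds of the mollifications involve only the `L¹` norms of the functions
  obtain ⟨B, hB0, hB⟩ : ∃ B : ℝ, 0 ≤ B ∧ ∀ n, ∫ y, ‖Ω.indicator (u n) y‖ ≤ B := by
    set b := ENNReal.ofReal M * (domainMeasure Ω) Set.univ ^ (1 / (1 : ℝ≥0∞).toReal -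
      1 / (ENNReal.ofReal s).toReal) with hb
    have hbtop : b ≠ ⊤ := by
      refine ENNReal.mul_ne_top ENNReal.ofReal_ne_top (ENNReal.rpow_ne_top_of_nonneg ?_ ?_)
      · rw [ENNReal.toReal_one, ENNReal.toReal_ofReal (by linarith), sub_nonneg, one_div_one]
        rw [div_le_one (by linarith)]
        exact hs
      · exact measure_ne_top _ _
    refine ⟨b.toReal, ENNReal.toReal_nonneg, fun n => ?_⟩
    have h1 : ∀ y, ‖Ω.indicator (u n) y‖ = Ω.indicator (fun y => ‖u n y‖) y := fun y =>
      norm_indicator_eq_indicator_norm _ _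
    simp only [h1]
    rw [integral_indicator hΩm]
    change ∫ y, ‖u n y‖ ∂(domainMeasure Ω) ≤ _
    rw [integral_norm_eq_lintegral_enorm (hu n).1]
    refine ENNReal.toReal_mono hbtop ?_
    rw [← eLpNorm_one_eq_lintegral_enorm]
    refine (eLpNorm_le_eLpNorm_mul_rpow_measure_univ h1s (hu n).1).trans ?_
    rw [hb]
    gcongr
    exact huM n
  -- `ε'` is the share of one chart, and `V` turns uniform bounds into `L^s` bounds
  set ε' := ε / ((Fintype.card T : ℝ) + 1) with hε'
  have hε'0 : 0 < ε' := by positivity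
  set V := ((domainMeasure Ω) Set.univ ^ (1 / s)).toReal with hV
  have hV0 : 0 ≤ V := ENNReal.toReal_nonneg
  have hVtop : (domainMeasure Ω) Set.univ ^ (1 / s) ≠ ⊤ :=
    ENNReal.rpow_ne_top_of_nonneg (by positivity) (measure_ne_top _ _)
  have hlocal : ∀ i : T, ∃ (K : Type) (_ : Finite K) (c : ℕ → K), ∀ n k, c n = c k →
      eLpNorm (fun x => u n x - u k x) (ENNReal.ofReal s) (volume.restrict (Ω ∩ U i)) ≤
        ENNReal.ofReal ε' := by
    intro i
    obtain ⟨hκ, hδ, -⟩ := hcone i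
    obtain ⟨t, ht, htδ, htε⟩ : ∃ t, 0 < t ∧ t < δ i ∧
        t * (‖z₀ i‖ + κ i) * max M 0 < ε' / 4 := by
      have hc : Tendsto (fun t : ℝ => t * (‖z₀ i‖ + κ i) * max M 0) (𝓝[>] 0) (𝓝 0) := by
        have : Tendsto (fun t : ℝ => t * (‖z₀ i‖ + κ i) * max M 0) (𝓝 0)
            (𝓝 (0 * (‖z₀ i‖ + κ i) * max M 0)) :=
          ((continuous_id.mul continuous_const).mul continuous_const).tendsto 0
        rw [zero_mul, zero_mul] at this
        exact this.mono_left nhdsWithin_le_nhds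
      obtain ⟨t, h⟩ := ((eventually_mem_nhdsWithin (a := (0 : ℝ)) (s := Set.Ioi 0)).and
        (((tendsto_id.mono_left nhdsWithin_le_nhds).eventually_lt_const hδ).and
        (hc.eventually_lt_const (show 0 < ε' / 4 by positivity)))).exists
      exact ⟨t, h.1, h.2.1, h.2.2⟩
    obtain ⟨g, hg, hsupp⟩ := exists_isMollifier (z₀ i) hκ ht
    obtain ⟨Cg, hCg⟩ := hg.hasCompactSupport.exists_bound_of_continuous hg.contDiff.continuous
    obtain ⟨L, hL⟩ := hg.contDiff.lipschitzWith_of_hasCompactSupport hg.hasCompactSupport (by simp)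
    have hCg0 : 0 ≤ Cg := (norm_nonneg _).trans (hCg 0)
    obtain ⟨K, hK, c, hc⟩ := exists_finite_classes_of_lipschitz (S := Ω)
      (hΩ.isBounded.isCompact_closure.totallyBounded.subset subset_closure)
      (h := fun n => mollify g (Ω.indicator (u n)))
      (B := Cg * B) (L := L * B)
      (fun n x => (abs_mollify_le (hui n) hCg x).trans (by gcongr; exact hB n))
      (fun n x y => (abs_mollify_sub_le hg (hui n) hL x y).trans (by gcongr; exact hB n))
      (η := ε' / (2 * (V + 1))) (by positivity)
    refine ⟨K, hK, c, fun n k hnk => ?_⟩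
    have hle : volume.restrict (Ω ∩ U i) ≤ domainMeasure Ω :=
      Measure.restrict_mono Set.inter_subset_left le_rfl
    have hm : ∀ n, AEStronglyMeasurable (mollify g (Ω.indicator (u n)))
        (volume.restrict (Ω ∩ U i)) := fun n =>
      (contDiff_mollify hg (hui n).locallyIntegrable).continuous.aestronglyMeasurable
    have hum : ∀ n, AEStronglyMeasurable (u n) (volume.restrict (Ω ∩ U i)) := fun n =>
      (hu n).1.mono_measure hle
    have hclose : ∀ n, eLpNorm (fun x => mollify g (Ω.indicator (u n)) x - u n x)
        (ENNReal.ofReal s) (volume.restrict (Ω ∩ U i)) ≤ ENNReal.ofReal (ε' / 4) := fun n => by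
      refine (eLpNorm_mollify_indicator_sub_le hΩ hs (hw n) (hu n) (hG n) (hU i) (hcone i) ht htδ
        hg hsupp).trans ?_
      calc _ ≤ ENNReal.ofReal (t * (‖z₀ i‖ + κ i)) * ENNReal.ofReal (max M 0) := by
            gcongr
            exact (hGM n).trans (ENNReal.ofReal_le_ofReal (le_max_left _ _))
        _ = ENNReal.ofReal (t * (‖z₀ i‖ + κ i) * max M 0) := by
            rw [← ENNReal.ofReal_mul (by positivity)]
        _ ≤ _ := ENNReal.ofReal_le_ofReal htε.le
    have hmid : eLpNorm (fun x => mollify g (Ω.indicator (u n)) x -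
        mollify g (Ω.indicator (u k)) x) (ENNReal.ofReal s) (volume.restrict (Ω ∩ U i)) ≤
        ENNReal.ofReal (ε' / 2) := by
      refine (eLpNorm_mono_measure _ hle).trans ?_
      have h1 : ∀ᵐ x ∂(domainMeasure Ω), ‖mollify g (Ω.indicator (u n)) x -
          mollify g (Ω.indicator (u k)) x‖ ≤ ε' / (2 * (V + 1)) := by
        filter_upwards [ae_restrict_mem hΩm] with x hx
        exact hc n k hnk x hx
      refine (eLpNorm_le_of_ae_bound h1).trans ?_
      rw [ENNReal.toReal_ofReal (by linarith), ← one_div, ← ENNReal.ofReal_toReal hVtop, ← hV,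
        ← ENNReal.ofReal_mul hV0]
      refine ENNReal.ofReal_le_ofReal ?_
      rw [mul_div_assoc', div_le_div_iff₀ (by positivity) (by positivity)]
      nlinarith
    have e : (fun x => u n x - u k x) = (fun x => mollify g (Ω.indicator (u n)) x -
        mollify g (Ω.indicator (u k)) x) - (fun x => mollify g (Ω.indicator (u n)) x - u n x) +
        fun x => mollify g (Ω.indicator (u k)) x - u k x := by
      ext x; simp
    rw [e]
    refine (eLpNorm_add_le (((hm n).sub (hm k)).sub ((hm n).sub (hum n))) ((hm k).sub (hum k))
      h1s).trans ((add_le_add_left (eLpNorm_sub_le ((hm n).sub (hm k)) ((hm n).sub (hum n)) h1s)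
        _).trans ?_)
    refine (add_le_add (add_le_add hmid (hclose n)) (hclose k)).trans (le_of_eq ?_)
    rw [← ENNReal.ofReal_add (by positivity) (by positivity),
      ← ENNReal.ofReal_add (by positivity) (by positivity)]
    congr 1; ring
  choose K hK c hc using hlocal
  refine ⟨∀ i, K i, inferInstance, fun n i => c i n, fun n k hnk => ?_⟩
  refine (eLpNorm_le_sum_local hΩ.isOpen hU hcov h1s ((hu n).1.sub (hu k).1)).trans ?_
  refine (Finset.sum_le_sum fun i _ => hc i n k (congrFun hnk i)).trans ?_
  rw [Finset.sum_const, nsmul_eq_mul, Finset.card_univ, ← ENNReal.ofReal_natCast,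
    ← ENNReal.ofReal_mul (by positivity)]
  refine ENNReal.ofReal_le_ofReal ?_
  rw [hε', mul_div_assoc', div_le_iff₀ (by positivity)]
  nlinarith

/-- The Rellich–Kondrachov theorem: the embedding of `W^{1,s}(Ω)` in `L^s(Ω)` is compact. -/
theorem rellich (hΩ : IsSmoothBoundedDomain Ω) {s : ℝ} (hs : 1 ≤ s)
    {u : ℕ → Space N → ℝ} {G : ℕ → Space N → Space N} (hw : ∀ n, HasWeakGradient Ω (u n) (G n))
    (hu : ∀ n, MemLp (u n) (ENNReal.ofReal s) (domainMeasure Ω))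
    (hG : ∀ n, MemLp (G n) (ENNReal.ofReal s) (domainMeasure Ω)) {M : ℝ}
    (huM : ∀ n, eLpNorm (u n) (ENNReal.ofReal s) (domainMeasure Ω) ≤ ENNReal.ofReal M)
    (hGM : ∀ n, eLpNorm (G n) (ENNReal.ofReal s) (domainMeasure Ω) ≤ ENNReal.ofReal M) :
    ∃ (φ : ℕ → ℕ) (v : Space N → ℝ), StrictMono φ ∧
      MemLp v (ENNReal.ofReal s) (domainMeasure Ω) ∧
      Tendsto (fun n => eLpNorm (fun x => u (φ n) x - v x) (ENNReal.ofReal s) (domainMeasure Ω))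
        atTop (𝓝 0) := by
  have hfact : Fact (1 ≤ ENNReal.ofReal s) := ⟨one_le_ofReal hs⟩
  set f : ℕ → Lp ℝ (ENNReal.ofReal s) (domainMeasure Ω) := fun n => (hu n).toLp with hf
  have htb : TotallyBounded (Set.range f) := by
    refine Metric.totallyBounded_iff.mpr fun ε hε => ?_
    obtain ⟨K, hK, c, hc⟩ := exists_finite_classes hΩ hs hw hu hG huM hGM (half_pos hε)
    have : Nonempty ℕ := ⟨0⟩
    refine ⟨Set.range fun k : Set.range c => f k.2.choose, Set.finite_range _, ?_⟩
    rintro _ ⟨n, rfl⟩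
    have hex : ∃ m, c m = c n := ⟨n, rfl⟩
    refine Set.mem_iUnion₂.mpr ⟨_, ⟨⟨c n, n, rfl⟩, rfl⟩, ?_⟩
    have h1 := hc n hex.choose hex.choose_spec.symm
    rw [Metric.mem_ball]
    refine lt_of_le_of_lt ?_ (half_lt_self hε)
    rw [← ENNReal.ofReal_le_ofReal_iff (half_pos hε).le, ← edist_dist]
    refine le_trans (le_of_eq ?_) h1
    exact Lp.edist_toLp_toLp _ _ (hu n) (hu hex.choose)
  have hcomp : IsCompact (closure (Set.range f)) :=
    htb.closure.isCompact_of_isClosed isClosed_closure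
  obtain ⟨v, -, φ, hφ, hv⟩ := hcomp.tendsto_subseq (x := f) fun n => subset_closure ⟨n, rfl⟩
  refine ⟨φ, v, hφ, Lp.memLp v, ?_⟩
  rw [Lp.tendsto_Lp_iff_tendsto_eLpNorm'] at hv
  refine hv.congr fun n => eLpNorm_congr_ae ?_
  filter_upwards [(hu (φ n)).coeFn_toLp] with x hx
  simp only [Function.comp_apply, Pi.sub_apply, hf, hx]

end Rellich

/-! ### Limits in Lebesgue spaces of a finite measure -/

section Limits

variable {α : Type*} [MeasurableSpace α] {μ : Measure α} [IsFiniteMeasure μ]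

theorem tendsto_eLpNorm_of_exponent_le {F : Type*} [NormedAddCommGroup F] {p r : ℝ≥0∞}
    (hp : 1 ≤ p) (hpr : p ≤ r) {f : ℕ → α → F} (hf : ∀ n, AEStronglyMeasurable (f n) μ)
    (h : Tendsto (fun n => eLpNorm (f n) r μ) atTop (𝓝 0)) :
    Tendsto (fun n => eLpNorm (f n) p μ) atTop (𝓝 0) := by
  have hC : μ Set.univ ^ (1 / p.toReal - 1 / r.toReal) ≠ ⊤ := by
    rcases eq_or_ne r ⊤ with rfl | hr
    · refine ENNReal.rpow_ne_top_of_nonneg ?_ (measure_ne_top _ _)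
      simp
    · refine ENNReal.rpow_ne_top_of_nonneg ?_ (measure_ne_top _ _)
      rw [sub_nonneg]
      have hp0 : 0 < p.toReal :=
        ENNReal.toReal_pos (one_pos.trans_le hp).ne' (ne_top_of_le_ne_top hr hpr)
      exact one_div_le_one_div_of_le hp0 (ENNReal.toReal_mono hr hpr)
  have h2 := ENNReal.Tendsto.mul_const h (b := μ Set.univ ^ (1 / p.toReal - 1 / r.toReal))
    (Or.inr hC)
  rw [zero_mul] at h2
  exact tendsto_of_tendsto_of_tendsto_of_le_of_le tendsto_const_nhds h2 (fun _ => zero_le)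
    fun n => eLpNorm_le_eLpNorm_mul_rpow_measure_univ hpr (hf n)

theorem tendsto_integral_smul {F : Type*} [NormedAddCommGroup F] [NormedSpace ℝ F] {p : ℝ≥0∞}
    (hp : 1 ≤ p) {f : ℕ → α → F} {g : α → F} (hf : ∀ n, MemLp (f n) p μ) (hg : MemLp g p μ)
    (h : Tendsto (fun n => eLpNorm (fun x => f n x - g x) p μ) atTop (𝓝 0)) {ψ : α → ℝ}
    (hψ : AEStronglyMeasurable ψ μ) {C : ℝ} (hC : ∀ x, ‖ψ x‖ ≤ C) :
    Tendsto (fun n => ∫ x, ψ x • f n x ∂μ) atTop (𝓝 (∫ x, ψ x • g x ∂μ)) := by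
  have hi : ∀ {k : α → F}, MemLp k p μ → Integrable (fun x => ψ x • k x) μ := fun hk =>
    (hk.integrable hp).bdd_smul C hψ (ae_of_all _ hC)
  refine tendsto_integral_of_L1' _ (hi hg).1 (Eventually.of_forall fun n => hi (hf n)) ?_
  have h1 := tendsto_eLpNorm_of_exponent_le le_rfl hp (fun n => (hf n).1.sub hg.1) h
  have h2 := ENNReal.Tendsto.const_mul h1 (a := ENNReal.ofReal C) (Or.inr ENNReal.ofReal_ne_top)
  rw [mul_zero] at h2
  refine tendsto_of_tendsto_of_tendsto_of_le_of_le tendsto_const_nhds h2 (fun _ => zero_le)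
    fun n => ?_
  refine eLpNorm_le_mul_eLpNorm_of_ae_le_mul (ae_of_all _ fun x => ?_) 1
  simp only [Pi.sub_apply]
  rw [← smul_sub, norm_smul]
  gcongr
  exact hC x

end Limits

/-! ### Poincaré's inequality -/

section Poincare

variable {Ω : Set (Space N)}

/-- The weak gradient is a closed operator. -/
theorem HasWeakGradient.of_tendsto (hΩ : IsSmoothBoundedDomain Ω) {s s' : ℝ} (hs : 1 ≤ s)
    (hs' : 1 ≤ s') {u : ℕ → Space N → ℝ} {g : ℕ → Space N → Space N} {v : Space N → ℝ}
    {G : Space N → Space N} (h : ∀ n, HasWeakGradient Ω (u n) (g n))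
    (hu : ∀ n, MemLp (u n) (ENNReal.ofReal s) (domainMeasure Ω))
    (hg : ∀ n, MemLp (g n) (ENNReal.ofReal s') (domainMeasure Ω))
    (hv : MemLp v (ENNReal.ofReal s) (domainMeasure Ω))
    (hG : MemLp G (ENNReal.ofReal s') (domainMeasure Ω))
    (huv : Tendsto (fun n => eLpNorm (fun x => u n x - v x) (ENNReal.ofReal s) (domainMeasure Ω))
      atTop (𝓝 0))
    (hgG : Tendsto (fun n => eLpNorm (fun x => g n x - G x) (ENNReal.ofReal s') (domainMeasure Ω))
      atTop (𝓝 0)) : HasWeakGradient Ω v G := by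
  have := hΩ.isFiniteMeasure
  refine ⟨(MemLp.integrableOn_domain hΩ hs hv).locallyIntegrableOn,
    (MemLp.integrableOn_domain hΩ hs' hG).locallyIntegrableOn, fun φ hφ hc hsub w => ?_⟩
  have cφ' : Continuous fun x => fderiv ℝ φ x w :=
    (hφ.continuous_fderiv (by simp)).clm_apply continuous_const
  obtain ⟨C₁, hC₁⟩ := (hc.fderiv_apply ℝ w).exists_bound_of_continuous cφ'
  obtain ⟨C₂, hC₂⟩ := hc.exists_bound_of_continuous hφ.continuous
  have h1 := tendsto_integral_smul (one_le_ofReal hs) hu hv huv cφ'.aestronglyMeasurable hC₁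
  have h2 := tendsto_integral_smul (one_le_ofReal hs') hg hG hgG hφ.continuous.aestronglyMeasurable
    hC₂
  have h3 := (Filter.Tendsto.inner (𝕜 := ℝ) h2 (tendsto_const_nhds (x := w))).neg
  have e : ∀ {k : Space N → Space N}, MemLp k (ENNReal.ofReal s') (domainMeasure Ω) →
      inner ℝ (∫ x, φ x • k x ∂(domainMeasure Ω)) w =
      ∫ x, inner ℝ (k x) w * φ x ∂(domainMeasure Ω) := fun {k} hk => by
    have hi : Integrable (fun x => φ x • k x) (domainMeasure Ω) :=
      (hk.integrable (one_le_ofReal hs')).bdd_smul C₂ hφ.continuous.aestronglyMeasurable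
        (ae_of_all _ hC₂)
    rw [real_inner_comm, ← integral_inner hi]
    congr 1; ext x
    rw [inner_smul_right, real_inner_comm]; ring
  have e1 : ∀ n, ∫ x, fderiv ℝ φ x w • u n x ∂(domainMeasure Ω) =
      -inner ℝ (∫ x, φ x • g n x ∂(domainMeasure Ω)) w := fun n => by
    rw [e (hg n)]
    have := (h n).2.2 φ hφ hc hsub w
    simp only [smul_eq_mul, mul_comm] at this ⊢
    exact this
  simp only [e1] at h1
  have h4 := tendsto_nhds_unique h1 h3
  rw [e hG] at h4
  simp only [smul_eq_mul, mul_comm] at h4 ⊢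
  exact h4

/-- Near each point of the domain, a Sobolev function with vanishing gradient agrees with its
mollification, which has vanishing gradient as well. -/
theorem exists_ae_eq_const_ball (hΩ : IsSmoothBoundedDomain Ω) {s : ℝ} (hs : 1 ≤ s)
    {u : Space N → ℝ} {G : Space N → Space N} (hw : HasWeakGradient Ω u G)
    (hu : MemLp u (ENNReal.ofReal s) (domainMeasure Ω)) (hG : G =ᵐ[domainMeasure Ω] 0)
    {x : Space N} (hx : x ∈ Ω) :
    ∃ ρ > 0, ∃ c : ℝ, ∀ᵐ y, y ∈ Metric.ball x ρ → u y = c := by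
  have hΩm := hΩ.isOpen.measurableSet
  obtain ⟨ρ₁, hρ₁, z₀, κ, δ, hcone⟩ := exists_coneCondition hΩ (subset_closure hx)
  obtain ⟨ρ₂, hρ₂, hsub⟩ := Metric.isOpen_iff.mp hΩ.isOpen x hx
  set ρ := min ρ₁ ρ₂
  have hρ : 0 < ρ := lt_min hρ₁ hρ₂
  obtain ⟨hκ, hδ, hc⟩ := hcone
  set t := δ / 2
  have ht : 0 < t := half_pos hδ
  have htδ : t < δ := half_lt_self hδ
  obtain ⟨g, hg, hsupp⟩ := exists_isMollifier z₀ hκ ht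
  have hGm : MemLp G (ENNReal.ofReal s) (domainMeasure Ω) :=
    (memLp_congr_ae hG).mpr MemLp.zero
  have h1 := eLpNorm_mollify_indicator_sub_le hΩ hs hw hu hGm Metric.isOpen_ball
    ⟨hκ, hδ, hc⟩ ht htδ hg hsupp
  have hloc : LocallyIntegrable (Ω.indicator u) :=
    ((integrable_indicator_iff hΩm).mpr (MemLp.integrableOn_domain hΩ hs hu)).locallyIntegrable
  have hψ := contDiff_mollify hg hloc
  have hmono : volume.restrict (Ω ∩ Metric.ball x ρ₁) ≤ domainMeasure Ω :=
    Measure.restrict_mono Set.inter_subset_left le_rfl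
  have hm : AEStronglyMeasurable (fun y => mollify g (Ω.indicator u) y - u y)
      (volume.restrict (Ω ∩ Metric.ball x ρ₁)) :=
    hψ.continuous.aestronglyMeasurable.sub (hu.1.mono_measure hmono)
  rw [eLpNorm_congr_ae hG, eLpNorm_zero, mul_zero, nonpos_iff_eq_zero,
    eLpNorm_eq_zero_iff hm (one_pos.trans_le (one_le_ofReal hs)).ne'] at h1
  have hb1 : ∀ y ∈ Metric.ball x ρ, y ∈ Ω ∩ Metric.ball x ρ₁ := fun y hy =>
    ⟨hsub (Metric.ball_subset_ball (min_le_right _ _) hy),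
      Metric.ball_subset_ball (min_le_left _ _) hy⟩
  have hG0 : Ω.indicator G =ᵐ[volume] fun _ => 0 := by
    rw [Filter.EventuallyEq, domainMeasure, ae_restrict_iff' hΩm] at hG
    filter_upwards [hG] with y hy
    by_cases h : y ∈ Ω
    · rw [Set.indicator_of_mem h, hy h, Pi.zero_apply]
    · rw [Set.indicator_of_notMem h]
  have hfd : ∀ y ∈ Metric.ball x ρ, fderiv ℝ (mollify g (Ω.indicator u)) y = 0 := by
    intro y hy
    rw [← norm_eq_zero, ← norm_gradient, gradient_mollify hΩ.isOpen hw
      (MemLp.integrableOn_domain hΩ hs hu) (MemLp.integrableOn_domain hΩ hs hGm) hg,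
      mollify_congr g hG0]
    · simp [mollify]
    · intro y' hy'
      obtain ⟨z, hz, rfl⟩ := hsupp y' hy'
      rw [sub_neg_eq_add]
      exact hc y (hb1 y hy) t ht htδ z hz
  obtain ⟨c, hcc⟩ := Metric.isOpen_ball.exists_is_const_of_fderiv_eq_zero
    (convex_ball x ρ).isPreconnected (hψ.differentiable (by simp)).differentiableOn hfd
  refine ⟨ρ, hρ, c, ?_⟩
  rw [Filter.EventuallyEq, ae_restrict_iff' (hΩm.inter Metric.isOpen_ball.measurableSet)] at h1
  filter_upwards [h1] with y hy hyb
  have := hy (hb1 y hyb)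
  rw [Pi.zero_apply, sub_eq_zero] at this
  rw [← this, hcc y hyb]

/-- A Sobolev function with vanishing gradient on a connected open set is constant. -/
theorem exists_ae_eq_const (hΩ : IsSmoothBoundedDomain Ω) {s : ℝ} (hs : 1 ≤ s)
    {u : Space N → ℝ} {G : Space N → Space N} (hw : HasWeakGradient Ω u G)
    (hu : MemLp u (ENNReal.ofReal s) (domainMeasure Ω)) (hG : G =ᵐ[domainMeasure Ω] 0) :
    ∃ c : ℝ, u =ᵐ[domainMeasure Ω] fun _ => c := by
  have hΩm := hΩ.isOpen.measurableSet
  have hloc := fun x hx => exists_ae_eq_const_ball hΩ hs hw hu hG (x := x) hx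
  obtain ⟨x₀, hx₀⟩ := hΩ.isConnected.nonempty
  obtain ⟨ρ₀, hρ₀, c₀, h₀⟩ := hloc x₀ hx₀
  let P : ℝ → Space N → Prop := fun c x => ∃ ρ > 0, ∀ᵐ y, y ∈ Metric.ball x ρ → u y = c
  have hopen : ∀ c x, P c x → ∃ ρ > 0, ∀ y ∈ Metric.ball x ρ, P c y := by
    rintro c x ⟨ρ, hρ, h⟩
    refine ⟨ρ, hρ, fun y hy => ?_⟩
    obtain ⟨ρ', hρ', hsub⟩ := Metric.isOpen_iff.mp Metric.isOpen_ball y hy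
    exact ⟨ρ', hρ', h.mono fun z hz hzb => hz (hsub hzb)⟩
  have huniq : ∀ c c' x, P c x → P c' x → c = c' := by
    rintro c c' x ⟨ρ, hρ, h⟩ ⟨ρ', hρ', h'⟩
    by_contra hne
    have hz : volume (Metric.ball x (min ρ ρ')) = 0 := by
      rw [← nonpos_iff_eq_zero, ← (measure_eq_zero_iff_ae_notMem.mpr
        (show ∀ᵐ y, y ∉ Metric.ball x (min ρ ρ') from ?_))]
      filter_upwards [h, h'] with y hy hy' hyb
      exact hne ((hy (Metric.ball_subset_ball (min_le_left _ _) hyb)).symm.trans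
        (hy' (Metric.ball_subset_ball (min_le_right _ _) hyb)))
    exact (Metric.measure_ball_pos volume x (lt_min hρ hρ')).ne' hz
  -- the set where `u` is locally equal to `c₀` and the set where it is locally equal to another
  -- constant are open and disjoint and cover the connected set `Ω`
  have hall : ∀ x ∈ Ω, P c₀ x := by
    by_contra! hcon
    obtain ⟨x₁, hx₁, hx₁'⟩ := hcon
    have hA : IsOpen {x | P c₀ x} := Metric.isOpen_iff.mpr fun x hx => hopen c₀ x hx
    have hB : IsOpen {x | ∃ c, c ≠ c₀ ∧ P c x} := Metric.isOpen_iff.mpr fun x ⟨c, hc, hx⟩ => by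
      obtain ⟨ρ, hρ, h⟩ := hopen c x hx
      exact ⟨ρ, hρ, fun y hy => ⟨c, hc, h y hy⟩⟩
    obtain ⟨y, -, hy, c, hc, hy'⟩ := hΩ.isConnected.isPreconnected _ _ hA hB (fun x hx => by
        obtain ⟨ρ, hρ, c, h⟩ := hloc x hx
        by_cases hc : c = c₀
        · exact Or.inl (hc ▸ ⟨ρ, hρ, h⟩)
        · exact Or.inr ⟨c, hc, ρ, hρ, h⟩)
      ⟨x₀, hx₀, ρ₀, hρ₀, h₀⟩ ⟨x₁, hx₁, by
        obtain ⟨ρ, hρ, c, h⟩ := hloc x₁ hx₁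
        refine ⟨c, ?_, ρ, hρ, h⟩
        rintro rfl
        exact hx₁' ⟨ρ, hρ, h⟩⟩
    exact hc (huniq _ _ _ hy' hy)
  refine ⟨c₀, ?_⟩
  rw [Filter.EventuallyEq, domainMeasure, ae_restrict_iff' hΩm]
  refine measure_null_of_locally_null _ fun x hx => ?_
  have hxΩ : x ∈ Ω := by
    by_contra h
    exact hx fun h' => absurd h' h
  obtain ⟨ρ, hρ, h⟩ := hall x hxΩ
  refine ⟨Metric.ball x ρ ∩ {y | ¬ (y ∈ Metric.ball x ρ → u y = c₀)} ∪
    {y | (y ∈ Ω → u y = c₀)}ᶜ ∩ Metric.ball x ρ, ?_, ?_⟩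
  · refine mem_of_superset (inter_mem_nhdsWithin _ (Metric.ball_mem_nhds x hρ)) ?_
    exact fun y hy => Or.inr hy
  · refine measure_mono_null (fun y hy => ?_) h
    rcases hy with hy | hy
    · exact hy.2
    · intro h'
      exact hy.1 fun _ => h' hy.2

theorem hasWeakGradient_const (c : ℝ) : HasWeakGradient Ω (fun _ => c) 0 := by
  have h := hasWeakGradient_of_contDiff (Ω := Ω) (φ := fun _ : Space N => c) contDiff_const
  have e : gradient (fun _ : Space N => c) = 0 := by
    ext1 x; simp [gradient]
  rwa [e] at h

/-- **Poincaré's inequality.** A sequence violating it, normalised and made orthogonal to the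
constants in the sense of Birkhoff, would converge to a constant of norm one orthogonal to the
constants. -/
theorem poincare (hΩ : IsSmoothBoundedDomain Ω) {s : ℝ} (hs : 1 ≤ s) :
    ∃ C : ℝ, 0 ≤ C ∧ ∀ (u : Space N → ℝ) (G : Space N → Space N), HasWeakGradient Ω u G →
      MemLp u (ENNReal.ofReal s) (domainMeasure Ω) →
      MemLp G (ENNReal.ofReal s) (domainMeasure Ω) →
      ∃ c : ℝ, eLpNorm (fun x => u x - c) (ENNReal.ofReal s) (domainMeasure Ω) ≤
        ENNReal.ofReal C * eLpNorm G (ENNReal.ofReal s) (domainMeasure Ω) := by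
  have hfin := hΩ.isFiniteMeasure
  have hs1 := one_le_ofReal hs
  have : Fact (1 ≤ ENNReal.ofReal s) := ⟨hs1⟩
  have hone : ∀ c : ℝ, MemLp (fun _ : Space N => c) (ENNReal.ofReal s) (domainMeasure Ω) :=
    fun c => memLp_const c
  set b : Lp ℝ (ENNReal.ofReal s) (domainMeasure Ω) := (hone 1).toLp _ with hb
  have hpos : domainMeasure Ω ≠ 0 := by
    rw [domainMeasure, Ne, Measure.restrict_eq_zero]
    exact (hΩ.isOpen.measure_pos volume hΩ.isConnected.nonempty).ne'
  have hb0 : b ≠ 0 := by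
    rw [hb, Ne, ← norm_eq_zero, Lp.norm_toLp, ENNReal.toReal_eq_zero_iff, not_or]
    refine ⟨?_, (hone 1).2.ne⟩
    rw [eLpNorm_const _ (one_pos.trans_le hs1).ne' hpos]
    simp only [enorm_one, one_mul]
    rw [ENNReal.rpow_eq_zero_iff]
    simp [hpos, measure_ne_top]
  by_contra! hcon
  choose u G hw hu hG hlt using fun n : ℕ => hcon (n + 1) (by positivity)
  choose c hc using fun n => exists_birkhoffOrth_add b ((hu n).toLp _) hb0
  set t : ℕ → ℝ := fun n => ‖(hu n).toLp _ + c n • b‖ with ht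
  have hv : ∀ n, MemLp (u n + fun _ => c n) (ENNReal.ofReal s) (domainMeasure Ω) :=
    fun n => (hu n).add (hone _)
  have hvb : ∀ n, (hv n).toLp _ = (hu n).toLp _ + c n • b := fun n => by
    rw [hb, ← MemLp.toLp_const_smul, ← MemLp.toLp_add]
    congr 2
    ext x; simp
  have htn : ∀ n, eLpNorm (u n + fun _ => c n) (ENNReal.ofReal s) (domainMeasure Ω) =
      ENNReal.ofReal (t n) := fun n => by
    rw [ht]; dsimp only
    rw [← hvb, Lp.norm_toLp, ENNReal.ofReal_toReal (hv n).2.ne]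
  have hlt' : ∀ n : ℕ, ENNReal.ofReal (n + 1) * eLpNorm (G n) (ENNReal.ofReal s) (domainMeasure Ω) <
      ENNReal.ofReal (t n) := fun n => by
    have := hlt n (-(c n))
    simp only [sub_neg_eq_add] at this
    rw [← htn]; exact this
  have htpos : ∀ n, 0 < t n := fun n => ENNReal.ofReal_pos.mp (zero_le.trans_lt (hlt' n))
  set w : ℕ → Space N → ℝ := fun n => (t n)⁻¹ • (u n + fun _ => c n) with hwd
  have hww : ∀ n, HasWeakGradient Ω (w n) ((t n)⁻¹ • (G n + 0)) := fun n =>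
    ((hw n).add (hasWeakGradient_const (c n))).const_smul _
  simp only [add_zero] at hww
  have hwm : ∀ n, MemLp (w n) (ENNReal.ofReal s) (domainMeasure Ω) := fun n => (hv n).const_smul _
  have hGm : ∀ n, MemLp ((t n)⁻¹ • G n) (ENNReal.ofReal s) (domainMeasure Ω) :=
    fun n => (hG n).const_smul _
  have hen : ∀ n, ‖(t n)⁻¹‖ₑ = (ENNReal.ofReal (t n))⁻¹ := fun n => by
    rw [← ofReal_norm, Real.norm_of_nonneg (inv_pos.mpr (htpos n)).le,
      ENNReal.ofReal_inv_of_pos (htpos n)]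
  have hw1 : ∀ n, eLpNorm (w n) (ENNReal.ofReal s) (domainMeasure Ω) = 1 := fun n => by
    rw [hwd]; dsimp only
    rw [eLpNorm_const_smul, htn, hen]
    exact ENNReal.inv_mul_cancel (ENNReal.ofReal_pos.mpr (htpos n)).ne' ENNReal.ofReal_ne_top
  have hG1 : ∀ n : ℕ, eLpNorm ((t n)⁻¹ • G n) (ENNReal.ofReal s) (domainMeasure Ω) ≤
      ENNReal.ofReal ((n : ℝ) + 1)⁻¹ := fun n => by
    have hn : (0 : ℝ) < (n : ℝ) + 1 := by positivity
    rw [eLpNorm_const_smul, hen, ENNReal.ofReal_inv_of_pos hn,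
      ENNReal.inv_mul_le_iff (ENNReal.ofReal_pos.mpr (htpos n)).ne' ENNReal.ofReal_ne_top,
      ← div_eq_mul_inv, ENNReal.le_div_iff_mul_le (Or.inl (ENNReal.ofReal_pos.mpr hn).ne')
        (Or.inl ENNReal.ofReal_ne_top), mul_comm]
    exact (hlt' n).le
  have hGlim : Tendsto (fun n => eLpNorm ((t n)⁻¹ • G n) (ENNReal.ofReal s) (domainMeasure Ω))
      atTop (𝓝 0) := by
    refine tendsto_of_tendsto_of_tendsto_of_le_of_le tendsto_const_nhds ?_ (fun _ => zero_le) hG1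
    have h1 : Tendsto (fun n : ℕ => ((n : ℝ) + 1)⁻¹) atTop (𝓝 0) := by
      simpa only [one_div] using tendsto_one_div_add_atTop_nhds_zero_nat (𝕜 := ℝ)
    simpa using ENNReal.tendsto_ofReal h1
  obtain ⟨φ, v, hφ, hvm, hlim⟩ := rellich hΩ hs hww hwm hGm (M := 1)
    (fun n => by rw [hw1]; simp) (fun n => (hG1 n).trans (ENNReal.ofReal_le_ofReal (by
      rw [inv_le_one₀ (by positivity)]; linarith [n.cast_nonneg (α := ℝ)])))
  have hv0 : HasWeakGradient Ω v 0 :=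
    HasWeakGradient.of_tendsto hΩ hs hs (fun n => hww (φ n)) (fun n => hwm _) (fun n => hGm _) hvm
      MemLp.zero hlim (by
        simp only [Pi.zero_apply, sub_zero]
        exact hGlim.comp hφ.tendsto_atTop)
  obtain ⟨d, hd⟩ := exists_ae_eq_const hΩ hs hv0 hvm EventuallyEq.rfl
  have hvL : hvm.toLp v = d • b := by
    rw [hb, ← MemLp.toLp_const_smul, MemLp.toLp_eq_toLp_iff]
    filter_upwards [hd] with x hx
    simp [hx]
  have hwL : Tendsto (fun n => (hwm (φ n)).toLp (w (φ n))) atTop (𝓝 (d • b)) := by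
    rw [← hvL]
    exact (Lp.tendsto_Lp_iff_tendsto_eLpNorm'' _ (fun n => hwm (φ n)) _ hvm).mpr hlim
  have horth : BirkhoffOrth b (d • b) := BirkhoffOrth.of_tendsto (fun n => by
    have : (hwm (φ n)).toLp (w (φ n)) = (t (φ n))⁻¹ • ((hu (φ n)).toLp _ + c (φ n) • b) := by
      rw [← hvb, ← MemLp.toLp_const_smul]
    rw [this]
    exact (hc _).smul _) hwL
  have h0 : Tendsto (fun n => ‖(hwm (φ n)).toLp (w (φ n))‖) atTop (𝓝 0) := by
    simpa [horth.eq_zero] using hwL.norm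
  have h1 : ∀ n, ‖(hwm (φ n)).toLp (w (φ n))‖ = 1 := fun n => by
    rw [Lp.norm_toLp, hw1, ENNReal.toReal_one]
  simp only [h1] at h0
  exact one_ne_zero (tendsto_nhds_unique tendsto_const_nhds h0)

end Poincare

/-! ### The collar of the boundary -/

section BoundaryCharts

variable {Ω : Set (Space N)}

/-- Fubini's theorem for the decomposition of space into a line and its orthogonal complement. -/
theorem lintegral_orthogonal_line {e : Space N} (he : ‖e‖ = 1) {f : Space N → ℝ≥0∞}
    (hf : Measurable f) :
    ∫⁻ y : (Submodule.span ℝ {e})ᗮ, ∫⁻ t : ℝ, f (y + t • e) = ∫⁻ x, f x := by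
  have h0 := (Submodule.measurePreserving_measurableEquivProd (Submodule.span ℝ {e})
    (0 : Space N)).symm
  rw [InnerProductSpace.euclideanHausdorffMeasure_eq_volume] at h0
  rw [← h0.lintegral_comp hf, Measure.volume_eq_prod,
    lintegral_prod_symm' (fun z => f (((Submodule.span ℝ {e}).measurableEquivProd
      (0 : Space N)).symm z)) (hf.comp (MeasurableEquiv.measurable _))]
  refine lintegral_congr fun y => ?_
  have h1 := (LinearIsometryEquiv.toSpanUnitSingleton (𝕜 := ℝ) e he).measurePreserving
  rw [← h1.lintegral_comp (f := fun z => f (((Submodule.span ℝ {e}).measurableEquivProd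
    (0 : Space N)).symm (z, y)))
    ((hf.comp (MeasurableEquiv.measurable _)).comp measurable_prodMk_right)]
  refine lintegral_congr fun t => ?_
  simp [add_comm]

/-- The surface measure of a piece of a Lipschitz graph is controlled by the Lebesgue measure of
its projection. -/
theorem map_hausdorff_le {F : Type*} [NormedAddCommGroup F] [InnerProductSpace ℝ F]
    [FiniteDimensional ℝ F] [MeasurableSpace F] [BorelSpace F] {d : ℕ}
    (hrank : Module.finrank ℝ F = d) {S : Set (Space N)} {π : Space N → F} (hπ : Measurable π)
    {g : F → Space N} {T : Set F} {K : NNReal} (hg : LipschitzOnWith K g T)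
    (hS : ∀ x ∈ S, π x ∈ T ∧ g (π x) = x) :
    ((Measure.euclideanHausdorffMeasure d).restrict S).map π ≤
      ((K : ℝ≥0∞) ^ (d : ℝ)) • (volume : Measure F) := by
  have hvol : (volume : Measure F) = Measure.euclideanHausdorffMeasure d := by
    rw [← hrank, InnerProductSpace.euclideanHausdorffMeasure_eq_volume]
  refine Measure.le_iff.mpr fun B hB => ?_
  rw [Measure.map_apply hπ hB, Measure.restrict_apply (hπ hB), Measure.smul_apply, smul_eq_mul,
    hvol]
  calc (Measure.euclideanHausdorffMeasure d) (π ⁻¹' B ∩ S)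
      ≤ (Measure.euclideanHausdorffMeasure d) (g '' (B ∩ T)) := by
        refine measure_mono fun x hx => ⟨π x, ⟨hx.1, (hS x hx.2).1⟩, (hS x hx.2).2⟩
    _ ≤ (K : ℝ≥0∞) ^ (d : ℝ) * (Measure.euclideanHausdorffMeasure d) (B ∩ T) := by
        rw [Measure.euclideanHausdorffMeasure_def, Measure.euclideanHausdorffMeasure_def,
          Measure.smul_apply, Measure.smul_apply, ENNReal.smul_def, ENNReal.smul_def,
          smul_eq_mul, smul_eq_mul, mul_left_comm]
        gcongr
        exact (hg.mono Set.inter_subset_right).hausdorffMeasure_image_le (by positivity)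
    _ ≤ _ := by gcongr; exact Set.inter_subset_left

/-- Near a boundary point, the domain contains the segments of some fixed length that leave the
boundary in the direction `e`, and integrals over this collar dominate the iterated integrals over
the boundary and the segments. -/
theorem exists_collar (hΩ : IsSmoothBoundedDomain Ω) {x₀ : Space N} (hx₀ : x₀ ∈ frontier Ω) :
    ∃ e : Space N, ‖e‖ = 1 ∧ ∃ ρ : ℝ, 0 < ρ ∧ ∃ δ : ℝ, 0 < δ ∧ ∃ C : ℝ≥0∞, C ≠ ⊤ ∧
      ∀ f : Space N → ℝ≥0∞, Measurable f →
        ∫⁻ x in Metric.ball x₀ ρ, ∫⁻ t in Set.Ioc 0 δ, f (x + t • e) ∂volume ∂(boundaryMeasure Ω) ≤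
          C * ∫⁻ x, f x ∂(domainMeasure Ω) := by
  obtain ⟨e, he, γ, hγ, hinv, r, hr, hchart⟩ := hΩ.smooth_boundary x₀ hx₀
  let F := (Submodule.span ℝ {e})ᗮ
  let π := F.orthogonalProjectionOnto
  have hrank : Module.finrank ℝ F = N - 1 := by
    have h1 := Submodule.finrank_add_finrank_orthogonal (Submodule.span ℝ {e})
    rw [finrank_span_singleton (by rintro rfl; simp at he), finrank_euclideanSpace,
      Fintype.card_fin] at h1
    change Module.finrank ℝ (Submodule.span ℝ {e})ᗮ = N - 1
    omega
  have hπx : ∀ x, (π x : Space N) = x + (-inner ℝ e x) • e := fun x => by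
    have h1 := Submodule.starProjection_add_starProjection_orthogonal (K := Submodule.span ℝ {e})
      (w := x)
    rw [Submodule.starProjection_unit_singleton ℝ he] at h1
    have h2 : (π x : Space N) = (Submodule.span ℝ {e})ᗮ.starProjection x := rfl
    rw [h2, neg_smul, ← sub_eq_add_neg, eq_sub_iff_add_eq, add_comm]
    exact h1
  let g : F → Space N := fun y => y + γ y • e
  have hgC : ContDiff ℝ 1 g := by
    have h1 : ContDiff ℝ 1 fun y : F => (y : Space N) := F.subtypeL.contDiff
    exact h1.add (((hγ.of_le (by simp)).comp h1).smul contDiff_const)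
  obtain ⟨K, T, hT, hK⟩ := hgC.contDiffAt (x := π x₀) |>.exists_lipschitzOnWith
  obtain ⟨ρ', hρ', hsubT⟩ := Metric.mem_nhds_iff.mp (π.continuous.continuousAt.preimage_mem_nhds hT)
  set ρ := min ρ' (r / 2)
  have hρ : 0 < ρ := lt_min hρ' (half_pos hr)
  -- the piece `S` of the boundary lies on the graph of `γ`, parametrized by `g`, with inverse `π`
  set S := frontier Ω ∩ Metric.ball x₀ ρ with hS
  have hSγ : ∀ x ∈ S, γ x = inner ℝ e x := by
    rintro x ⟨hx, hxb⟩
    have hxr : x ∈ Metric.ball x₀ r := Metric.ball_subset_ball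
      ((min_le_right _ _).trans (half_le_self hr.le)) hxb
    refine le_antisymm ?_ (not_lt.mp fun h => ?_)
    · have hcl : x ∈ closure (Ω ∩ Metric.ball x₀ r) :=
        Set.inter_comm _ Ω ▸ Metric.isOpen_ball.inter_closure ⟨hxr, frontier_subset_closure hx⟩
      have hclosed : IsClosed {y : Space N | γ y ≤ inner ℝ e y} :=
        isClosed_le hγ.continuous (by fun_prop)
      exact hclosed.closure_subset_iff.mpr (fun y hy => ((hchart y hy.2).mp hy.1).le) hcl
    · have := (hchart x hxr).mpr h
      rw [hΩ.isOpen.frontier_eq] at hx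
      exact hx.2 this
  have hgπ : ∀ x ∈ S, π x ∈ T ∧ g (π x) = x := fun x hx => by
    refine ⟨hsubT (Metric.ball_subset_ball (min_le_left _ _) hx.2), ?_⟩
    change (π x : Space N) + γ (π x) • e = x
    rw [hπx, hinv, hSγ x hx]
    simp
  have hmap := map_hausdorff_le hrank π.continuous.measurable hK hgπ
  refine ⟨e, he, ρ, hρ, r / 2, half_pos hr, _, ENNReal.rpow_ne_top_of_nonneg (Nat.cast_nonneg (N - 1))
    (ENNReal.coe_ne_top (r := K)), fun f hf => ?_⟩
  have hSm : MeasurableSet S := isClosed_frontier.measurableSet.inter Metric.isOpen_ball.measurableSet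
  have hΩm := hΩ.isOpen.measurableSet
  have hfi : Measurable (Ω.indicator f) := hf.indicator hΩm
  set h : F → ℝ≥0∞ := fun y => ∫⁻ t in Set.Ioc 0 (r / 2), Ω.indicator f (g y + t • e) with hh
  have hhm : Measurable h :=
    Measurable.lintegral_prod_right' (f := fun z : F × ℝ => Ω.indicator f (g z.1 + z.2 • e))
      (hfi.comp ((hgC.continuous.comp continuous_fst).add
        (continuous_snd.smul continuous_const)).measurable)
  rw [boundaryMeasure, Measure.restrict_restrict Metric.isOpen_ball.measurableSet, Set.inter_comm]
  calc ∫⁻ x in S, ∫⁻ t in Set.Ioc 0 (r / 2), f (x + t • e)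
        ∂volume ∂(Measure.euclideanHausdorffMeasure (N - 1))
      = ∫⁻ x in S, h (π x) ∂(Measure.euclideanHausdorffMeasure (N - 1)) := by
        refine setLIntegral_congr_fun hSm fun x hx => ?_
        refine setLIntegral_congr_fun measurableSet_Ioc fun t ht => ?_
        rw [(hgπ x hx).2, Set.indicator_of_mem]
        refine (hchart _ ?_).mpr ?_
        · rw [Metric.mem_ball, dist_eq_norm]
          have h1 : ‖x - x₀‖ < r / 2 := (mem_ball_iff_norm.mp hx.2).trans_le (min_le_right _ _)
          have h2 : ‖t • e‖ ≤ r / 2 := by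
            rw [norm_smul, he, mul_one, Real.norm_of_nonneg ht.1.le]; exact ht.2
          calc ‖x + t • e - x₀‖ = ‖(x - x₀) + t • e‖ := by congr 1; abel
            _ ≤ ‖x - x₀‖ + ‖t • e‖ := norm_add_le _ _
            _ < r := by linarith
        · rw [hinv, hSγ x hx, inner_add_right, inner_smul_right, real_inner_self_eq_norm_sq, he]
          linarith [ht.1]
    _ = ∫⁻ y, h y ∂(((Measure.euclideanHausdorffMeasure (N - 1)).restrict S).map π) :=
        (lintegral_map hhm π.continuous.measurable).symm
    _ ≤ ∫⁻ y, h y ∂(((K : ℝ≥0∞) ^ ((N - 1 : ℕ) : ℝ)) • (volume : Measure F)) :=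
        lintegral_mono' hmap le_rfl
    _ = (K : ℝ≥0∞) ^ ((N - 1 : ℕ) : ℝ) * ∫⁻ y, h y := lintegral_smul_measure _ _
    _ ≤ (K : ℝ≥0∞) ^ ((N - 1 : ℕ) : ℝ) * ∫⁻ y : F, ∫⁻ t : ℝ, Ω.indicator f (y + t • e) := by
        gcongr with y
        refine (setLIntegral_le_lintegral _ _).trans (le_of_eq ?_)
        rw [← lintegral_add_left_eq_self (fun t : ℝ => Ω.indicator f (y + t • e)) (γ y)]
        refine lintegral_congr fun t => ?_
        simp only [g]
        rw [add_smul, add_assoc]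
    _ = _ := by
        rw [lintegral_orthogonal_line he hfi, lintegral_indicator hΩm]
        rfl

end BoundaryCharts

/-! ### The trace inequality for smooth functions -/

section TraceInequality

variable {Ω : Set (Space N)}

theorem rpow_setLIntegral_Ioc_le {s η : ℝ} (hs : 1 ≤ s) {g : ℝ → ℝ≥0∞}
    (hg : Measurable g) :
    (∫⁻ t in Set.Ioc 0 η, g t) ^ s ≤ ENNReal.ofReal η ^ (s - 1) * ∫⁻ t in Set.Ioc 0 η, g t ^ s := by
  have hs0 : 0 < s := by linarith
  have h1 := eLpNorm'_le_eLpNorm'_mul_rpow_measure_univ (μ := volume.restrict (Set.Ioc 0 η)) (f := g)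
    one_pos hs hg.aestronglyMeasurable
  simp only [eLpNorm', enorm_eq_self, ENNReal.rpow_one, div_one, Measure.restrict_apply_univ,
    Real.volume_Ioc, sub_zero] at h1
  have h2 := ENNReal.rpow_le_rpow h1 hs0.le
  rwa [ENNReal.mul_rpow_of_nonneg _ _ hs0.le, ← ENNReal.rpow_mul, ← ENNReal.rpow_mul,
    one_div_mul_cancel hs0.ne', ENNReal.rpow_one, sub_mul, one_mul, one_div_mul_cancel hs0.ne',
    mul_comm] at h2

theorem enorm_le_add_lintegral_gradient {φ : Space N → ℝ} (hφ : ContDiff ℝ ∞ φ) {e : Space N}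
    (he : ‖e‖ = 1) (x : Space N) {t η : ℝ} (ht : t ∈ Set.Ioc 0 η) :
    ‖φ x‖ₑ ≤ ‖φ (x + t • e)‖ₑ + ∫⁻ τ in Set.Ioc 0 η, ‖gradient φ (x + τ • e)‖ₑ := by
  have hd : ∀ τ : ℝ, HasDerivAt (fun τ : ℝ => φ (x + τ • e)) (fderiv ℝ φ (x + τ • e) e) τ := by
    intro τ
    have h1 : HasDerivAt (fun τ : ℝ => x + τ • e) e τ := by
      simpa using ((hasDerivAt_id τ).smul_const e).const_add x
    exact (hφ.differentiable (by simp) _).hasFDerivAt.comp_hasDerivAt τ h1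
  have hcont : Continuous fun τ : ℝ => fderiv ℝ φ (x + τ • e) e :=
    ((hφ.continuous_fderiv (by simp)).comp (by fun_prop)).clm_apply continuous_const
  have hint := intervalIntegral.integral_eq_sub_of_hasDerivAt
    (fun τ _ => hd τ) (hcont.intervalIntegrable 0 t)
  rw [zero_smul, add_zero, intervalIntegral.integral_of_le ht.1.le] at hint
  have h2 : ‖φ x‖ₑ ≤ ‖φ (x + t • e)‖ₑ + ‖φ (x + t • e) - φ x‖ₑ := by
    have : φ x = φ (x + t • e) - (φ (x + t • e) - φ x) := by ring
    conv_lhs => rw [this]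
    exact enorm_sub_le
  refine h2.trans ?_
  gcongr
  rw [← hint]
  refine (enorm_integral_le_lintegral_enorm _).trans ?_
  refine (lintegral_mono_set (Set.Ioc_subset_Ioc_right ht.2)).trans (lintegral_mono fun τ => ?_)
  rw [← inner_gradient_left, ← ofReal_norm, ← ofReal_norm]
  refine ENNReal.ofReal_le_ofReal ((norm_inner_le_norm _ _).trans_eq ?_)
  rw [he, mul_one]

/-- A boundary value is controlled by averages along a segment leaving the boundary. -/
theorem mul_enorm_rpow_le {φ : Space N → ℝ} (hφ : ContDiff ℝ ∞ φ) {e : Space N}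
    (he : ‖e‖ = 1) {s : ℝ} (hs : 1 ≤ s) (x : Space N) {η : ℝ} (hη : 0 < η) :
    ENNReal.ofReal η * ‖φ x‖ₑ ^ s ≤ 2 ^ (s - 1) * ∫⁻ t in Set.Ioc 0 η,
      (‖φ (x + t • e)‖ₑ ^ s + ENNReal.ofReal η ^ s * ‖gradient φ (x + t • e)‖ₑ ^ s) := by
  have hs0 : 0 ≤ s := by linarith
  have hline : Continuous fun t : ℝ => x + t • e := by fun_prop
  have hm1 : Measurable fun t : ℝ => ‖φ (x + t • e)‖ₑ :=
    (hφ.continuous.comp hline).enorm.measurable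
  have hm2 : Measurable fun t : ℝ => ‖gradient φ (x + t • e)‖ₑ :=
    ((continuous_gradient hφ).comp hline).enorm.measurable
  set J := ∫⁻ τ in Set.Ioc 0 η, ‖gradient φ (x + τ • e)‖ₑ with hJ
  have hη0 : ENNReal.ofReal η ≠ 0 := (ENNReal.ofReal_pos.mpr hη).ne'
  calc ENNReal.ofReal η * ‖φ x‖ₑ ^ s = ∫⁻ _t in Set.Ioc 0 η, ‖φ x‖ₑ ^ s := by
        rw [setLIntegral_const, Real.volume_Ioc, sub_zero, mul_comm]
    _ ≤ ∫⁻ t in Set.Ioc 0 η, 2 ^ (s - 1) * (‖φ (x + t • e)‖ₑ ^ s + J ^ s) := by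
        refine setLIntegral_mono' measurableSet_Ioc fun t ht => ?_
        exact (ENNReal.rpow_le_rpow (enorm_le_add_lintegral_gradient hφ he x ht) hs0).trans
          (ENNReal.rpow_add_le_mul_rpow_add_rpow _ _ hs)
    _ = 2 ^ (s - 1) * ((∫⁻ t in Set.Ioc 0 η, ‖φ (x + t • e)‖ₑ ^ s) + J ^ s * ENNReal.ofReal η) := by
        rw [lintegral_const_mul' _ _ (by finiteness), lintegral_add_left (hm1.pow_const s),
          setLIntegral_const, Real.volume_Ioc, sub_zero]
    _ ≤ 2 ^ (s - 1) * ((∫⁻ t in Set.Ioc 0 η, ‖φ (x + t • e)‖ₑ ^ s) +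
          ENNReal.ofReal η ^ s * ∫⁻ t in Set.Ioc 0 η, ‖gradient φ (x + t • e)‖ₑ ^ s) := by
        refine mul_le_mul_right (add_le_add_right ?_ _) _
        have hpow : ENNReal.ofReal η ^ s = ENNReal.ofReal η ^ (s - 1) * ENNReal.ofReal η := by
          conv_lhs => rw [← sub_add_cancel s 1]
          rw [ENNReal.rpow_add _ _ hη0 ENNReal.ofReal_ne_top, ENNReal.rpow_one]
        rw [hpow, mul_right_comm]
        exact mul_le_mul_left (rpow_setLIntegral_Ioc_le hs hm2) _
    _ = _ := by
        rw [lintegral_add_left (hm1.pow_const s), lintegral_const_mul' _ _ (by finiteness)]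

/-- The trace inequality for smooth functions; the parameter `η` is the width of the collar of the
boundary that is used. -/
theorem exists_trace_inequality (hΩ : IsSmoothBoundedDomain Ω) {s : ℝ} (hs : 1 ≤ s) :
    ∃ C : ℝ≥0∞, C ≠ ⊤ ∧ ∃ δ : ℝ, 0 < δ ∧ ∀ φ : Space N → ℝ, ContDiff ℝ ∞ φ → ∀ η ∈ Set.Ioc 0 δ,
      ENNReal.ofReal η * ∫⁻ x, ‖φ x‖ₑ ^ s ∂(boundaryMeasure Ω) ≤
        C * ((∫⁻ x, ‖φ x‖ₑ ^ s ∂(domainMeasure Ω)) +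
          ENNReal.ofReal η ^ s * ∫⁻ x, ‖gradient φ x‖ₑ ^ s ∂(domainMeasure Ω)) := by
  have hcomp : IsCompact (frontier Ω) := hΩ.isBounded.isCompact_closure.of_isClosed_subset
    isClosed_frontier frontier_subset_closure
  -- the inequality passes from the pieces of a finite cover to the whole compact boundary
  have key : ∃ C : ℝ≥0∞, C ≠ ⊤ ∧ ∃ δ : ℝ, 0 < δ ∧ ∀ φ : Space N → ℝ, ContDiff ℝ ∞ φ →
      ∀ η ∈ Set.Ioc 0 δ, ENNReal.ofReal η * ∫⁻ x in frontier Ω, ‖φ x‖ₑ ^ s ∂(boundaryMeasure Ω) ≤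
        C * ((∫⁻ x, ‖φ x‖ₑ ^ s ∂(domainMeasure Ω)) +
          ENNReal.ofReal η ^ s * ∫⁻ x, ‖gradient φ x‖ₑ ^ s ∂(domainMeasure Ω)) := by
    refine hcomp.induction_on (p := fun S => ∃ C : ℝ≥0∞, C ≠ ⊤ ∧ ∃ δ : ℝ, 0 < δ ∧
      ∀ φ : Space N → ℝ, ContDiff ℝ ∞ φ → ∀ η ∈ Set.Ioc 0 δ,
        ENNReal.ofReal η * ∫⁻ x in S, ‖φ x‖ₑ ^ s ∂(boundaryMeasure Ω) ≤
        C * ((∫⁻ x, ‖φ x‖ₑ ^ s ∂(domainMeasure Ω)) +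
          ENNReal.ofReal η ^ s * ∫⁻ x, ‖gradient φ x‖ₑ ^ s ∂(domainMeasure Ω))) ?_ ?_ ?_ ?_
    · exact ⟨0, by simp, 1, one_pos, by simp⟩
    · rintro S S' hSS ⟨C, hC, δ, hδ, h⟩
      exact ⟨C, hC, δ, hδ, fun φ hφ η hη => le_trans (by gcongr) (h φ hφ η hη)⟩
    · rintro S S' ⟨C, hC, δ, hδ, h⟩ ⟨C', hC', δ', hδ', h'⟩
      refine ⟨C + C', ENNReal.add_ne_top.mpr ⟨hC, hC'⟩, min δ δ', lt_min hδ hδ', fun φ hφ η hη => ?_⟩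
      rw [add_mul]
      refine le_trans ?_ (add_le_add (h φ hφ η ⟨hη.1, hη.2.trans (min_le_left _ _)⟩)
        (h' φ hφ η ⟨hη.1, hη.2.trans (min_le_right _ _)⟩))
      rw [← mul_add]
      gcongr
      exact lintegral_union_le _ _ _
    · intro x₀ hx₀
      obtain ⟨e, he, ρ, hρ, δ, hδ, C, hC, h⟩ := exists_collar hΩ hx₀
      refine ⟨Metric.ball x₀ ρ, mem_nhdsWithin_of_mem_nhds (Metric.ball_mem_nhds x₀ hρ),
        2 ^ (s - 1) * C, ENNReal.mul_ne_top (by finiteness) hC, δ, hδ, fun φ hφ η hη => ?_⟩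
      have hm1 : Measurable fun x => ‖φ x‖ₑ ^ s := hφ.continuous.enorm.measurable.pow_const s
      have hm2 : Measurable fun x => ENNReal.ofReal η ^ s * ‖gradient φ x‖ₑ ^ s :=
        ((continuous_gradient hφ).enorm.measurable.pow_const s).const_mul _
      have h1 := h (fun x => ‖φ x‖ₑ ^ s + ENNReal.ofReal η ^ s * ‖gradient φ x‖ₑ ^ s)
        (hm1.add hm2)
      rw [lintegral_add_left hm1, lintegral_const_mul' _ _ (by finiteness)] at h1
      rw [mul_assoc, ← lintegral_const_mul' _ _ ENNReal.ofReal_ne_top]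
      refine le_trans (lintegral_mono fun x => mul_enorm_rpow_le hφ he hs x hη.1) ?_
      rw [lintegral_const_mul' _ _ (by finiteness)]
      gcongr 2 ^ (s - 1) * ?_
      refine le_trans (lintegral_mono fun x => ?_) h1
      exact lintegral_mono_set (Set.Ioc_subset_Ioc_right hη.2)
  have e : (boundaryMeasure Ω).restrict (frontier Ω) = boundaryMeasure Ω := by
    rw [boundaryMeasure, Measure.restrict_restrict isClosed_frontier.measurableSet, Set.inter_self]
  rwa [e] at key

/-- The boundary has finite surface measure, by the trace inequality for the constant one. -/
theorem IsSmoothBoundedDomain.isFiniteMeasure_boundary (hΩ : IsSmoothBoundedDomain Ω) :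
    IsFiniteMeasure (boundaryMeasure Ω) := by
  have := hΩ.isFiniteMeasure
  obtain ⟨C, hC, δ, hδ, h⟩ := exists_trace_inequality hΩ le_rfl
  have h1 := h (fun _ => 1) contDiff_const δ ⟨hδ, le_rfl⟩
  have e : gradient (fun _ : Space N => (1 : ℝ)) = 0 := by
    ext1 x; simp [gradient]
  simp only [e, enorm_one, lintegral_one, Pi.zero_apply, enorm_zero,
    ENNReal.rpow_one, lintegral_zero, mul_zero, add_zero] at h1
  refine ⟨lt_of_le_of_ne le_top fun htop => ?_⟩
  rw [htop, ENNReal.mul_top (ENNReal.ofReal_pos.mpr hδ).ne', top_le_iff] at h1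
  exact ENNReal.mul_ne_top hC (measure_ne_top _ _) h1

/-- The trace inequality for smooth functions, with an arbitrarily small factor in front of the
gradient. -/
theorem eLpNorm_boundary_le (hΩ : IsSmoothBoundedDomain Ω) {s : ℝ} (hs : 1 < s) {ε : ℝ}
    (hε : 0 < ε) : ∃ C : ℝ, 0 ≤ C ∧ ∀ φ : Space N → ℝ, ContDiff ℝ ∞ φ →
      eLpNorm φ (ENNReal.ofReal s) (boundaryMeasure Ω) ≤
        ENNReal.ofReal C * eLpNorm φ (ENNReal.ofReal s) (domainMeasure Ω) +
          ENNReal.ofReal ε * eLpNorm (gradient φ) (ENNReal.ofReal s) (domainMeasure Ω) := by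
  have hs0 : 0 < s := by linarith
  obtain ⟨K, hK, δ, hδ, h⟩ := exists_trace_inequality hΩ hs.le
  obtain ⟨k, rfl⟩ : ∃ k : ℝ, K = ENNReal.ofReal k := ⟨K.toReal, (ENNReal.ofReal_toReal hK).symm⟩
  -- after division by `η` the factor of the gradient is `K η ^ (s - 1)`, which is small with `η`
  -- because `1 < s`
  have hlim : Tendsto (fun η : ℝ => |k| * η ^ (s - 1)) (𝓝[>] 0) (𝓝 0) := by
    have h1 : ContinuousAt (fun η : ℝ => |k| * η ^ (s - 1)) 0 :=
      (Real.continuousAt_rpow_const _ _ (Or.inr (by linarith))).const_mul _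
    have h2 := h1.tendsto.mono_left (nhdsWithin_le_nhds (s := Set.Ioi 0))
    simpa [Real.zero_rpow (by linarith : s - 1 ≠ 0)] using h2
  obtain ⟨η, hη1, hη2⟩ := ((hlim.eventually_lt_const (Real.rpow_pos_of_pos hε s)).and
    (Ioc_mem_nhdsGT hδ)).exists
  have hη := hη2.1
  refine ⟨(|k| / η) ^ (1 / s), by positivity, fun φ hφ => ?_⟩
  have h1 := h φ hφ η hη2
  have h2 : ∫⁻ x, ‖φ x‖ₑ ^ s ∂(boundaryMeasure Ω) ≤
      ENNReal.ofReal (|k| / η) * (∫⁻ x, ‖φ x‖ₑ ^ s ∂(domainMeasure Ω)) +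
        ENNReal.ofReal (ε ^ s) * ∫⁻ x, ‖gradient φ x‖ₑ ^ s ∂(domainMeasure Ω) := by
    rw [← ENNReal.mul_le_mul_iff_right (a := ENNReal.ofReal η) (ENNReal.ofReal_pos.mpr hη).ne'
      ENNReal.ofReal_ne_top]
    refine h1.trans ?_
    rw [mul_add, mul_add, ← mul_assoc, ← mul_assoc, ← mul_assoc, ← ENNReal.ofReal_mul hη.le,
      ← ENNReal.ofReal_mul hη.le]
    gcongr
    · rw [mul_div_cancel₀ _ hη.ne']; exact le_abs_self k
    · rw [ENNReal.ofReal_rpow_of_pos hη, ← ENNReal.ofReal_mul' (by positivity)]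
      refine ENNReal.ofReal_le_ofReal ?_
      calc k * η ^ s ≤ |k| * η ^ s := by gcongr; exact le_abs_self k
        _ = η * (|k| * η ^ (s - 1)) := by
          rw [show s = (s - 1) + 1 by ring, Real.rpow_add hη, Real.rpow_one]; ring_nf
        _ ≤ _ := by gcongr
  have hr : ∀ a : ℝ, 0 ≤ a → ∀ X : ℝ≥0∞, (ENNReal.ofReal a * X) ^ (1 / s) =
      ENNReal.ofReal (a ^ (1 / s)) * X ^ (1 / s) := fun a ha X => by
    rw [ENNReal.mul_rpow_of_nonneg _ _ (by positivity),
      ENNReal.ofReal_rpow_of_nonneg ha (by positivity)]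
  rw [eLpNorm_ofReal hs.le, eLpNorm_ofReal hs.le, eLpNorm_ofReal hs.le]
  refine (ENNReal.rpow_le_rpow h2 (by positivity : 0 ≤ 1 / s)).trans ?_
  refine (ENNReal.rpow_add_le_add_rpow _ _ (by positivity) ?_).trans ?_
  · rw [div_le_one hs0]; exact hs.le
  · rw [hr _ (by positivity), hr _ (by positivity), ← Real.rpow_mul hε.le, mul_one_div_cancel hs0.ne',
      Real.rpow_one]

end TraceInequality

/-! ### Sobolev functions -/

section SobolevFunctions

variable {Ω : Set (Space N)} {r : ℝ} {u u' v v' : Space N → ℝ}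

theorem memLp_of_continuous {F : Type*} [NormedAddCommGroup F] {m : Measure (Space N)}
    [IsFiniteMeasure m] {K : Set (Space N)} (hK : IsCompact K) (hm : ∀ᵐ x ∂m, x ∈ K)
    {f : Space N → F} (hf : Continuous f) (p : ℝ≥0∞) : MemLp f p m := by
  obtain ⟨C, hC⟩ := hK.exists_bound_of_continuousOn hf.continuousOn
  exact MemLp.of_bound hf.aestronglyMeasurable C (hm.mono hC)

theorem memLp_domain_of_continuous {F : Type*} [NormedAddCommGroup F]
    (hΩ : IsSmoothBoundedDomain Ω) {f : Space N → F} (hf : Continuous f) (p : ℝ≥0∞) :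
    MemLp f p (domainMeasure Ω) := by
  have := hΩ.isFiniteMeasure
  exact memLp_of_continuous (m := domainMeasure Ω) hΩ.isBounded.isCompact_closure
    ((ae_restrict_mem hΩ.isOpen.measurableSet).mono fun x hx => subset_closure hx) hf p

theorem ae_mem_frontier : ∀ᵐ x ∂(boundaryMeasure Ω), x ∈ frontier Ω :=
  ae_restrict_mem isClosed_frontier.measurableSet

theorem memLp_boundary_of_continuous {F : Type*} [NormedAddCommGroup F]
    (hΩ : IsSmoothBoundedDomain Ω) {f : Space N → F} (hf : Continuous f) (p : ℝ≥0∞) :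
    MemLp f p (boundaryMeasure Ω) := by
  have := hΩ.isFiniteMeasure_boundary
  exact memLp_of_continuous (hΩ.isBounded.isCompact_closure.of_isClosed_subset isClosed_frontier
    frontier_subset_closure) ae_mem_frontier hf p

theorem MemSobolev.hasWeakGradient (h : MemSobolev Ω r u) :
    HasWeakGradient Ω u (weakGradient Ω u) :=
  h.2.choose_spec.1.weakGradient

theorem MemSobolev.memLp_weakGradient (hΩ : IsOpen Ω) (h : MemSobolev Ω r u) :
    MemLp (weakGradient Ω u) (ENNReal.ofReal r) (domainMeasure Ω) := by
  obtain ⟨-, g, hg, hgm⟩ := h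
  exact (memLp_congr_ae (hg.weakGradient_ae_eq hΩ)).mpr hgm

theorem MemSobolev.add (h : MemSobolev Ω r u) (h' : MemSobolev Ω r u') :
    MemSobolev Ω r (u + u') := by
  obtain ⟨hu, g, hg, hgm⟩ := h
  obtain ⟨hu', g', hg', hgm'⟩ := h'
  exact ⟨hu.add hu', g + g', hg.add hg', hgm.add hgm'⟩

theorem MemSobolev.const_smul (h : MemSobolev Ω r u) (c : ℝ) : MemSobolev Ω r (c • u) := by
  obtain ⟨hu, g, hg, hgm⟩ := h
  exact ⟨hu.const_smul c, c • g, hg.const_smul c, hgm.const_smul c⟩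

theorem memSobolev_of_contDiff (hΩ : IsSmoothBoundedDomain Ω) {φ : Space N → ℝ}
    (hφ : ContDiff ℝ ∞ φ) : MemSobolev Ω r φ :=
  ⟨memLp_domain_of_continuous hΩ hφ.continuous _, gradient φ, hasWeakGradient_of_contDiff hφ,
    memLp_domain_of_continuous hΩ (continuous_gradient hφ) _⟩

theorem MemSobolev.of_exponent_le (hΩ : IsSmoothBoundedDomain Ω) {s : ℝ} (hsr : s ≤ r)
    (h : MemSobolev Ω r u) : MemSobolev Ω s u := by
  have := hΩ.isFiniteMeasure
  obtain ⟨hu, g, hg, hgm⟩ := h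
  exact ⟨hu.mono_exponent (ENNReal.ofReal_le_ofReal hsr), g, hg,
    hgm.mono_exponent (ENNReal.ofReal_le_ofReal hsr)⟩

theorem MemSobolev.weakGradient_add (hΩ : IsOpen Ω) (h : MemSobolev Ω r u)
    (h' : MemSobolev Ω r u') : weakGradient Ω (u + u') =ᵐ[domainMeasure Ω]
      weakGradient Ω u + weakGradient Ω u' :=
  (h.hasWeakGradient.add h'.hasWeakGradient).weakGradient_ae_eq hΩ

theorem MemSobolev.weakGradient_const_smul (hΩ : IsOpen Ω) (h : MemSobolev Ω r u) (c : ℝ) :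
    weakGradient Ω (c • u) =ᵐ[domainMeasure Ω] c • weakGradient Ω u :=
  (h.hasWeakGradient.const_smul c).weakGradient_ae_eq hΩ

theorem weakGradient_ae_eq_of_contDiff (hΩ : IsOpen Ω) {φ : Space N → ℝ} (hφ : ContDiff ℝ ∞ φ) :
    weakGradient Ω φ =ᵐ[domainMeasure Ω] gradient φ :=
  (hasWeakGradient_of_contDiff hφ).weakGradient_ae_eq hΩ

theorem weakGradient_const_ae_eq (hΩ : IsOpen Ω) (c : ℝ) :
    weakGradient Ω (fun _ => c) =ᵐ[domainMeasure Ω] 0 :=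
  (hasWeakGradient_const c).weakGradient_ae_eq hΩ

theorem gradient_add_smul {φ ψ : Space N → ℝ} (hφ : ContDiff ℝ ∞ φ) (hψ : ContDiff ℝ ∞ ψ) (c : ℝ)
    (x : Space N) : gradient (φ + c • ψ) x = gradient φ x + c • gradient ψ x := by
  have h1 := (hφ.differentiable (by simp)) x
  have h2 := (hψ.differentiable (by simp)) x
  rw [gradient, fderiv_add h1 (h2.const_smul c), fderiv_const_smul h2]
  simp [gradient]

end SobolevFunctions

/-! ### Traces of Sobolev functions -/

section Trace

variable {Ω : Set (Space N)} {r : ℝ} {u u' v v' : Space N → ℝ}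

/-- Traces exist: smooth approximations of `u` in the Sobolev space are a Cauchy sequence on the
boundary. -/
theorem exists_isTrace (hΩ : IsSmoothBoundedDomain Ω) (hr : 1 < r) (h : MemSobolev Ω r u) :
    ∃ v, IsTrace Ω r u v := by
  have hr1 := one_le_ofReal hr.le
  have : Fact (1 ≤ ENNReal.ofReal r) := ⟨hr1⟩
  have hG := h.memLp_weakGradient hΩ.isOpen
  obtain ⟨φ, hφ, hφu, hφG⟩ := exists_smooth_approx hΩ hr.le h.hasWeakGradient h.1 hG
  obtain ⟨C, hC, hineq⟩ := eLpNorm_boundary_le hΩ hr one_pos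
  have hb : ∀ n, MemLp (φ n) (ENNReal.ofReal r) (boundaryMeasure Ω) := fun n =>
    memLp_boundary_of_continuous hΩ (hφ n).continuous _
  set a : ℕ → ℝ≥0∞ := fun n => ENNReal.ofReal C *
    eLpNorm (fun x => φ n x - u x) (ENNReal.ofReal r) (domainMeasure Ω) + ENNReal.ofReal 1 *
    eLpNorm (fun x => gradient (φ n) x - weakGradient Ω u x) (ENNReal.ofReal r) (domainMeasure Ω)
    with ha
  have halim : Tendsto a atTop (𝓝 0) := by
    have := (ENNReal.Tendsto.const_mul hφu (Or.inr (ENNReal.ofReal_ne_top (r := C)))).add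
      (ENNReal.Tendsto.const_mul hφG (Or.inr (ENNReal.ofReal_ne_top (r := 1))))
    simpa only [mul_zero, add_zero] using this
  have hdist : ∀ n k, edist ((hb n).toLp (φ n)) ((hb k).toLp (φ k)) ≤ a n + a k := fun n k => by
    rw [Lp.edist_toLp_toLp]
    have e : φ n - φ k = φ n + (-1 : ℝ) • φ k := by ext x; simp [sub_eq_add_neg]
    have h1 := hineq (φ n - φ k) ((hφ n).sub (hφ k))
    refine h1.trans ?_
    rw [ha]; dsimp only
    rw [add_add_add_comm, ← mul_add, ← mul_add]
    have m1 : ∀ n, AEStronglyMeasurable (fun x => φ n x - u x) (domainMeasure Ω) := fun n =>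
      (hφ n).continuous.aestronglyMeasurable.sub h.1.1
    have m2 : ∀ n, AEStronglyMeasurable (fun x => gradient (φ n) x - weakGradient Ω u x)
      (domainMeasure Ω) := fun n =>
      (continuous_gradient (hφ n)).aestronglyMeasurable.sub hG.1
    gcongr
    · refine le_trans (le_of_eq ?_) (eLpNorm_sub_le (m1 n) (m1 k) hr1)
      congr 1; ext x; simp
    · refine le_trans (le_of_eq ?_) (eLpNorm_sub_le (m2 n) (m2 k) hr1)
      congr 1; ext1 x
      rw [e, gradient_add_smul (hφ n) (hφ k)]
      simp [sub_eq_add_neg]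
  have hcs : CauchySeq fun n => (hb n).toLp (φ n) := by
    refine EMetric.cauchySeq_iff.mpr fun ε hε => ?_
    obtain ⟨n₀, hn₀⟩ := eventually_atTop.mp (halim.eventually_lt_const (ENNReal.half_pos hε.ne'))
    refine ⟨n₀, fun n hn k hk => (hdist n k).trans_lt ?_⟩
    calc a n + a k < ε / 2 + ε / 2 := ENNReal.add_lt_add (hn₀ n hn) (hn₀ k hk)
      _ = ε := ENNReal.add_halves ε
  obtain ⟨f, hf⟩ := cauchySeq_tendsto_of_complete hcs
  refine ⟨f, Lp.memLp f, φ, hφ, hφu, hφG, ?_⟩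
  have h2 := (Lp.tendsto_Lp_iff_tendsto_eLpNorm' _ _).mp hf
  refine h2.congr fun n => eLpNorm_congr_ae ?_
  filter_upwards [(hb n).coeFn_toLp] with x hx
  simp [hx]

theorem MemSobolev.isTrace_trace (hΩ : IsSmoothBoundedDomain Ω) (hr : 1 < r)
    (h : MemSobolev Ω r u) : IsTrace Ω r u (trace Ω r u) := by
  have hex := exists_isTrace hΩ hr h
  rw [trace, dif_pos hex]
  exact hex.choose_spec

/-- The trace inequality for Sobolev functions, at any exponent not exceeding theirs. -/
theorem IsTrace.eLpNorm_le (hΩ : IsSmoothBoundedDomain Ω) {s : ℝ} (hs : 1 < s) (hsr : s ≤ r)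
    {ε : ℝ} (hε : 0 < ε) : ∃ C : ℝ, 0 ≤ C ∧ ∀ u v : Space N → ℝ, MemSobolev Ω r u →
      IsTrace Ω r u v → eLpNorm v (ENNReal.ofReal s) (boundaryMeasure Ω) ≤
        ENNReal.ofReal C * eLpNorm u (ENNReal.ofReal s) (domainMeasure Ω) +
          ENNReal.ofReal ε * eLpNorm (weakGradient Ω u) (ENNReal.ofReal s) (domainMeasure Ω) := by
  have := hΩ.isFiniteMeasure
  have := hΩ.isFiniteMeasure_boundary
  have hs1 := one_le_ofReal hs.le
  have hsr' := ENNReal.ofReal_le_ofReal hsr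
  obtain ⟨C, hC, hineq⟩ := eLpNorm_boundary_le hΩ hs hε
  refine ⟨C, hC, fun u v h ⟨hv, φ, hφ, hφu, hφG, hφv⟩ => ?_⟩
  have hG := h.memLp_weakGradient hΩ.isOpen
  have t1 := tendsto_eLpNorm_of_sub hs1 (fun n => (hφ n).continuous.aestronglyMeasurable) h.1.1
    (tendsto_eLpNorm_of_exponent_le hs1 hsr'
      (fun n => (hφ n).continuous.aestronglyMeasurable.sub h.1.1) hφu)
  have t2 := tendsto_eLpNorm_of_sub hs1 (fun n => (continuous_gradient (hφ n)).aestronglyMeasurable)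
    hG.1 (tendsto_eLpNorm_of_exponent_le hs1 hsr'
      (fun n => (continuous_gradient (hφ n)).aestronglyMeasurable.sub hG.1) hφG)
  have t3 := tendsto_eLpNorm_of_sub hs1 (fun n => (hφ n).continuous.aestronglyMeasurable) hv.1
    (tendsto_eLpNorm_of_exponent_le hs1 hsr'
      (fun n => (hφ n).continuous.aestronglyMeasurable.sub hv.1) hφv)
  exact le_of_tendsto_of_tendsto' t3 ((ENNReal.Tendsto.const_mul t1
    (Or.inr ENNReal.ofReal_ne_top)).add (ENNReal.Tendsto.const_mul t2
    (Or.inr ENNReal.ofReal_ne_top))) fun n => hineq (φ n) (hφ n)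

theorem tendsto_eLpNorm_sub_add_smul {α F : Type*} [MeasurableSpace α] [NormedAddCommGroup F]
    [NormedSpace ℝ F] {μ : Measure α} {p : ℝ≥0∞} (hp : 1 ≤ p) {f f' : ℕ → α → F} {g g' : α → F}
    (hf : ∀ n, AEStronglyMeasurable (f n) μ) (hg : AEStronglyMeasurable g μ)
    (hf' : ∀ n, AEStronglyMeasurable (f' n) μ) (hg' : AEStronglyMeasurable g' μ)
    (h : Tendsto (fun n => eLpNorm (fun x => f n x - g x) p μ) atTop (𝓝 0))
    (h' : Tendsto (fun n => eLpNorm (fun x => f' n x - g' x) p μ) atTop (𝓝 0)) (c : ℝ) :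
    Tendsto (fun n => eLpNorm (fun x => (f n x + c • f' n x) - (g x + c • g' x)) p μ) atTop
      (𝓝 0) := by
  have h2 := h.add (ENNReal.Tendsto.const_mul h' (a := ‖c‖ₑ) (Or.inr enorm_ne_top))
  simp only [mul_zero, add_zero] at h2
  refine tendsto_of_tendsto_of_tendsto_of_le_of_le tendsto_const_nhds h2 (fun _ => zero_le)
    fun n => ?_
  have e : (fun x => (f n x + c • f' n x) - (g x + c • g' x)) =
      (fun x => f n x - g x) + c • fun x => f' n x - g' x := by
    ext1 x
    simp only [Pi.add_apply, Pi.smul_apply, smul_sub]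
    abel
  simp only
  rw [e]
  refine (eLpNorm_add_le ((hf n).sub hg) (((hf' n).sub hg').const_smul c) hp).trans ?_
  rw [eLpNorm_const_smul]
  exact le_rfl

theorem IsTrace.add_smul (hΩ : IsSmoothBoundedDomain Ω) (hr : 1 < r) (hu : MemSobolev Ω r u)
    (hu' : MemSobolev Ω r u') (h : IsTrace Ω r u v) (h' : IsTrace Ω r u' v') (c : ℝ) :
    IsTrace Ω r (u + c • u') (v + c • v') := by
  obtain ⟨hv, φ, hφ, hφu, hφG, hφv⟩ := h
  obtain ⟨hv', φ', hφ', hφu', hφG', hφv'⟩ := h'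
  have hr1 := one_le_ofReal hr.le
  refine ⟨hv.add (hv'.const_smul c), fun n => φ n + c • φ' n,
    fun n => (hφ n).add ((hφ' n).const_smul c), ?_, ?_, ?_⟩
  · exact tendsto_eLpNorm_sub_add_smul hr1 (fun n => (hφ n).continuous.aestronglyMeasurable) hu.1.1
      (fun n => (hφ' n).continuous.aestronglyMeasurable) hu'.1.1 hφu hφu' c
  · have h1 := tendsto_eLpNorm_sub_add_smul hr1
      (fun n => (continuous_gradient (hφ n)).aestronglyMeasurable)
      (hu.memLp_weakGradient hΩ.isOpen).1
      (fun n => (continuous_gradient (hφ' n)).aestronglyMeasurable)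
      (hu'.memLp_weakGradient hΩ.isOpen).1 hφG hφG' c
    refine h1.congr fun n => eLpNorm_congr_ae ?_
    filter_upwards [hu.weakGradient_add hΩ.isOpen (hu'.const_smul c),
      hu'.weakGradient_const_smul hΩ.isOpen c] with x hx hx'
    rw [hx, gradient_add_smul (hφ n) (hφ' n), Pi.add_apply, hx', Pi.smul_apply]
  · exact tendsto_eLpNorm_sub_add_smul hr1 (fun n => (hφ n).continuous.aestronglyMeasurable) hv.1
      (fun n => (hφ' n).continuous.aestronglyMeasurable) hv'.1 hφv hφv' c

theorem isTrace_of_contDiff (hΩ : IsSmoothBoundedDomain Ω) {φ : Space N → ℝ}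
    (hφ : ContDiff ℝ ∞ φ) : IsTrace Ω r φ φ := by
  refine ⟨memLp_boundary_of_continuous hΩ hφ.continuous _, fun _ => φ, fun _ => hφ, by simp, ?_,
    by simp⟩
  refine tendsto_const_nhds.congr fun n => ?_
  rw [← eLpNorm_zero (α := Space N) (ε := Space N) (p := ENNReal.ofReal r) (μ := domainMeasure Ω)]
  refine eLpNorm_congr_ae ?_
  filter_upwards [weakGradient_ae_eq_of_contDiff hΩ.isOpen hφ] with x hx
  simp [hx]

theorem MemSobolev.weakGradient_ae_eq_of_ae_eq (hΩ : IsSmoothBoundedDomain Ω) (hr : 1 ≤ r)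
    (hu : MemSobolev Ω r u) (hu' : MemSobolev Ω r u') (h : u =ᵐ[domainMeasure Ω] u') :
    weakGradient Ω u =ᵐ[domainMeasure Ω] weakGradient Ω u' :=
  (hu.hasWeakGradient.congr (MemLp.integrableOn_domain hΩ hr hu'.1).locallyIntegrableOn
    (MemLp.integrableOn_domain hΩ hr (hu.memLp_weakGradient hΩ.isOpen)).locallyIntegrableOn h
    EventuallyEq.rfl).ae_eq hΩ.isOpen hu'.hasWeakGradient

/-- Traces are unique, and depend only on the class of the function: the trace inequality applies to
the difference. -/
theorem IsTrace.ae_eq (hΩ : IsSmoothBoundedDomain Ω) (hr : 1 < r) (hu : MemSobolev Ω r u)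
    (hu' : MemSobolev Ω r u') (h : IsTrace Ω r u v) (h' : IsTrace Ω r u' v')
    (huu' : u =ᵐ[domainMeasure Ω] u') : v =ᵐ[boundaryMeasure Ω] v' := by
  obtain ⟨C, -, hC⟩ := IsTrace.eLpNorm_le (N := N) hΩ hr le_rfl one_pos
  have h1 := hC _ _ (hu.add (hu'.const_smul (-1))) (h.add_smul hΩ hr hu hu' h' (-1))
  have hz : u + (-1 : ℝ) • u' =ᵐ[domainMeasure Ω] 0 := by
    filter_upwards [huu'] with x hx
    simp [hx]
  have hz' : weakGradient Ω (u + (-1 : ℝ) • u') =ᵐ[domainMeasure Ω] 0 := by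
    filter_upwards [hu.weakGradient_add hΩ.isOpen (hu'.const_smul (-1)),
      hu'.weakGradient_const_smul hΩ.isOpen (-1),
      hu.weakGradient_ae_eq_of_ae_eq hΩ hr.le hu' huu'] with x h1 h2 h3
    rw [h1, Pi.add_apply, h2, Pi.smul_apply, h3]
    simp
  rw [eLpNorm_congr_ae hz, eLpNorm_congr_ae hz', eLpNorm_zero, eLpNorm_zero, mul_zero, mul_zero,
    add_zero, nonpos_iff_eq_zero, eLpNorm_eq_zero_iff (h.1.1.add (h'.1.1.const_smul _))
    (one_pos.trans_le (one_le_ofReal hr.le)).ne'] at h1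
  filter_upwards [h1] with x hx
  simp only [Pi.add_apply, Pi.smul_apply, smul_eq_mul, Pi.zero_apply] at hx
  linarith

theorem MemSobolev.trace_add_smul (hΩ : IsSmoothBoundedDomain Ω) (hr : 1 < r)
    (hu : MemSobolev Ω r u) (hu' : MemSobolev Ω r u') (c : ℝ) :
    trace Ω r (u + c • u') =ᵐ[boundaryMeasure Ω] trace Ω r u + c • trace Ω r u' :=
  have h := hu.add (hu'.const_smul c)
  (h.isTrace_trace hΩ hr).ae_eq hΩ hr h h
    ((hu.isTrace_trace hΩ hr).add_smul hΩ hr hu hu' (hu'.isTrace_trace hΩ hr) c) EventuallyEq.rfl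

theorem trace_ae_eq_of_contDiff (hΩ : IsSmoothBoundedDomain Ω) (hr : 1 < r) {φ : Space N → ℝ}
    (hφ : ContDiff ℝ ∞ φ) : trace Ω r φ =ᵐ[boundaryMeasure Ω] φ :=
  have h : MemSobolev Ω r φ := memSobolev_of_contDiff hΩ hφ
  (h.isTrace_trace hΩ hr).ae_eq hΩ hr h h (isTrace_of_contDiff hΩ hφ) EventuallyEq.rfl

end Trace

/-! ### Birkhoff orthogonality in `L^q` -/

section LpCalculus

variable {α E : Type*} [MeasurableSpace α] {m : Measure α} [NormedAddCommGroup E] {q : ℝ}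

theorem Lp_norm_add_rpow (hq : 1 < q) (f g : Lp E (ENNReal.ofReal q) m) :
    ‖f + g‖ ^ q = ∫ x, ‖f x + g x‖ ^ q ∂m := by
  rw [Lp_norm_rpow hq]
  refine integral_congr_ae ?_
  filter_upwards [Lp.coeFn_add f g] with x hx
  rw [hx, Pi.add_apply]

variable [InnerProductSpace ℝ E]

theorem Lp_norm_add_smul_rpow (hq : 1 < q) (f g : Lp E (ENNReal.ofReal q) m) (t : ℝ) :
    ‖f + t • g‖ ^ q = ∫ x, ‖f x + t • g x‖ ^ q ∂m := by
  rw [Lp_norm_add_rpow hq]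
  refine integral_congr_ae ?_
  filter_upwards [Lp.coeFn_smul t g] with x hx
  rw [hx, Pi.smul_apply]

theorem Lp_hasDerivAt_norm_rpow (hq : 1 < q) (f g : Lp E (ENNReal.ofReal q) m) :
    HasDerivAt (fun t : ℝ => ‖f + t • g‖ ^ q) (q * dualForm m q f g) 0 := by
  simp only [Lp_norm_add_smul_rpow hq]
  exact hasDerivAt_integral_norm_rpow hq (Lp.memLp f) (Lp.memLp g)

theorem Lp_norm_rpow_add_dualForm_le (hq : 1 < q) (f g : Lp E (ENNReal.ofReal q) m) :
    ‖f‖ ^ q + q * dualForm m q f g ≤ ‖f + g‖ ^ q := by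
  rw [Lp_norm_add_rpow hq, Lp_norm_rpow hq]
  exact integral_rpow_add_dualForm_le hq (Lp.memLp f) (Lp.memLp g)

theorem Lp_dualForm_add_right (hq : 1 < q) (f g h : Lp E (ENNReal.ofReal q) m) :
    dualForm m q f (g + h : Lp E (ENNReal.ofReal q) m) = dualForm m q f g + dualForm m q f h := by
  rw [← dualForm_add_right hq (Lp.memLp f) (Lp.memLp g) (Lp.memLp h)]
  exact dualForm_congr EventuallyEq.rfl (Lp.coeFn_add g h)

theorem Lp_dualForm_smul_right (f g : Lp E (ENNReal.ofReal q) m) (c : ℝ) :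
    dualForm m q f (c • g : Lp E (ENNReal.ofReal q) m) = c * dualForm m q f g := by
  rw [← dualForm_smul_right]
  exact dualForm_congr EventuallyEq.rfl (Lp.coeFn_smul c g)

/-- In `L^q` the Birkhoff orthogonality of `f` to `g` is the vanishing of `∫ |f|^{q-2} f g`. -/
theorem birkhoffOrth_iff_dualForm_eq_zero [Fact (1 ≤ ENNReal.ofReal q)] (hq : 1 < q)
    (f g : Lp E (ENNReal.ofReal q) m) : BirkhoffOrth g f ↔ dualForm m q f g = 0 := by
  have hq0 : 0 < q := by linarith
  constructor
  · intro h
    have hmin : IsLocalMin (fun t : ℝ => ‖f + t • g‖ ^ q) 0 := by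
      refine Eventually.of_forall fun t => ?_
      simp only [zero_smul, add_zero]
      exact Real.rpow_le_rpow (norm_nonneg _) (h t) hq0.le
    have := hmin.hasDerivAt_eq_zero (Lp_hasDerivAt_norm_rpow hq f g)
    exact (mul_eq_zero.mp this).resolve_left hq0.ne'
  · intro h c
    have h1 := Lp_norm_rpow_add_dualForm_le hq f (c • g)
    rw [Lp_dualForm_smul_right, h, mul_zero, mul_zero, add_zero] at h1
    exact (Real.rpow_le_rpow_iff (norm_nonneg _) (norm_nonneg _) hq0).mp h1

theorem eLpNorm_eq_ofReal_norm_toLp {F : Type*} [NormedAddCommGroup F] {p : ℝ≥0∞} {f : α → F}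
    (hf : MemLp f p m) : eLpNorm f p m = ENNReal.ofReal ‖hf.toLp f‖ := by
  rw [Lp.norm_toLp, ENNReal.ofReal_toReal hf.2.ne]

/-- Fatou's lemma for a sequence that converges in one Lebesgue space and is bounded in another. -/
theorem eLpNorm_le_of_tendsto {F : Type*} [NormedAddCommGroup F] {p p' : ℝ≥0∞} (hp : p ≠ 0)
    {f : ℕ → α → F} {g : α → F} (hf : ∀ n, AEStronglyMeasurable (f n) m)
    (hg : AEStronglyMeasurable g m)
    (h : Tendsto (fun n => eLpNorm (fun x => f n x - g x) p m) atTop (𝓝 0)) {K : ℝ≥0∞}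
    (hK : ∀ᶠ n in atTop, eLpNorm (f n) p' m ≤ K) : eLpNorm g p' m ≤ K := by
  obtain ⟨φ, hφ, hlim⟩ := (tendstoInMeasure_of_tendsto_eLpNorm hp hf hg h).exists_seq_tendsto_ae
  refine (Lp.eLpNorm_lim_le_liminf_eLpNorm (fun n => hf (φ n)) g hlim).trans ?_
  refine liminf_le_of_frequently_le' ?_
  exact (hφ.tendsto_atTop.eventually hK).frequently

end LpCalculus

/-! ### The weight measure -/

section Weights

variable {Ω : Set (Space N)} {a b : Space N → ℝ}

/-- The hypotheses on the weights: bounded, nonnegative and not both zero. -/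
structure AdmissibleWeights (Ω : Set (Space N)) (a b : Space N → ℝ) : Prop where
  memLp_left : MemLp a ⊤ (domainMeasure Ω)
  memLp_right : MemLp b ⊤ (boundaryMeasure Ω)
  nonneg_left : ∀ᵐ x ∂(domainMeasure Ω), 0 ≤ a x
  nonneg_right : ∀ᵐ x ∂(boundaryMeasure Ω), 0 ≤ b x
  pos : 0 < (∫ x, a x ∂(domainMeasure Ω)) + ∫ x, b x ∂(boundaryMeasure Ω)

/-- The measure `a dx + b dσ` on the closure of the domain. -/
def weightMeasure (Ω : Set (Space N)) (a b : Space N → ℝ) : Measure (Space N) :=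
  (domainMeasure Ω).withDensity (fun x => ENNReal.ofReal (a x)) +
    (boundaryMeasure Ω).withDensity (fun x => ENNReal.ofReal (b x))

theorem withDensity_le_smul {α : Type*} [MeasurableSpace α] (m : Measure α) (f : α → ℝ) :
    m.withDensity (fun x => ENNReal.ofReal (f x)) ≤ eLpNorm f ⊤ m • m := by
  rw [← withDensity_const]
  refine withDensity_mono ?_
  rw [eLpNorm_exponent_top]
  filter_upwards [ae_le_eLpNormEssSup (f := f) (μ := m)] with x hx
  refine le_trans ?_ hx
  rw [← ofReal_norm]
  exact ENNReal.ofReal_le_ofReal (le_abs_self _)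

theorem AdmissibleWeights.weightMeasure_le (h : AdmissibleWeights Ω a b) :
    ∃ K : ℝ≥0∞, K ≠ ⊤ ∧ weightMeasure Ω a b ≤ K • (domainMeasure Ω + boundaryMeasure Ω) := by
  refine ⟨eLpNorm a ⊤ (domainMeasure Ω) + eLpNorm b ⊤ (boundaryMeasure Ω),
    ENNReal.add_ne_top.mpr ⟨h.memLp_left.2.ne, h.memLp_right.2.ne⟩, ?_⟩
  rw [smul_add]
  refine add_le_add ((withDensity_le_smul _ a).trans ?_)
    ((withDensity_le_smul _ b).trans ?_)
  · exact Measure.le_iff.mpr fun s _ => by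
      simp only [Measure.smul_apply, smul_eq_mul]
      gcongr
      exact le_self_add
  · exact Measure.le_iff.mpr fun s _ => by
      simp only [Measure.smul_apply, smul_eq_mul]
      gcongr
      exact le_add_self

theorem ae_weightMeasure {P : Space N → Prop} (h : ∀ᵐ x ∂(domainMeasure Ω), P x)
    (h' : ∀ᵐ x ∂(boundaryMeasure Ω), P x) : ∀ᵐ x ∂(weightMeasure Ω a b), P x :=
  ae_add_measure_iff.mpr ⟨(withDensity_absolutelyContinuous _ _).ae_le h,
    (withDensity_absolutelyContinuous _ _).ae_le h'⟩

theorem integrable_withDensity {α : Type*} [MeasurableSpace α] {m : Measure α} {f h : α → ℝ}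
    (hf : MemLp f ⊤ m) (hh : Integrable h m) :
    Integrable h (m.withDensity fun x => ENNReal.ofReal (f x)) :=
  hh.of_measure_le_smul hf.2.ne (withDensity_le_smul _ f)

theorem integral_withDensity_ofReal {α : Type*} [MeasurableSpace α] {m : Measure α} {f h : α → ℝ}
    (hf : MemLp f ⊤ m) (hf0 : ∀ᵐ x ∂m, 0 ≤ f x) :
    ∫ x, h x ∂(m.withDensity fun x => ENNReal.ofReal (f x)) = ∫ x, f x * h x ∂m := by
  rw [integral_withDensity_eq_integral_toReal_smul₀ hf.1.aemeasurable.ennreal_ofReal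
    (ae_of_all _ fun x => ENNReal.ofReal_lt_top)]
  refine integral_congr_ae ?_
  filter_upwards [hf0] with x hx
  rw [ENNReal.toReal_ofReal hx, smul_eq_mul]

/-- An integral for the weight measure splits into its interior and boundary parts; `k₁` and `k₂` are
the representatives used on each of them. -/
theorem AdmissibleWeights.integral_weightMeasure (h : AdmissibleWeights Ω a b)
    {k k₁ k₂ : Space N → ℝ} (h₁ : k =ᵐ[domainMeasure Ω] k₁) (h₂ : k =ᵐ[boundaryMeasure Ω] k₂)
    (hk₁ : Integrable k₁ (domainMeasure Ω)) (hk₂ : Integrable k₂ (boundaryMeasure Ω)) :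
    ∫ x, k x ∂(weightMeasure Ω a b) =
      (∫ x, a x * k₁ x ∂(domainMeasure Ω)) + ∫ x, b x * k₂ x ∂(boundaryMeasure Ω) := by
  rw [weightMeasure, integral_add_measure
    (integrable_withDensity h.memLp_left (hk₁.congr h₁.symm))
    (integrable_withDensity h.memLp_right (hk₂.congr h₂.symm)),
    integral_withDensity_ofReal h.memLp_left h.nonneg_left,
    integral_withDensity_ofReal h.memLp_right h.nonneg_right]
  congr 1
  · refine integral_congr_ae ?_
    filter_upwards [h₁] with x hx
    rw [hx]
  · refine integral_congr_ae ?_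
    filter_upwards [h₂] with x hx
    rw [hx]

theorem AdmissibleWeights.isFiniteMeasure (hΩ : IsSmoothBoundedDomain Ω)
    (h : AdmissibleWeights Ω a b) : IsFiniteMeasure (weightMeasure Ω a b) := by
  have := hΩ.isFiniteMeasure
  have := hΩ.isFiniteMeasure_boundary
  obtain ⟨K, hK, hle⟩ := h.weightMeasure_le
  refine ⟨(hle _).trans_lt ?_⟩
  rw [Measure.smul_apply, smul_eq_mul]
  exact ENNReal.mul_lt_top hK.lt_top (measure_lt_top _ _)

theorem AdmissibleWeights.weightMeasure_ne_zero (hΩ : IsSmoothBoundedDomain Ω)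
    (h : AdmissibleWeights Ω a b) : weightMeasure Ω a b ≠ 0 := by
  have := hΩ.isFiniteMeasure
  have := hΩ.isFiniteMeasure_boundary
  intro h0
  have h1 := h.integral_weightMeasure (k := fun _ => 1) EventuallyEq.rfl EventuallyEq.rfl
    (integrable_const 1) (integrable_const 1)
  simp only [h0, integral_zero_measure, mul_one] at h1
  exact h.pos.ne h1

theorem eLpNorm_add_measure_le {α F : Type*} [MeasurableSpace α] [NormedAddCommGroup F]
    {m m' : Measure α} {s : ℝ} (hs : 1 ≤ s) (f : α → F) :
    eLpNorm f (ENNReal.ofReal s) (m + m') ≤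
      eLpNorm f (ENNReal.ofReal s) m + eLpNorm f (ENNReal.ofReal s) m' := by
  rw [eLpNorm_ofReal hs, eLpNorm_ofReal hs, eLpNorm_ofReal hs, lintegral_add_measure]
  refine ENNReal.rpow_add_le_add_rpow _ _ (by positivity) ?_
  rw [div_le_one (by linarith)]
  exact hs

theorem AdmissibleWeights.eLpNorm_weightMeasure_le (h : AdmissibleWeights Ω a b) {s : ℝ}
    (hs : 1 ≤ s) : ∃ K : ℝ≥0∞, K ≠ ⊤ ∧ ∀ f : Space N → ℝ,
      eLpNorm f (ENNReal.ofReal s) (weightMeasure Ω a b) ≤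
        K * (eLpNorm f (ENNReal.ofReal s) (domainMeasure Ω) +
          eLpNorm f (ENNReal.ofReal s) (boundaryMeasure Ω)) := by
  obtain ⟨K, hK, hle⟩ := h.weightMeasure_le
  refine ⟨_, ENNReal.rpow_ne_top_of_nonneg (y := (1 / ENNReal.ofReal s).toReal) ?_ hK, fun f => ?_⟩
  · exact ENNReal.toReal_nonneg
  · refine (eLpNorm_le_of_measure_le_smul hle).trans ?_
    rw [smul_eq_mul]
    gcongr
    exact eLpNorm_add_measure_le hs f

open Classical in
/-- A Sobolev function, extended to the boundary by its trace. -/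
def jointValue (Ω : Set (Space N)) (r : ℝ) (u : Space N → ℝ) : Space N → ℝ :=
  Ω.piecewise u (trace Ω r u)

variable {r : ℝ} {u w : Space N → ℝ}

theorem jointValue_ae_domain (hΩ : IsSmoothBoundedDomain Ω) :
    jointValue Ω r u =ᵐ[domainMeasure Ω] u := by
  filter_upwards [ae_restrict_mem hΩ.isOpen.measurableSet] with x hx
  classical exact Set.piecewise_eq_of_mem _ _ _ hx

theorem jointValue_ae_boundary (hΩ : IsSmoothBoundedDomain Ω) :
    jointValue Ω r u =ᵐ[boundaryMeasure Ω] trace Ω r u := by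
  filter_upwards [ae_mem_frontier (Ω := Ω)] with x hx
  rw [hΩ.isOpen.frontier_eq] at hx
  classical exact Set.piecewise_eq_of_notMem _ _ _ hx.2

theorem jointValue_add_smul (hΩ : IsSmoothBoundedDomain Ω) (hr : 1 < r) (hu : MemSobolev Ω r u)
    (hw : MemSobolev Ω r w) (c : ℝ) :
    jointValue Ω r (u + c • w) =ᵐ[weightMeasure Ω a b] jointValue Ω r u + c • jointValue Ω r w := by
  refine ae_weightMeasure ?_ ?_
  · filter_upwards [jointValue_ae_domain (r := r) (u := u + c • w) hΩ,
      jointValue_ae_domain (r := r) (u := u) hΩ, jointValue_ae_domain (r := r) (u := w) hΩ]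
      with x h1 h2 h3
    simp only [h1, h2, h3, Pi.add_apply, Pi.smul_apply]
  · filter_upwards [jointValue_ae_boundary (r := r) (u := u + c • w) hΩ,
      jointValue_ae_boundary (r := r) (u := u) hΩ, jointValue_ae_boundary (r := r) (u := w) hΩ,
      hu.trace_add_smul hΩ hr hw c] with x h1 h2 h3 h4
    simp only [h1, h2, h3, h4, Pi.add_apply, Pi.smul_apply]

theorem jointValue_of_contDiff (hΩ : IsSmoothBoundedDomain Ω) (hr : 1 < r) {φ : Space N → ℝ}
    (hφ : ContDiff ℝ ∞ φ) : jointValue Ω r φ =ᵐ[weightMeasure Ω a b] φ :=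
  ae_weightMeasure (jointValue_ae_domain hΩ)
    ((jointValue_ae_boundary hΩ).trans (trace_ae_eq_of_contDiff hΩ hr hφ))

theorem MemSobolev.memLp_trace (hΩ : IsSmoothBoundedDomain Ω) (hr : 1 < r) {q : ℝ} (hqr : q ≤ r)
    (hu : MemSobolev Ω r u) : MemLp (trace Ω r u) (ENNReal.ofReal q) (boundaryMeasure Ω) := by
  have := hΩ.isFiniteMeasure_boundary
  exact (hu.isTrace_trace hΩ hr).1.mono_exponent (ENNReal.ofReal_le_ofReal hqr)

theorem MemSobolev.memLp_jointValue (hΩ : IsSmoothBoundedDomain Ω) (hab : AdmissibleWeights Ω a b)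
    {q : ℝ} (hq : 1 < q) (hqr : q ≤ r) (hu : MemSobolev Ω r u) :
    MemLp (jointValue Ω r u) (ENNReal.ofReal q) (weightMeasure Ω a b) := by
  have h1 : MemLp (jointValue Ω r u) (ENNReal.ofReal q) (domainMeasure Ω) :=
    (memLp_congr_ae (jointValue_ae_domain hΩ)).mpr (hu.of_exponent_le hΩ hqr).1
  have h2 : MemLp (jointValue Ω r u) (ENNReal.ofReal q) (boundaryMeasure Ω) :=
    (memLp_congr_ae (jointValue_ae_boundary hΩ)).mpr (hu.memLp_trace hΩ (hq.trans_le hqr) hqr)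
  obtain ⟨K, hK, hle⟩ := hab.weightMeasure_le
  exact MemLp.of_measure_le_smul hK hle ⟨h1.1.add_measure h2.1,
    (eLpNorm_add_measure_le hq.le _).trans_lt (ENNReal.add_lt_top.mpr ⟨h1.2, h2.2⟩)⟩

end Weights

/-! ### The operators of the problem -/

section Operators

variable {Ω : Set (Space N)} {a b : Space N → ℝ} {p q r s : ℝ}

/-- The Sobolev space `W^{1,r}(Ω)` as a space of functions (not of classes of functions). -/
def sobolevSpace (Ω : Set (Space N)) (r : ℝ) : Submodule ℝ (Space N → ℝ) where
  carrier := {u | MemSobolev Ω r u}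
  add_mem' h h' := h.add h'
  zero_mem' := ⟨MemLp.zero, 0, hasWeakGradient_const 0, MemLp.zero⟩
  smul_mem' c _ h := h.const_smul c

/-- The linear map given by a function that is compatible with the combinations `u + c • w`. -/
def linearMapOfAddSMul {V Y : Type*} [AddCommGroup V] [Module ℝ V] [AddCommGroup Y] [Module ℝ Y]
    (f : V → Y) (hf : ∀ u w (c : ℝ), f (u + c • w) = f u + c • f w) : V →ₗ[ℝ] Y where
  toFun := f
  map_add' u w := by simpa using hf u w 1
  map_smul' c w := by
    have h0 : f 0 = 0 := by simpa using hf 0 0 1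
    simpa [h0] using hf 0 w c

/-- The inclusion of `W^{1,r}(Ω)` into `L^s(Ω)` for `s ≤ r`. -/
def valueMap (hΩ : IsSmoothBoundedDomain Ω) (hsr : s ≤ r) :
    sobolevSpace Ω r →ₗ[ℝ] Lp ℝ (ENNReal.ofReal s) (domainMeasure Ω) :=
  linearMapOfAddSMul (fun u => (MemSobolev.of_exponent_le hΩ hsr u.2).1.toLp _) fun u w c => by
    rw [← MemLp.toLp_const_smul, ← MemLp.toLp_add]
    rfl

theorem MemSobolev.memLp_weakGradient_of_le (hΩ : IsSmoothBoundedDomain Ω) (hsr : s ≤ r)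
    {u : Space N → ℝ} (hu : MemSobolev Ω r u) :
    MemLp (weakGradient Ω u) (ENNReal.ofReal s) (domainMeasure Ω) :=
  (hu.of_exponent_le hΩ hsr).memLp_weakGradient hΩ.isOpen

/-- The weak gradient as an operator from `W^{1,r}(Ω)` to `L^s(Ω)` for `s ≤ r`. -/
def gradMap (hΩ : IsSmoothBoundedDomain Ω) (hsr : s ≤ r) :
    sobolevSpace Ω r →ₗ[ℝ] Lp (Space N) (ENNReal.ofReal s) (domainMeasure Ω) :=
  linearMapOfAddSMul (fun u => (MemSobolev.memLp_weakGradient_of_le hΩ hsr u.2).toLp _)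
    fun u w c => by
    rw [← MemLp.toLp_const_smul, ← MemLp.toLp_add, MemLp.toLp_eq_toLp_iff]
    have hu : MemSobolev Ω r u := u.2
    have hw : MemSobolev Ω r w := w.2
    filter_upwards [hu.weakGradient_add hΩ.isOpen (hw.const_smul c),
      hw.weakGradient_const_smul hΩ.isOpen c] with x h1 h2
    change weakGradient Ω ((u : Space N → ℝ) + c • (w : Space N → ℝ)) x = _
    rw [h1, Pi.add_apply, h2, Pi.add_apply]

/-- Interior and boundary values as an operator from `W^{1,r}(Ω)` to `L^q` of the weight measure. -/
def weightMap (hΩ : IsSmoothBoundedDomain Ω) (hab : AdmissibleWeights Ω a b) (hq : 1 < q)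
    (hqr : q ≤ r) : sobolevSpace Ω r →ₗ[ℝ] Lp ℝ (ENNReal.ofReal q) (weightMeasure Ω a b) :=
  linearMapOfAddSMul (fun u => (MemSobolev.memLp_jointValue hΩ hab hq hqr u.2).toLp _)
    fun u w c => by
    rw [← MemLp.toLp_const_smul, ← MemLp.toLp_add, MemLp.toLp_eq_toLp_iff]
    exact jointValue_add_smul hΩ (hq.trans_le hqr) u.2 w.2 c

theorem coeFn_gradMap (hΩ : IsSmoothBoundedDomain Ω) (hsr : s ≤ r) (u : sobolevSpace Ω r) :
    gradMap hΩ hsr u =ᵐ[domainMeasure Ω] weakGradient Ω u :=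
  (MemSobolev.memLp_weakGradient_of_le hΩ hsr u.2).coeFn_toLp

theorem coeFn_weightMap (hΩ : IsSmoothBoundedDomain Ω) (hab : AdmissibleWeights Ω a b) (hq : 1 < q)
    (hqr : q ≤ r) (u : sobolevSpace Ω r) :
    weightMap hΩ hab hq hqr u =ᵐ[weightMeasure Ω a b] jointValue Ω r u :=
  (MemSobolev.memLp_jointValue hΩ hab hq hqr u.2).coeFn_toLp

theorem eLpNorm_eq_valueMap (hΩ : IsSmoothBoundedDomain Ω) (hsr : s ≤ r) (u : sobolevSpace Ω r) :
    eLpNorm (u : Space N → ℝ) (ENNReal.ofReal s) (domainMeasure Ω) =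
      ENNReal.ofReal ‖valueMap hΩ hsr u‖ :=
  eLpNorm_eq_ofReal_norm_toLp (MemSobolev.of_exponent_le hΩ hsr u.2).1

theorem eLpNorm_eq_gradMap (hΩ : IsSmoothBoundedDomain Ω) (hsr : s ≤ r) (u : sobolevSpace Ω r) :
    eLpNorm (weakGradient Ω u) (ENNReal.ofReal s) (domainMeasure Ω) =
      ENNReal.ofReal ‖gradMap hΩ hsr u‖ :=
  eLpNorm_eq_ofReal_norm_toLp (MemSobolev.memLp_weakGradient_of_le hΩ hsr u.2)

theorem eLpNorm_eq_weightMap (hΩ : IsSmoothBoundedDomain Ω) (hab : AdmissibleWeights Ω a b)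
    (hq : 1 < q) (hqr : q ≤ r) (u : sobolevSpace Ω r) :
    eLpNorm (jointValue Ω r u) (ENNReal.ofReal q) (weightMeasure Ω a b) =
      ENNReal.ofReal ‖weightMap hΩ hab hq hqr u‖ :=
  eLpNorm_eq_ofReal_norm_toLp (MemSobolev.memLp_jointValue hΩ hab hq hqr u.2)

/-- The constant function one as an element of the Sobolev space. -/
def constOne (hΩ : IsSmoothBoundedDomain Ω) (r : ℝ) : sobolevSpace Ω r :=
  ⟨fun _ => 1, memSobolev_of_contDiff hΩ contDiff_const⟩

theorem gradMap_constOne (hΩ : IsSmoothBoundedDomain Ω) (hsr : s ≤ r) :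
    gradMap hΩ hsr (constOne hΩ r) = 0 := by
  refine Lp.ext ?_
  filter_upwards [coeFn_gradMap hΩ hsr (constOne hΩ r), weakGradient_const_ae_eq hΩ.isOpen 1,
    Lp.coeFn_zero (Space N) (ENNReal.ofReal s) (domainMeasure Ω)] with x h1 h2 h3
  rw [h1, h3]
  exact h2

theorem coeFn_weightMap_constOne (hΩ : IsSmoothBoundedDomain Ω) (hab : AdmissibleWeights Ω a b)
    (hq : 1 < q) (hqr : q ≤ r) :
    weightMap hΩ hab hq hqr (constOne hΩ r) =ᵐ[weightMeasure Ω a b] fun _ => 1 :=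
  (coeFn_weightMap hΩ hab hq hqr _).trans
    (jointValue_of_contDiff hΩ (hq.trans_le hqr) contDiff_const)

theorem gradMap_sub_smul_constOne (hΩ : IsSmoothBoundedDomain Ω) (hsr : s ≤ r)
    (u : sobolevSpace Ω r) (c : ℝ) : gradMap hΩ hsr (u - c • constOne hΩ r) = gradMap hΩ hsr u := by
  rw [map_sub, map_smul, gradMap_constOne, smul_zero, sub_zero]

theorem exists_ae_eq_const_of_gradMap_eq_zero (hΩ : IsSmoothBoundedDomain Ω) (hs : 1 ≤ s)
    (hsr : s ≤ r) {u : sobolevSpace Ω r} (h : gradMap hΩ hsr u = 0) :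
    ∃ c : ℝ, (u : Space N → ℝ) =ᵐ[domainMeasure Ω] fun _ => c := by
  have hu : MemSobolev Ω r u := u.2
  refine exists_ae_eq_const hΩ hs hu.hasWeakGradient (hu.of_exponent_le hΩ hsr).1 ?_
  filter_upwards [coeFn_gradMap hΩ hsr u, Lp.coeFn_zero (Space N) (ENNReal.ofReal s)
    (domainMeasure Ω)] with x h1 h2
  rw [← h1, h, h2]

theorem valueMap_norm_le (hΩ : IsSmoothBoundedDomain Ω) (hs : 1 ≤ s) (hsr : s ≤ r) :
    ∃ C : ℝ, 0 ≤ C ∧ ∀ u : sobolevSpace Ω r, ‖valueMap hΩ hsr u‖ ≤ C * ‖valueMap hΩ le_rfl u‖ := by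
  have := hΩ.isFiniteMeasure
  set K := domainMeasure Ω Set.univ ^
    (1 / (ENNReal.ofReal s).toReal - 1 / (ENNReal.ofReal r).toReal) with hK
  have : Fact (1 ≤ ENNReal.ofReal r) := ⟨one_le_ofReal (hs.trans hsr)⟩
  have hs0 : 0 < s := by linarith
  have hKt : K ≠ ⊤ := by
    refine ENNReal.rpow_ne_top_of_nonneg ?_ (measure_ne_top _ _)
    rw [ENNReal.toReal_ofReal hs0.le, ENNReal.toReal_ofReal (hs0.le.trans hsr), sub_nonneg]
    exact one_div_le_one_div_of_le hs0 hsr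
  refine ⟨K.toReal, ENNReal.toReal_nonneg, fun u => ?_⟩
  have hu : MemSobolev Ω r u := u.2
  have h1 := eLpNorm_le_eLpNorm_mul_rpow_measure_univ (ENNReal.ofReal_le_ofReal hsr) hu.1.1
  rw [← hK, eLpNorm_eq_valueMap hΩ hsr, eLpNorm_eq_valueMap hΩ le_rfl, ← ENNReal.ofReal_toReal hKt,
    ← ENNReal.ofReal_mul (norm_nonneg _), mul_comm] at h1
  exact (ENNReal.ofReal_le_ofReal_iff (by positivity)).mp h1

theorem exists_valueMap_sub_le (hΩ : IsSmoothBoundedDomain Ω) (hs : 1 ≤ s) (hsr : s ≤ r) :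
    ∃ C : ℝ, 0 ≤ C ∧ ∀ u : sobolevSpace Ω r, ∃ c : ℝ,
      ‖valueMap hΩ hsr (u - c • constOne hΩ r)‖ ≤ C * ‖gradMap hΩ hsr u‖ := by
  have : Fact (1 ≤ ENNReal.ofReal s) := ⟨one_le_ofReal hs⟩
  obtain ⟨C, hC, h⟩ := poincare hΩ hs
  refine ⟨C, hC, fun u => ?_⟩
  have hu : MemSobolev Ω r u := u.2
  obtain ⟨c, hc⟩ := h u _ hu.hasWeakGradient (hu.of_exponent_le hΩ hsr).1
    (hu.memLp_weakGradient_of_le hΩ hsr)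
  refine ⟨c, ?_⟩
  have e : (fun x => (u : Space N → ℝ) x - c) = ((u - c • constOne hΩ r : sobolevSpace Ω r) :
      Space N → ℝ) := by
    ext x; simp [constOne]
  rw [e, eLpNorm_eq_valueMap hΩ hsr, eLpNorm_eq_gradMap hΩ hsr, ← ENNReal.ofReal_mul hC] at hc
  exact (ENNReal.ofReal_le_ofReal_iff (by positivity)).mp hc

section Estimates

variable [Fact (1 ≤ ENNReal.ofReal q)]

/-- The trace inequality for the joint values, with an arbitrarily small factor in front of the
gradient. -/
theorem weightMap_norm_le (hΩ : IsSmoothBoundedDomain Ω) (hab : AdmissibleWeights Ω a b)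
    (hq : 1 < q) (hqr : q ≤ r) {ε : ℝ} (hε : 0 < ε) :
    ∃ C : ℝ, 0 ≤ C ∧ ∀ u : sobolevSpace Ω r, ‖weightMap hΩ hab hq hqr u‖ ≤
      C * ‖valueMap hΩ hqr u‖ + ε * ‖gradMap hΩ hqr u‖ := by
  obtain ⟨K, hK, hKle⟩ := hab.eLpNorm_weightMeasure_le hq.le
  obtain ⟨k, hk0, rfl⟩ : ∃ k : ℝ, 0 ≤ k ∧ K = ENNReal.ofReal k :=
    ⟨K.toReal, ENNReal.toReal_nonneg, (ENNReal.ofReal_toReal hK).symm⟩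
  obtain ⟨C, hC, htr⟩ := IsTrace.eLpNorm_le hΩ hq hqr (div_pos hε (show 0 < k + 1 by linarith))
  refine ⟨k * (1 + C), by positivity, fun u => ?_⟩
  have hu : MemSobolev Ω r u := u.2
  have h1 := htr u _ hu (hu.isTrace_trace hΩ (hq.trans_le hqr))
  have h2 := hKle (jointValue Ω r u)
  rw [eLpNorm_congr_ae (jointValue_ae_domain hΩ), eLpNorm_congr_ae (jointValue_ae_boundary hΩ)] at h2
  have h3 := h2.trans (mul_le_mul_right (add_le_add_right h1 _) _)
  have hg := norm_nonneg (gradMap hΩ hqr u)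
  have hv := norm_nonneg (valueMap hΩ hqr u)
  rw [eLpNorm_eq_weightMap hΩ hab hq hqr, eLpNorm_eq_valueMap hΩ hqr, eLpNorm_eq_gradMap hΩ hqr,
    ← ENNReal.ofReal_mul hC, ← ENNReal.ofReal_mul (by positivity),
    ← ENNReal.ofReal_add (by positivity) (by positivity),
    ← ENNReal.ofReal_add (by positivity) (by positivity), ← ENNReal.ofReal_mul hk0] at h3
  have h4 := (ENNReal.ofReal_le_ofReal_iff (by positivity)).mp h3
  have h5 : k * (ε / (k + 1)) ≤ ε := by
    rw [mul_div_assoc', div_le_iff₀ (by linarith)]; nlinarith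
  nlinarith [mul_le_mul_of_nonneg_right h5 hg]

/-- On the cone of functions with values orthogonal to the constants, the gradient controls the
values. -/
theorem exists_weightMap_le_gradMap (hΩ : IsSmoothBoundedDomain Ω) (hab : AdmissibleWeights Ω a b)
    (hq : 1 < q) (hqr : q ≤ r) : ∃ C : ℝ, 0 ≤ C ∧ ∀ u : sobolevSpace Ω r,
      BirkhoffOrth (weightMap hΩ hab hq hqr (constOne hΩ r)) (weightMap hΩ hab hq hqr u) →
        ‖weightMap hΩ hab hq hqr u‖ ≤ C * ‖gradMap hΩ hqr u‖ := by
  obtain ⟨C₁, hC₁, h₁⟩ := weightMap_norm_le hΩ hab hq hqr one_pos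
  obtain ⟨C₂, hC₂, h₂⟩ := exists_valueMap_sub_le hΩ hq.le hqr
  refine ⟨C₁ * C₂ + 1, by positivity, fun u hu => ?_⟩
  obtain ⟨c, hc⟩ := h₂ u
  have h3 := hu (-c)
  rw [neg_smul, ← sub_eq_add_neg, ← map_smul, ← map_sub] at h3
  have h4 := h₁ (u - c • constOne hΩ r)
  rw [gradMap_sub_smul_constOne] at h4
  nlinarith [mul_le_mul_of_nonneg_left hc hC₁]

/-- A Sobolev function that is constant in the domain has the same constant boundary values. -/
theorem weightMap_eq_smul_of_ae_eq_const (hΩ : IsSmoothBoundedDomain Ω)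
    (hab : AdmissibleWeights Ω a b) (hq : 1 < q) (hqr : q ≤ r) {u : sobolevSpace Ω r} {c : ℝ}
    (h : (u : Space N → ℝ) =ᵐ[domainMeasure Ω] fun _ => c) :
    weightMap hΩ hab hq hqr u = c • weightMap hΩ hab hq hqr (constOne hΩ r) := by
  obtain ⟨C, hC, h₁⟩ := weightMap_norm_le hΩ hab hq hqr one_pos
  have h2 := h₁ (u - c • constOne hΩ r)
  have hz : ((u - c • constOne hΩ r : sobolevSpace Ω r) : Space N → ℝ) =ᵐ[domainMeasure Ω]
      fun _ => 0 := by
    filter_upwards [h] with x hx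
    simp [constOne, hx]
  have hm : MemSobolev Ω r (u - c • constOne hΩ r : sobolevSpace Ω r) := Subtype.property _
  have hz' := hm.weakGradient_ae_eq_of_ae_eq hΩ (hq.le.trans hqr)
    (memSobolev_of_contDiff hΩ contDiff_const) hz
  have e1 : ‖valueMap hΩ hqr (u - c • constOne hΩ r)‖ = 0 := by
    rw [← ENNReal.ofReal_eq_zero.trans (norm_le_zero_iff.trans norm_eq_zero.symm),
      ← eLpNorm_eq_valueMap hΩ hqr, eLpNorm_congr_ae hz]
    simp
  have e2 : ‖gradMap hΩ hqr (u - c • constOne hΩ r)‖ = 0 := by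
    rw [← ENNReal.ofReal_eq_zero.trans (norm_le_zero_iff.trans norm_eq_zero.symm),
      ← eLpNorm_eq_gradMap hΩ hqr, eLpNorm_congr_ae (hz'.trans (weakGradient_const_ae_eq hΩ.isOpen 0))]
    simp
  rw [e1, e2, mul_zero, mul_zero, add_zero, map_sub, map_smul] at h2
  exact sub_eq_zero.mp (norm_le_zero_iff.mp h2)

theorem weightMap_constOne_ne_zero (hΩ : IsSmoothBoundedDomain Ω) (hab : AdmissibleWeights Ω a b)
    (hq : 1 < q) (hqr : q ≤ r) : weightMap hΩ hab hq hqr (constOne hΩ r) ≠ 0 := by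
  have := hab.isFiniteMeasure hΩ
  intro h
  have h1 := Lp_norm_rpow hq (weightMap hΩ hab hq hqr (constOne hΩ r))
  rw [h, norm_zero, Real.zero_rpow (by linarith), ← h] at h1
  have h2 : ∫ x, ‖weightMap hΩ hab hq hqr (constOne hΩ r) x‖ ^ q ∂(weightMeasure Ω a b) =
      ∫ _x, (1 : ℝ) ∂(weightMeasure Ω a b) := by
    refine integral_congr_ae ?_
    filter_upwards [coeFn_weightMap_constOne hΩ hab hq hqr] with x hx
    rw [hx, norm_one, Real.one_rpow]
  rw [h2, integral_const, smul_eq_mul, mul_one] at h1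
  have h3 := (measureReal_eq_zero_iff (measure_ne_top _ _)).mp h1.symm
  exact hab.weightMeasure_ne_zero hΩ (Measure.measure_univ_eq_zero.mp h3)

/-- An element of the cone with vanishing gradient vanishes. -/
theorem ae_eq_zero_of_birkhoffOrth (hΩ : IsSmoothBoundedDomain Ω) (hab : AdmissibleWeights Ω a b)
    (hq : 1 < q) (hqr : q ≤ r) (hs : 1 ≤ s) (hsr : s ≤ r) {u : sobolevSpace Ω r}
    (hu : BirkhoffOrth (weightMap hΩ hab hq hqr (constOne hΩ r)) (weightMap hΩ hab hq hqr u))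
    (h : gradMap hΩ hsr u = 0) : (u : Space N → ℝ) =ᵐ[domainMeasure Ω] 0 := by
  obtain ⟨c, hc⟩ := exists_ae_eq_const_of_gradMap_eq_zero hΩ hs hsr h
  rw [weightMap_eq_smul_of_ae_eq_const hΩ hab hq hqr hc] at hu
  have h0 := (smul_eq_zero.mp hu.eq_zero).resolve_right (weightMap_constOne_ne_zero hΩ hab hq hqr)
  rw [h0] at hc
  exact hc

end Estimates

end Operators

/-! ### Compactness on the cone -/

section ConeCompactness

/-- If `B` is bounded by `J` up to an arbitrarily small multiple of `D`, then `B` tends to zero along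
with `J` on sets where `D` is bounded. -/
theorem tendsto_zero_of_norm_le {V X Y Z ι : Type*} [AddCommGroup V] [Module ℝ V]
    [NormedAddCommGroup X] [NormedSpace ℝ X] [NormedAddCommGroup Y] [NormedSpace ℝ Y]
    [NormedAddCommGroup Z] [NormedSpace ℝ Z] {J : V →ₗ[ℝ] X} {D : V →ₗ[ℝ] Z} {B : V →ₗ[ℝ] Y}
    (h : ∀ ε : ℝ, 0 < ε → ∃ C : ℝ, 0 ≤ C ∧ ∀ u, ‖B u‖ ≤ C * ‖J u‖ + ε * ‖D u‖) {l : Filter ι}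
    {u : ι → V} {M : ℝ} (hD : ∀ i, ‖D (u i)‖ ≤ M)
    (hJ : Tendsto (fun i => ‖J (u i)‖) l (𝓝 0)) : Tendsto (fun i => ‖B (u i)‖) l (𝓝 0) := by
  refine tendsto_order.mpr ⟨fun η hη => Eventually.of_forall fun i => hη.trans_le (norm_nonneg _),
    fun η hη => ?_⟩
  have hM : 0 < |M| + 1 := by positivity
  obtain ⟨C, hC, hle⟩ := h (η / (2 * (|M| + 1))) (by positivity)
  have h1 := hJ.const_mul C
  rw [mul_zero] at h1
  filter_upwards [h1.eventually_lt_const (half_pos hη)] with i hi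
  have h2 : η / (2 * (|M| + 1)) * ‖D (u i)‖ ≤ η / 2 := by
    have : ‖D (u i)‖ ≤ |M| + 1 := (hD i).trans (by linarith [le_abs_self M])
    calc η / (2 * (|M| + 1)) * ‖D (u i)‖ ≤ η / (2 * (|M| + 1)) * (|M| + 1) := by gcongr
      _ = η / 2 := by field_simp
  linarith [hle (u i)]

variable {Ω : Set (Space N)} {a b : Space N → ℝ} {p q r : ℝ}

/-- Compactness for the three operators of the problem: Poincaré's inequality and the trace
inequality bound the sequence in the Sobolev space, Rellich's theorem gives a limit of the values,
and, the gradients being bounded, the trace inequality with a small factor turns the convergence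
of the values into that of the traces. -/
theorem coneCompact (hΩ : IsSmoothBoundedDomain Ω) (hab : AdmissibleWeights Ω a b)
    [Fact (1 ≤ ENNReal.ofReal p)] [Fact (1 ≤ ENNReal.ofReal q)]
    (hp : 1 < p) (hq : 1 < q) (hpr : p ≤ r) (hqr : q ≤ r) (hr : r = p ∨ r = q) :
    ConeCompact (gradMap hΩ hpr) (gradMap hΩ hqr) (weightMap hΩ hab hq hqr)
      (weightMap hΩ hab hq hqr (constOne hΩ r)) := by
  intro v horth M hA hD
  have hr1 : 1 ≤ r := hp.le.trans hpr
  have : Fact (1 ≤ ENNReal.ofReal r) := ⟨one_le_ofReal hr1⟩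
  have hv : ∀ n, MemSobolev Ω r (v n) := fun n => (v n).2
  set B := weightMap hΩ hab hq hqr
  set D := gradMap hΩ hqr
  set e := constOne hΩ r
  have hM0 : 0 ≤ M := (norm_nonneg _).trans (hA 0)
  have hGr : ∀ n, eLpNorm (weakGradient Ω (v n)) (ENNReal.ofReal r) (domainMeasure Ω) ≤
      ENNReal.ofReal M := fun n => by
    rcases hr with h | h
    · have e1 : ENNReal.ofReal r = ENNReal.ofReal p := by rw [h]
      rw [e1, eLpNorm_eq_gradMap hΩ hpr]
      exact ENNReal.ofReal_le_ofReal (hA n)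
    · have e1 : ENNReal.ofReal r = ENNReal.ofReal q := by rw [h]
      rw [e1, eLpNorm_eq_gradMap hΩ hqr]
      exact ENNReal.ofReal_le_ofReal (hD n)
  have hR : ∀ n, ‖gradMap hΩ le_rfl (v n)‖ ≤ M := fun n => by
    have := hGr n
    rw [eLpNorm_eq_gradMap hΩ le_rfl] at this
    exact (ENNReal.ofReal_le_ofReal_iff hM0).mp this
  -- Poincaré's inequality bounds `v n - c n`, and then the orthogonality of `B (v n)` to the
  -- constants bounds `c n`
  obtain ⟨C₁, hC₁, h₁⟩ := exists_valueMap_sub_le hΩ hr1 (le_refl r)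
  obtain ⟨C₂, hC₂, h₂⟩ := valueMap_norm_le hΩ hq.le hqr
  obtain ⟨C₃, hC₃, h₃⟩ := weightMap_norm_le hΩ hab hq hqr one_pos
  choose c hc using fun n => h₁ (v n)
  set L := C₃ * (C₂ * (C₁ * M)) + 1 * M with hL
  have hJz : ∀ n, ‖valueMap hΩ le_rfl (v n - c n • e)‖ ≤ C₁ * M := fun n =>
    (hc n).trans (mul_le_mul_of_nonneg_left (hR n) hC₁)
  have hBz : ∀ n, ‖B (v n - c n • e)‖ ≤ L := fun n => by
    refine (h₃ _).trans ?_
    rw [gradMap_sub_smul_constOne]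
    have h4 := (h₂ (v n - c n • e)).trans (mul_le_mul_of_nonneg_left (hJz n) hC₂)
    exact add_le_add (mul_le_mul_of_nonneg_left h4 hC₃)
      (mul_le_mul_of_nonneg_left (hD n) zero_le_one)
  have hBe : 0 < ‖B e‖ := norm_pos_iff.mpr (weightMap_constOne_ne_zero hΩ hab hq hqr)
  have hcb : ∀ n, |c n| ≤ 2 * L / ‖B e‖ := fun n => by
    have h4 := (horth n) (-(c n))
    rw [neg_smul, ← sub_eq_add_neg, ← map_smul, ← map_sub] at h4
    rw [le_div_iff₀ hBe, ← Real.norm_eq_abs, ← norm_smul, ← map_smul]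
    have e1 : B (c n • e) = B (v n) - B (v n - c n • e) := by rw [map_sub]; abel
    rw [e1]
    refine (norm_sub_le _ _).trans ?_
    linarith [hBz n]
  set M₂ := C₁ * M + 2 * L / ‖B e‖ * ‖valueMap hΩ le_rfl e‖ with hM₂
  have hJ : ∀ n, ‖valueMap hΩ le_rfl (v n)‖ ≤ M₂ := fun n => by
    have e1 : valueMap hΩ le_rfl (v n) = valueMap hΩ le_rfl (v n - c n • e) +
        c n • valueMap hΩ le_rfl e := by rw [map_sub, map_smul]; abel
    rw [e1]
    refine (norm_add_le _ _).trans (add_le_add (hJz n) ?_)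
    rw [norm_smul, Real.norm_eq_abs]
    exact mul_le_mul_of_nonneg_right (hcb n) (norm_nonneg _)
  obtain ⟨φ, v₀, hφ, hv₀, hlim⟩ := rellich hΩ hr1 (fun n => (hv n).hasWeakGradient)
    (fun n => (hv n).1) (fun n => (hv n).memLp_weakGradient hΩ.isOpen) (M := max M M₂)
    (fun n => by
      rw [eLpNorm_eq_valueMap hΩ le_rfl]
      exact ENNReal.ofReal_le_ofReal ((hJ n).trans (le_max_right _ _)))
    (fun n => (hGr n).trans (ENNReal.ofReal_le_ofReal (le_max_left _ _)))
  have hJlim : Tendsto (fun n => valueMap hΩ le_rfl (v (φ n))) atTop (𝓝 (hv₀.toLp v₀)) :=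
    (Lp.tendsto_Lp_iff_tendsto_eLpNorm'' _ (fun n => (hv (φ n)).1) _ hv₀).mpr hlim
  have hsmall : ∀ ε : ℝ, 0 < ε → ∃ C : ℝ, 0 ≤ C ∧ ∀ u : sobolevSpace Ω r,
      ‖B u‖ ≤ C * ‖valueMap hΩ (le_refl r) u‖ + ε * ‖D u‖ := fun ε hε => by
    obtain ⟨C, hC, h⟩ := weightMap_norm_le hΩ hab hq hqr hε
    refine ⟨C * C₂, by positivity, fun u => (h u).trans ?_⟩
    rw [mul_assoc]
    exact add_le_add_left (mul_le_mul_of_nonneg_left (h₂ u) hC) _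
  have hBcauchy : CauchySeq fun n => B (v (φ n)) := by
    rw [cauchySeq_iff_tendsto_dist_atTop_0]
    have hJc := cauchySeq_iff_tendsto_dist_atTop_0.mp hJlim.cauchySeq
    simp only [dist_eq_norm, ← map_sub] at hJc ⊢
    refine tendsto_zero_of_norm_le hsmall (M := M + M) (fun i => ?_) hJc
    rw [map_sub]
    exact (norm_sub_le _ _).trans (add_le_add (hD _) (hD _))
  obtain ⟨y, hy⟩ := cauchySeq_tendsto_of_complete hBcauchy
  refine ⟨φ, hφ, y, hy, fun hAc => ?_⟩
  obtain ⟨G, hG⟩ := cauchySeq_tendsto_of_complete hAc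
  have hGm : ∀ n, AEStronglyMeasurable (weakGradient Ω (v (φ n))) (domainMeasure Ω) := fun n =>
    ((hv (φ n)).memLp_weakGradient hΩ.isOpen).1
  have hGlim : Tendsto (fun n => eLpNorm (fun x => weakGradient Ω (v (φ n)) x - G x)
      (ENNReal.ofReal p) (domainMeasure Ω)) atTop (𝓝 0) := by
    refine ((Lp.tendsto_Lp_iff_tendsto_eLpNorm' _ _).mp hG).congr fun n => eLpNorm_congr_ae ?_
    filter_upwards [coeFn_gradMap hΩ hpr (v (φ n))] with x hx
    rw [Pi.sub_apply, hx]
  have hp0 : ENNReal.ofReal p ≠ 0 := (one_pos.trans_le (one_le_ofReal hp.le)).ne'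
  -- the gradients converge only in `L^p`, but their bound in `L^r` passes to the limit
  have hGmr : MemLp G (ENNReal.ofReal r) (domainMeasure Ω) :=
    ⟨(Lp.memLp G).1, (eLpNorm_le_of_tendsto hp0 hGm (Lp.memLp G).1 hGlim
      (Eventually.of_forall fun n => hGr (φ n))).trans_lt ENNReal.ofReal_lt_top⟩
  have hwG : HasWeakGradient Ω v₀ G := HasWeakGradient.of_tendsto hΩ hr1 hp.le
    (fun n => (hv (φ n)).hasWeakGradient) (fun n => (hv (φ n)).1)
    (fun n => (hv (φ n)).memLp_weakGradient_of_le hΩ hpr) hv₀ (Lp.memLp G) hlim hGlim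
  have hGae := hwG.weakGradient_ae_eq hΩ.isOpen
  let w : sobolevSpace Ω r := ⟨v₀, hv₀, G, hwG, hGmr⟩
  have hAw : gradMap hΩ hpr w = G := Lp.ext ((coeFn_gradMap hΩ hpr w).trans hGae)
  have hBw : Tendsto (fun n => B (v (φ n))) atTop (𝓝 (B w)) := by
    rw [tendsto_iff_norm_sub_tendsto_zero]
    have hJw : Tendsto (fun n => valueMap hΩ le_rfl (v (φ n))) atTop
        (𝓝 (valueMap hΩ le_rfl w)) := hJlim
    rw [tendsto_iff_norm_sub_tendsto_zero] at hJw
    simp only [← map_sub] at hJw ⊢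
    refine tendsto_zero_of_norm_le hsmall (M := M + ‖D w‖) (fun i => ?_) hJw
    rw [map_sub]
    exact (norm_sub_le _ _).trans (add_le_add_left (hD _) _)
  refine ⟨w, tendsto_nhds_unique hBw hy, hAw ▸ hG, fun M' hM' => ?_⟩
  obtain ⟨n, hn⟩ := hM'.exists
  have h5 := eLpNorm_le_of_tendsto (p' := ENNReal.ofReal q) (K := ENNReal.ofReal M') hp0 hGm
    (Lp.memLp G).1 hGlim (hM'.mono fun n hn => by
      rw [eLpNorm_eq_gradMap hΩ hqr]; exact ENNReal.ofReal_le_ofReal hn)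
  rw [← eLpNorm_congr_ae hGae] at h5
  have h6 := eLpNorm_eq_gradMap hΩ hqr w
  rw [h6] at h5
  exact (ENNReal.ofReal_le_ofReal_iff ((norm_nonneg _).trans hn)).mp h5

end ConeCompactness

/-! ### The forms, the cone and the Rayleigh quotient in terms of the operators -/

section Forms

variable {Ω : Set (Space N)} {a b : Space N → ℝ} {p q : ℝ} {u w : Space N → ℝ}

theorem weightForm_eq_dualForm (hΩ : IsSmoothBoundedDomain Ω) (hab : AdmissibleWeights Ω a b)
    (hq : 1 < q) (hu : MemSobolev Ω (max p q) u) (hw : MemSobolev Ω (max p q) w) :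
    weightForm Ω p q a b u w = dualForm (weightMeasure Ω a b) q (jointValue Ω (max p q) u)
      (jointValue Ω (max p q) w) := by
  have hqr : q ≤ max p q := le_max_right _ _
  have hr : 1 < max p q := hq.trans_le hqr
  rw [dualForm, hab.integral_weightMeasure
    (k₁ := fun x => ‖u x‖ ^ (q - 2) * inner ℝ (u x) (w x))
    (k₂ := fun x => ‖trace Ω (max p q) u x‖ ^ (q - 2) *
      inner ℝ (trace Ω (max p q) u x) (trace Ω (max p q) w x)) ?_ ?_
    (integrable_dualForm hq (hu.of_exponent_le hΩ hqr).1 (hw.of_exponent_le hΩ hqr).1)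
    (integrable_dualForm hq (hu.memLp_trace hΩ hr hqr) (hw.memLp_trace hΩ hr hqr))]
  · rw [weightForm]
    congr 1
    · congr 1; ext x
      simp only [Real.norm_eq_abs, RCLike.inner_apply, conj_trivial]; ring
    · congr 1; ext x
      simp only [Real.norm_eq_abs, RCLike.inner_apply, conj_trivial]; ring
  · filter_upwards [jointValue_ae_domain (r := max p q) (u := u) hΩ,
      jointValue_ae_domain (r := max p q) (u := w) hΩ] with x h1 h2
    rw [h1, h2]
  · filter_upwards [jointValue_ae_boundary (r := max p q) (u := u) hΩ,
      jointValue_ae_boundary (r := max p q) (u := w) hΩ] with x h1 h2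
    rw [h1, h2]

theorem pqForm_eq_dualForm (hΩ : IsSmoothBoundedDomain Ω) (hp : 1 < p) (hq : 1 < q)
    (hu : MemSobolev Ω (max p q) u) (hw : MemSobolev Ω (max p q) w) :
    pqForm Ω p q u w = dualForm (domainMeasure Ω) p (weakGradient Ω u) (weakGradient Ω w) +
      dualForm (domainMeasure Ω) q (weakGradient Ω u) (weakGradient Ω w) := by
  rw [dualForm, dualForm, ← integral_add
    (integrable_dualForm hp (hu.memLp_weakGradient_of_le hΩ (le_max_left _ _))
      (hw.memLp_weakGradient_of_le hΩ (le_max_left _ _)))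
    (integrable_dualForm hq (hu.memLp_weakGradient_of_le hΩ (le_max_right _ _))
      (hw.memLp_weakGradient_of_le hΩ (le_max_right _ _)))]
  simp only [pqForm, add_mul]

theorem weightForm_constOne (hΩ : IsSmoothBoundedDomain Ω) (hab : AdmissibleWeights Ω a b)
    (hq : 1 < q) (u : sobolevSpace Ω (max p q)) :
    weightForm Ω p q a b u (fun _ => 1) = dualForm (weightMeasure Ω a b) q
      (weightMap hΩ hab hq (le_max_right p q) u)
      (weightMap hΩ hab hq (le_max_right p q) (constOne hΩ (max p q))) := by
  refine (weightForm_eq_dualForm hΩ hab hq u.2 (constOne hΩ (max p q)).2).trans ?_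
  exact dualForm_congr (coeFn_weightMap hΩ hab hq _ u).symm (coeFn_weightMap hΩ hab hq _ _).symm

/-- The cone of the problem consists of the functions whose values are Birkhoff orthogonal to the
constants in `L^q` of the weight measure. -/
theorem mem_cone_iff [Fact (1 ≤ ENNReal.ofReal q)] (hΩ : IsSmoothBoundedDomain Ω)
    (hab : AdmissibleWeights Ω a b) (hq : 1 < q) (u : sobolevSpace Ω (max p q)) :
    (u : Space N → ℝ) ∈ cone Ω p q a b ↔
      BirkhoffOrth (weightMap hΩ hab hq (le_max_right p q) (constOne hΩ (max p q)))
        (weightMap hΩ hab hq (le_max_right p q) u) := by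
  have hr : 1 < max p q := hq.trans_le (le_max_right _ _)
  rw [birkhoffOrth_iff_dualForm_eq_zero hq, ← weightForm_constOne]
  have hu : MemSobolev Ω (max p q) u := u.2
  have e : weightForm Ω p q a b u (fun _ => 1) =
      (∫ x, a x * |(u : Space N → ℝ) x| ^ (q - 2) * (u : Space N → ℝ) x ∂(domainMeasure Ω)) +
      (∫ x, b x * |trace Ω (max p q) u x| ^ (q - 2) * trace Ω (max p q) u x
        ∂(boundaryMeasure Ω)) := by
    rw [weightForm]
    congr 1
    · simp only [mul_one]
    · refine integral_congr_ae ?_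
      filter_upwards [trace_ae_eq_of_contDiff (r := max p q) hΩ hr
        (contDiff_const (c := (1 : ℝ)))] with x hx
      rw [hx, mul_one]
  rw [e]
  exact ⟨fun h => h.2, fun h => ⟨hu, h⟩⟩

theorem rayleigh_eq (hΩ : IsSmoothBoundedDomain Ω) (hab : AdmissibleWeights Ω a b)
    (hq : 1 < q) (u : sobolevSpace Ω (max p q)) :
    rayleigh Ω p q a b u =
      ENNReal.ofReal (‖gradMap hΩ (le_max_right p q) u‖ ^ q) /
        ENNReal.ofReal (‖weightMap hΩ hab hq (le_max_right p q) u‖ ^ q) := by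
  have hqr : q ≤ max p q := le_max_right _ _
  have hr : 1 < max p q := hq.trans_le hqr
  have hu : MemSobolev Ω (max p q) u := u.2
  have e1 : ‖gradMap hΩ hqr u‖ ^ q = ∫ x, ‖weakGradient Ω u x‖ ^ q ∂(domainMeasure Ω) := by
    rw [Lp_norm_rpow hq]
    refine integral_congr_ae ?_
    filter_upwards [coeFn_gradMap hΩ hqr u] with x hx
    rw [hx]
  have e2 : ‖weightMap hΩ hab hq hqr u‖ ^ q =
      (∫ x, a x * |(u : Space N → ℝ) x| ^ q ∂(domainMeasure Ω)) +
      ∫ x, b x * |trace Ω (max p q) u x| ^ q ∂(boundaryMeasure Ω) := by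
    simp only [← Real.norm_eq_abs]
    rw [Lp_norm_rpow hq, ← hab.integral_weightMeasure
      (k := fun x => ‖jointValue Ω (max p q) u x‖ ^ q) ?_ ?_
      (MemLp_integrable_rpow hq (hu.of_exponent_le hΩ hqr).1)
      (MemLp_integrable_rpow hq (hu.memLp_trace hΩ hr hqr))]
    · refine integral_congr_ae ?_
      filter_upwards [coeFn_weightMap hΩ hab hq hqr u] with x hx
      rw [hx]
    · filter_upwards [jointValue_ae_domain (r := max p q) (u := u) hΩ] with x hx
      rw [hx]
    · filter_upwards [jointValue_ae_boundary (r := max p q) (u := u) hΩ] with x hx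
      rw [hx]
  rw [rayleigh, e1, e2]

end Forms

/-! ### The weight measure is not a point mass -/

section Finiteness

variable {Ω : Set (Space N)} {a b : Space N → ℝ} {p q r : ℝ}

/-- A ray from a point of a bounded domain meets the boundary. -/
theorem exists_frontier_ray (hΩ : IsSmoothBoundedDomain Ω) {x v : Space N} (hx : x ∈ Ω)
    (hv : v ≠ 0) : ∃ t : ℝ, 0 < t ∧ x + t • v ∈ frontier Ω := by
  by_contra! hcon
  set S : Set (Space N) := (fun t : ℝ => x + t • v) '' Set.Ici 0 with hS
  have hpre : IsPreconnected S := isPreconnected_Ici.image _ (by fun_prop)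
  have hsub : S ⊆ Ω := by
    refine hpre.subset_of_closure_inter_subset hΩ.isOpen ⟨x, ⟨0, by simp⟩, hx⟩ ?_
    rintro _ ⟨hcl, t, ht, rfl⟩
    by_contra hn
    rcases (Set.mem_Ici.mp ht).eq_or_lt with h | h
    · exact hn (by simpa [← h] using hx)
    · exact hcon t h (by rw [hΩ.isOpen.frontier_eq]; exact ⟨hcl, hn⟩)
  obtain ⟨R, hR⟩ := hΩ.isBounded.exists_norm_le
  have hv' : 0 < ‖v‖ := norm_pos_iff.mpr hv
  have hR0 : 0 ≤ R := (norm_nonneg x).trans (hR x hx)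
  have h1 := hR _ (hsub ⟨(2 * R + 1) / ‖v‖, Set.mem_Ici.mpr (by positivity), rfl⟩)
  have h2 : ‖((2 * R + 1) / ‖v‖) • v‖ = 2 * R + 1 := by
    rw [norm_smul, Real.norm_of_nonneg (by positivity), div_mul_cancel₀ _ hv'.ne']
  have h3 := norm_sub_le (x + ((2 * R + 1) / ‖v‖) • v) x
  rw [add_sub_cancel_left, h2] at h3
  linarith [hR x hx]

/-- The boundary has a point different from any given one: take a line through the domain and
follow it in both directions. -/
theorem exists_frontier_ne (hN : 1 ≤ N) (hΩ : IsSmoothBoundedDomain Ω) (z : Space N) :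
    ∃ y ∈ frontier Ω, y ≠ z := by
  obtain ⟨x, hx⟩ := hΩ.isConnected.nonempty
  set v : Space N := EuclideanSpace.single (⟨0, hN⟩ : Fin N) (1 : ℝ)
  have hv : v ≠ 0 := fun h => by
    have := congrArg (fun x : Space N => x ⟨0, hN⟩) h
    simp [v] at this
  obtain ⟨t, ht, h1⟩ := exists_frontier_ray hΩ hx hv
  obtain ⟨t', ht', h2⟩ := exists_frontier_ray hΩ hx (neg_ne_zero.mpr hv)
  by_cases hz : x + t • v = z
  · refine ⟨_, h2, fun h => ?_⟩
    rw [← hz, smul_neg, ← neg_smul, add_right_inj, ← sub_eq_zero, ← sub_smul, smul_eq_zero] at h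
    rcases h with h | h
    · linarith
    · exact hv h
  · exact ⟨_, h1, hz⟩

theorem ae_ne_domain (hN : 1 ≤ N) (z : Space N) : ∀ᵐ x ∂(domainMeasure Ω), x ≠ z := by
  have : Nonempty (Fin N) := ⟨⟨0, hN⟩⟩
  refine measure_eq_zero_iff_ae_notMem.mp (?_ : domainMeasure Ω {z} = 0)
  exact le_antisymm ((Measure.restrict_apply_le _ _).trans_eq (measure_singleton z)) zero_le

theorem ae_ne_boundary (hN : 2 ≤ N) (z : Space N) : ∀ᵐ x ∂(boundaryMeasure Ω), x ≠ z := by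
  refine measure_eq_zero_iff_ae_notMem.mp (?_ : boundaryMeasure Ω {z} = 0)
  refine le_antisymm ((Measure.restrict_apply_le _ _).trans_eq ?_) zero_le
  have := Measure.nullSingletonClass_hausdorff (Space N) (d := ((N - 1 : ℕ) : ℝ))
    (by have : 0 < N - 1 := by omega
        exact_mod_cast this)
  rw [Measure.euclideanHausdorffMeasure_def, Measure.smul_apply, measure_singleton, smul_zero]

/-- The weight measure is not concentrated at a single point, except when the domain is an
interval, `a` vanishes and `b` vanishes at one of the end points. -/
theorem not_ae_eq_point (hN : 1 ≤ N) (hΩ : IsSmoothBoundedDomain Ω) (hab : AdmissibleWeights Ω a b)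
    (h : 2 ≤ N ∨ 0 < (∫ x, a x ∂(domainMeasure Ω)) ∨ ∀ x ∈ frontier Ω, 0 < b x) (z : Space N) :
    ¬ ∀ᵐ x ∂(weightMeasure Ω a b), x = z := by
  intro hz
  obtain ⟨hz1, hz2⟩ := ae_add_measure_iff.mp hz
  have hN2 : ¬ 2 ≤ N := fun hN2 => by
    have h1 := ae_weightMeasure (a := a) (b := b) (ae_ne_domain (Ω := Ω) hN z) (ae_ne_boundary hN2 z)
    have h2 : ∀ᵐ _x ∂(weightMeasure Ω a b), False := by
      filter_upwards [hz, h1] with x h3 h4 using h4 h3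
    rw [Filter.eventually_false_iff_eq_bot, ae_eq_bot] at h2
    exact hab.weightMeasure_ne_zero hΩ h2
  rcases h with h | h | h
  · exact hN2 h
  · have h1 : ∀ᵐ _x ∂((domainMeasure Ω).withDensity fun x => ENNReal.ofReal (a x)), False := by
      filter_upwards [hz1, (withDensity_absolutelyContinuous _ _).ae_le (ae_ne_domain hN z)]
        with x h3 h4 using h4 h3
    rw [Filter.eventually_false_iff_eq_bot, ae_eq_bot,
      withDensity_eq_zero_iff hab.memLp_left.1.aemeasurable.ennreal_ofReal] at h1
    have h2 : ∫ x, a x ∂(domainMeasure Ω) ≤ 0 := integral_nonpos_of_ae <| by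
      filter_upwards [h1] with x hx
      exact ENNReal.ofReal_eq_zero.mp hx
    linarith
  · obtain ⟨y, hy, hyz⟩ := exists_frontier_ne hN hΩ z
    obtain rfl : N = 1 := by omega
    have h1 : ((boundaryMeasure Ω).withDensity fun x => ENNReal.ofReal (b x)) {y} = 0 :=
      measure_mono_null (fun x hx => by rw [Set.mem_singleton_iff.mp hx]; exact hyz) hz2
    rw [withDensity_apply_eq_zero' hab.memLp_right.1.aemeasurable.ennreal_ofReal,
      Set.inter_eq_self_of_subset_right (by
        rintro x rfl
        exact (ENNReal.ofReal_pos.mpr (h x hy)).ne'), boundaryMeasure,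
      Measure.restrict_apply (measurableSet_singleton y),
      Set.inter_eq_self_of_subset_left (Set.singleton_subset_iff.mpr hy)] at h1
    -- for `N = 1` the surface measure counts points
    simp at h1

/-- If the weight measure is not concentrated at a point, then some coordinate function has joint
values different from all constants. -/
theorem exists_weightMap_ne_smul (hN : 1 ≤ N) (hΩ : IsSmoothBoundedDomain Ω)
    (hab : AdmissibleWeights Ω a b) (hq : 1 < q) (hqr : q ≤ r)
    (h : 2 ≤ N ∨ 0 < (∫ x, a x ∂(domainMeasure Ω)) ∨ ∀ x ∈ frontier Ω, 0 < b x) :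
    ∃ u : sobolevSpace Ω r, ∀ c : ℝ,
      weightMap hΩ hab hq hqr u ≠ c • weightMap hΩ hab hq hqr (constOne hΩ r) := by
  by_contra! hcon
  have hφ : ∀ i : Fin N, ContDiff ℝ ∞ fun x : Space N => x i := fun i =>
    (EuclideanSpace.proj i : Space N →L[ℝ] ℝ).contDiff
  choose c hc using fun i => hcon ⟨fun x => x i, memSobolev_of_contDiff hΩ (hφ i)⟩
  refine not_ae_eq_point hN hΩ hab h (WithLp.toLp 2 c) ?_
  have hall : ∀ i, ∀ᵐ x ∂(weightMeasure Ω a b), x i = c i := fun i => by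
    have h1 := coeFn_weightMap hΩ hab hq hqr ⟨fun x => x i, memSobolev_of_contDiff hΩ (hφ i)⟩
    rw [hc i] at h1
    filter_upwards [h1, jointValue_of_contDiff (a := a) (b := b) hΩ (hq.trans_le hqr) (hφ i),
      Lp.coeFn_smul (c i) (weightMap hΩ hab hq hqr (constOne hΩ r)),
      coeFn_weightMap_constOne hΩ hab hq hqr] with x h2 h3 h4 h5
    rw [h4, Pi.smul_apply, h5, smul_eq_mul, mul_one] at h2
    rw [h2]
    exact h3.symm
  filter_upwards [ae_all_iff.mpr hall] with x hx
  ext i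
  exact hx i

end Finiteness

/-! ### The spectrum -/

section Spectrum

variable {Ω : Set (Space N)} {a b : Space N → ℝ} {p q : ℝ}

theorem lambdaOne_pos (hΩ : IsSmoothBoundedDomain Ω) (hab : AdmissibleWeights Ω a b)
    (hq : 1 < q) : 0 < lambdaOne Ω p q a b := by
  have hq1 : Fact (1 ≤ ENNReal.ofReal q) := ⟨one_le_ofReal hq.le⟩
  have hqr : q ≤ max p q := le_max_right _ _
  obtain ⟨C, hC, h⟩ := exists_weightMap_le_gradMap hΩ hab hq hqr
  have hK : 0 < (C + 1) ^ q := by positivity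
  have hpos : 0 < (ENNReal.ofReal ((C + 1) ^ q))⁻¹ := ENNReal.inv_pos.mpr ENNReal.ofReal_ne_top
  refine hpos.trans_le (le_iInf₂ fun w hw => ?_)
  obtain ⟨hw, hw0⟩ := hw
  obtain ⟨u, rfl⟩ : ∃ u : sobolevSpace Ω (max p q), (u : Space N → ℝ) = w := ⟨⟨w, hw.1⟩, rfl⟩
  rw [mem_cone_iff hΩ hab hq] at hw
  have hg : 0 < ‖gradMap hΩ hqr u‖ := norm_pos_iff.mpr fun h0 =>
    hw0 (ae_eq_zero_of_birkhoffOrth hΩ hab hq hqr hq.le hqr hw h0)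
  rw [rayleigh_eq hΩ hab hq, ENNReal.le_div_iff_mul_le (Or.inr (ENNReal.ofReal_pos.mpr
    (by positivity)).ne') (Or.inl ENNReal.ofReal_ne_top),
    ENNReal.inv_mul_le_iff (ENNReal.ofReal_pos.mpr hK).ne' ENNReal.ofReal_ne_top,
    ← ENNReal.ofReal_mul hK.le]
  refine ENNReal.ofReal_le_ofReal ?_
  rw [← Real.mul_rpow (by positivity) (norm_nonneg _)]
  refine Real.rpow_le_rpow (norm_nonneg _) ((h u hw).trans ?_) (by linarith)
  gcongr
  linarith

theorem lambdaOne_lt_top (hN : 1 ≤ N) (hΩ : IsSmoothBoundedDomain Ω)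
    (hab : AdmissibleWeights Ω a b) (hq : 1 < q)
    (h : 2 ≤ N ∨ 0 < (∫ x, a x ∂(domainMeasure Ω)) ∨ ∀ x ∈ frontier Ω, 0 < b x) :
    lambdaOne Ω p q a b < ⊤ := by
  have hq1 : Fact (1 ≤ ENNReal.ofReal q) := ⟨one_le_ofReal hq.le⟩
  have hqr : q ≤ max p q := le_max_right _ _
  obtain ⟨u, hu⟩ := exists_weightMap_ne_smul (q := q) (r := max p q) hN hΩ hab hq hqr h
  obtain ⟨c, hc⟩ := exists_birkhoffOrth_add _ (weightMap hΩ hab hq hqr u)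
    (weightMap_constOne_ne_zero hΩ hab hq hqr)
  rw [← map_smul, ← map_add] at hc
  set w := u + c • constOne hΩ (max p q) with hw
  have hBw : weightMap hΩ hab hq hqr w ≠ 0 := fun h0 => by
    refine hu (-c) ?_
    rw [hw, map_add, map_smul] at h0
    rw [neg_smul]
    exact eq_neg_of_add_eq_zero_left h0
  have hw0 : ¬ ((w : Space N → ℝ) =ᵐ[domainMeasure Ω] 0) := fun h0 => hBw (by
    rw [weightMap_eq_smul_of_ae_eq_const hΩ hab hq hqr (c := 0) h0, zero_smul])
  refine (iInf₂_le (w : Space N → ℝ) ⟨(mem_cone_iff hΩ hab hq w).mpr hc, hw0⟩).trans_lt ?_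
  rw [rayleigh_eq hΩ hab hq]
  refine ENNReal.div_lt_top ENNReal.ofReal_ne_top (ENNReal.ofReal_pos.mpr ?_).ne'
  have := norm_pos_iff.mpr hBw
  positivity

theorem isEigenvalue_zero (hΩ : IsSmoothBoundedDomain Ω) : IsEigenvalue Ω p q a b 0 := by
  refine ⟨fun _ => 1, memSobolev_of_contDiff hΩ contDiff_const, fun h => ?_, fun w _ => ?_⟩
  · have h1 : ∀ᵐ _x ∂(domainMeasure Ω), False := by
      filter_upwards [h] with x hx using one_ne_zero hx
    rw [Filter.eventually_false_iff_eq_bot, ae_eq_bot, domainMeasure,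
      Measure.restrict_eq_zero] at h1
    exact (hΩ.isOpen.measure_pos volume hΩ.isConnected.nonempty).ne' h1
  · rw [zero_mul, pqForm, ← integral_zero (Space N) ℝ (μ := domainMeasure Ω)]
    refine integral_congr_ae ?_
    filter_upwards [weakGradient_const_ae_eq hΩ.isOpen 1] with x hx
    rw [hx, Pi.zero_apply, inner_zero_left, mul_zero]

/-- Testing the equation with the constant one shows that an eigenfunction of a nonzero eigenvalue
lies in the cone, and testing it with itself that the eigenvalue exceeds the Rayleigh quotient, the
term `∫ |∇u|^p` being positive. -/
theorem IsEigenvalue.lambdaOne_lt (hΩ : IsSmoothBoundedDomain Ω) (hab : AdmissibleWeights Ω a b)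
    (hp : 1 < p) (hq : 1 < q) {lam : ℝ} (h : IsEigenvalue Ω p q a b lam) (hlam : lam ≠ 0) :
    lambdaOne Ω p q a b < ENNReal.ofReal lam := by
  have hp1 : Fact (1 ≤ ENNReal.ofReal p) := ⟨one_le_ofReal hp.le⟩
  have hq1 : Fact (1 ≤ ENNReal.ofReal q) := ⟨one_le_ofReal hq.le⟩
  have hpr : p ≤ max p q := le_max_left _ _
  have hqr : q ≤ max p q := le_max_right _ _
  obtain ⟨u₀, hu₀, hu0, heq⟩ := h
  obtain ⟨u, rfl⟩ : ∃ u : sobolevSpace Ω (max p q), (u : Space N → ℝ) = u₀ := ⟨⟨u₀, hu₀⟩, rfl⟩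
  have horth : BirkhoffOrth (weightMap hΩ hab hq hqr (constOne hΩ (max p q)))
      (weightMap hΩ hab hq hqr u) := by
    have h1 := heq (fun _ => 1) (memSobolev_of_contDiff hΩ contDiff_const)
    have h2 : pqForm Ω p q u (fun _ => 1) = 0 := by
      rw [pqForm, ← integral_zero (Space N) ℝ (μ := domainMeasure Ω)]
      refine integral_congr_ae ?_
      filter_upwards [weakGradient_const_ae_eq hΩ.isOpen 1] with x hx
      rw [hx, Pi.zero_apply, inner_zero_right, mul_zero]
    rw [h2, weightForm_constOne hΩ hab hq] at h1
    rw [birkhoffOrth_iff_dualForm_eq_zero hq]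
    exact (mul_eq_zero.mp h1.symm).resolve_left hlam
  have hA : 0 < ‖gradMap hΩ hpr u‖ := norm_pos_iff.mpr fun h0 =>
    hu0 (ae_eq_zero_of_birkhoffOrth hΩ hab hq hqr hp.le hpr horth h0)
  have hself := heq u hu₀
  have e1 : ∀ {s : ℝ} (hs : 1 < s) (hsr : s ≤ max p q),
      dualForm (domainMeasure Ω) s (weakGradient Ω u) (weakGradient Ω u) =
        ‖gradMap hΩ hsr u‖ ^ s := fun hs hsr => by
    rw [Lp_norm_rpow hs, ← dualForm_self hs]
    exact dualForm_congr (coeFn_gradMap hΩ hsr u).symm (coeFn_gradMap hΩ hsr u).symm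
  have e2 : dualForm (weightMeasure Ω a b) q (jointValue Ω (max p q) u)
      (jointValue Ω (max p q) u) = ‖weightMap hΩ hab hq hqr u‖ ^ q := by
    rw [Lp_norm_rpow hq, ← dualForm_self hq]
    exact dualForm_congr (coeFn_weightMap hΩ hab hq hqr u).symm
      (coeFn_weightMap hΩ hab hq hqr u).symm
  rw [pqForm_eq_dualForm hΩ hp hq hu₀ hu₀, weightForm_eq_dualForm hΩ hab hq hu₀ hu₀, e1 hp hpr,
    e1 hq hqr, e2] at hself
  have hAp : 0 < ‖gradMap hΩ hpr u‖ ^ p := by positivity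
  have hDq : 0 ≤ ‖gradMap hΩ hqr u‖ ^ q := by positivity
  have hBq : 0 < ‖weightMap hΩ hab hq hqr u‖ ^ q := by
    refine lt_of_le_of_ne (by positivity) fun h0 => ?_
    rw [← h0, mul_zero] at hself
    linarith
  have hlt : ‖gradMap hΩ hqr u‖ ^ q < lam * ‖weightMap hΩ hab hq hqr u‖ ^ q := by linarith
  refine (iInf₂_le (u : Space N → ℝ) ⟨(mem_cone_iff hΩ hab hq u).mpr horth, hu0⟩).trans_lt ?_
  rw [rayleigh_eq hΩ hab hq, ENNReal.div_lt_iff (Or.inl (ENNReal.ofReal_pos.mpr hBq).ne')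
    (Or.inl ENNReal.ofReal_ne_top), ← ENNReal.ofReal_mul' hBq.le]
  exact (ENNReal.ofReal_lt_ofReal_iff_of_nonneg hDq).mpr hlt

/-- Every number above `λ₁` is an eigenvalue: an eigenfunction is a suitable multiple of the
constrained minimizer. -/
theorem isEigenvalue_of_lambdaOne_lt (hΩ : IsSmoothBoundedDomain Ω)
    (hab : AdmissibleWeights Ω a b) (hp : 1 < p) (hq : 1 < q) (hpq : p ≠ q) {lam : ℝ}
    (h : lambdaOne Ω p q a b < ENNReal.ofReal lam) : IsEigenvalue Ω p q a b lam := by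
  have hp1 : Fact (1 ≤ ENNReal.ofReal p) := ⟨one_le_ofReal hp.le⟩
  have hq1 : Fact (1 ≤ ENNReal.ofReal q) := ⟨one_le_ofReal hq.le⟩
  have hpr : p ≤ max p q := le_max_left _ _
  have hqr : q ≤ max p q := le_max_right _ _
  have hlam : 0 < lam := ENNReal.ofReal_pos.mp (zero_le.trans_lt h)
  obtain ⟨v, hv, hvlt⟩ := by simpa only [lambdaOne, iInf_lt_iff] using h
  obtain ⟨hvc, hv0⟩ := hv
  obtain ⟨v₀, rfl⟩ : ∃ u : sobolevSpace Ω (max p q), (u : Space N → ℝ) = v := ⟨⟨v, hvc.1⟩, rfl⟩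
  set B := weightMap hΩ hab hq hqr with hB
  set A := gradMap hΩ hpr with hA
  set D := gradMap hΩ hqr with hD
  set e := constOne hΩ (max p q) with he
  rw [mem_cone_iff hΩ hab hq] at hvc
  have hpos : 0 < lam * ‖B v₀‖ ^ q - ‖D v₀‖ ^ q := by
    have hDpos : 0 < ‖D v₀‖ := norm_pos_iff.mpr fun h0 =>
      hv0 (ae_eq_zero_of_birkhoffOrth hΩ hab hq hqr hq.le hqr hvc h0)
    have hDq : 0 < ‖D v₀‖ ^ q := by positivity
    rw [rayleigh_eq hΩ hab hq, ENNReal.div_lt_iff (Or.inr (ENNReal.ofReal_pos.mpr hDq).ne')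
      (Or.inl ENNReal.ofReal_ne_top), ← ENNReal.ofReal_mul hlam.le,
      ENNReal.ofReal_lt_ofReal_iff_of_nonneg hDq.le] at hvlt
    exact sub_pos.mpr hvlt
  have hBe : B e ≠ 0 := weightMap_constOne_ne_zero hΩ hab hq hqr
  have hAe : A e = 0 := gradMap_constOne hΩ hpr
  have hDe : D e = 0 := gradMap_constOne hΩ hqr
  obtain ⟨w, hworth, hwA, hw1, hmin⟩ := exists_constrained_minimizer (A := A) (D := D) (B := B)
    (e := e) hp hq hlam hAe hDe hBe (fun ε hε => exists_Lp_norm_sub_rpow_le hp hε)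
    (fun v hv => by
      obtain ⟨c, hc⟩ := exists_ae_eq_const_of_gradMap_eq_zero hΩ hp.le hpr hv
      exact ⟨c, weightMap_eq_smul_of_ae_eq_const hΩ hab hq hqr hc⟩)
    (coneCompact hΩ hab hp hq hpr hqr (max_choice p q)) hvc hpos
  have hw0 := (birkhoffOrth_iff_dualForm_eq_zero hq _ _).mp hworth
  set m := ‖A w‖ ^ p with hm
  have hm0 : 0 < m := by positivity
  have hEL : ∀ v : sobolevSpace Ω (max p q),
      dualForm (domainMeasure Ω) p (A w) (A v) + m * dualForm (domainMeasure Ω) q (D w) (D v) =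
        m * (lam * dualForm (weightMeasure Ω a b) q (B w) (B v)) := fun v =>
    euler_lagrange (A := A) (D := D) (B := B) (e := e) hp hq hlam hAe hDe hBe hw1 hmin
      (Lp_hasDerivAt_norm_rpow hp (A w) (A v)) (Lp_hasDerivAt_norm_rpow hq (D w) (D v))
      fun t c => by
        have h1 := Lp_norm_rpow_add_dualForm_le hq (B w) (t • B v + c • B e)
        rwa [Lp_dualForm_add_right hq, Lp_dualForm_smul_right, Lp_dualForm_smul_right, hw0,
          mul_zero, add_zero] at h1
  -- replacing `w` by `s • w` multiplies the two forms of exponent `q` by `s ^ (q - 1)` and the one of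
  -- exponent `p` by `s ^ (p - 1)`; this choice of `s` absorbs the factor `m`
  set s := m ^ (1 / (q - p)) with hs
  have hs0 : 0 < s := by positivity
  have hsm : s ^ (q - 1) = s ^ (p - 1) * m := by
    have h1 : s ^ (q - p) = m := by
      rw [hs, ← Real.rpow_mul hm0.le, one_div_mul_cancel (sub_ne_zero.mpr hpq.symm), Real.rpow_one]
    rw [← h1, ← Real.rpow_add hs0]
    congr 1; ring
  have hwS : MemSobolev Ω (max p q) w := w.2
  have hu : MemSobolev Ω (max p q) (s • (w : Space N → ℝ)) := hwS.const_smul s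
  refine ⟨s • (w : Space N → ℝ), hu, fun h0 => ?_, fun v hv => ?_⟩
  · have h1 : (w : Space N → ℝ) =ᵐ[domainMeasure Ω] fun _ => 0 := by
      filter_upwards [h0] with x hx
      exact (mul_eq_zero.mp hx).resolve_left hs0.ne'
    have h2 := hwS.weakGradient_ae_eq_of_ae_eq hΩ (hp.le.trans hpr)
      (memSobolev_of_contDiff hΩ contDiff_const) h1
    have h3 := eLpNorm_eq_gradMap hΩ hpr w
    rw [eLpNorm_congr_ae (h2.trans (weakGradient_const_ae_eq hΩ.isOpen 0)), eLpNorm_zero] at h3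
    exact (ENNReal.ofReal_pos.mpr hwA).ne h3
  · have hEL' := hEL ⟨v, hv⟩
    rw [pqForm_eq_dualForm hΩ hp hq hu hv, weightForm_eq_dualForm hΩ hab hq hu hv]
    have hgr := hwS.weakGradient_const_smul hΩ.isOpen s
    have hjv : jointValue Ω (max p q) (s • (w : Space N → ℝ)) =ᵐ[weightMeasure Ω a b]
        s • (B w : Space N → ℝ) := by
      have h1 : B (s • w) = s • B w := map_smul _ _ _
      have h2 := coeFn_weightMap hΩ hab hq hqr (s • w)
      rw [← hB, h1] at h2
      exact h2.symm.trans (Lp.coeFn_smul s (B w))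
    have e1 : ∀ {k : ℝ} (hk : k ≤ max p q), dualForm (domainMeasure Ω) k
        (weakGradient Ω (s • (w : Space N → ℝ))) (weakGradient Ω v) =
          s ^ (k - 1) * dualForm (domainMeasure Ω) k (gradMap hΩ hk w)
            (gradMap hΩ hk ⟨v, hv⟩) := fun hk => by
      rw [← dualForm_smul_left _ _ hs0]
      refine dualForm_congr (hgr.trans ?_) (coeFn_gradMap hΩ hk ⟨v, hv⟩).symm
      filter_upwards [coeFn_gradMap hΩ hk w] with x hx
      rw [Pi.smul_apply, Pi.smul_apply, hx]
    rw [e1 hpr, e1 hqr, dualForm_congr hjv (coeFn_weightMap hΩ hab hq hqr ⟨v, hv⟩).symm,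
      dualForm_smul_left _ _ hs0, hsm]
    linear_combination s ^ (p - 1) * hEL'

end Spectrum

end PQSteklov
end

theorem theorem1 (N : ℕ) (hN : 1 ≤ N) (Ω : Set (PQSteklov.Space N))
    (hΩ : PQSteklov.IsSmoothBoundedDomain Ω)
    (p q : ℝ) (hp : 1 < p) (hq : 1 < q) (hpq : p ≠ q)
    (a b : PQSteklov.Space N → ℝ)
    (ha : MemLp a ⊤ (PQSteklov.domainMeasure Ω))
    (hb : MemLp b ⊤ (PQSteklov.boundaryMeasure Ω))
    (ha0 : ∀ᵐ x ∂(PQSteklov.domainMeasure Ω), 0 ≤ a x)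
    (hb0 : ∀ᵐ x ∂(PQSteklov.boundaryMeasure Ω), 0 ≤ b x)
    (hab : 0 < (∫ x, a x ∂(PQSteklov.domainMeasure Ω)) +
      ∫ x, b x ∂(PQSteklov.boundaryMeasure Ω)) :
    0 < PQSteklov.lambdaOne Ω p q a b ∧
    ((2 ≤ N ∨ 0 < (∫ x, a x ∂(PQSteklov.domainMeasure Ω)) ∨ ∀ x ∈ frontier Ω, 0 < b x) →
      PQSteklov.lambdaOne Ω p q a b < ⊤) ∧
    {lam : ℝ | PQSteklov.IsEigenvalue Ω p q a b lam} =
      {0} ∪ {lam : ℝ | PQSteklov.lambdaOne Ω p q a b < ENNReal.ofReal lam} := by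
  have h : PQSteklov.AdmissibleWeights Ω a b := ⟨ha, hb, ha0, hb0, hab⟩
  refine ⟨PQSteklov.lambdaOne_pos hΩ h hq, PQSteklov.lambdaOne_lt_top hN hΩ h hq,
    Set.eq_of_subset_of_subset (fun lam hlam => ?_) (Set.union_subset ?_ fun lam hlam => ?_)⟩
  · by_cases h0 : lam = 0
    · exact Or.inl h0
    · exact Or.inr (PQSteklov.IsEigenvalue.lambdaOne_lt hΩ h hp hq hlam h0)
  · rintro _ rfl
    exact PQSteklov.isEigenvalue_zero hΩ
  · exact PQSteklov.isEigenvalue_of_lambdaOne_lt hΩ h hp hq hpq hlam
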